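/- For $a\in\mathbb R$ and $p\ge 1$ let $L^p_a$ be the space of measurable $u:(0,\infty)\to\mathbb R$ with $\|u\|_{L^p_a}=\left(\int_0^\infty |u|^p r^a\,dr\right)^{1/p}<\infty$. For an integer $k\ge 1$ and $(\alpha_0,\dots,\alpha_k)\in\mathbb R^{k+1}$ let $X^{k,p}_\infty=X^{k,p}_\infty(\alpha_0,\dots,\alpha_k)$ be the space of all $u:(0,\infty)\to\mathbb R$ whose weak derivatives satisfy $u^{(j)}\in L^p_{\alpha_j}$ for $j=0,\dots,k$, with the norm $\left(\sum_{j=0}^k\|u^{(j)}\|^p_{L^p_{\alpha_j}}\right)^{1/p}$. For $\theta,\gamma\in\mathbb R$ put $Lu=-r^{-\theta}(r^\gamma u')'$, and let $\nabla^k_Lu=L^{k/2}u$ if $k$ is even and $\nabla^k_Lu=(L^{(k-1)/2}u)'$ if $k$ is odd. **Theorem.** Let $k\ge1$, $p>1$, $\alpha_k-kp+1=0$, $\alpha_i\ge\alpha_k-(k-i)p$ for $i=1,\dots,k$, $\eta>-1$, $\theta+2>\gamma$, $\theta>\lfloor k/2\rfloor(\theta+2-\gamma)-1$, $\gamma=(2p-1+(p-1)\eta)/p$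 and $\alpha_0>-1$. Assume moreover that $\eta\le\alpha_j-jp$ for some $j\in\{0,\dots,k\}$ (for instance $\eta\le\alpha_0$). Let $$\beta_{0,k}=\begin{cases}(\eta+1)\left[(\gamma-1)(\theta+2-\gamma)^{k-2}\dfrac{\Gamma\left(\frac k2\right)\Gamma\left(\frac{\gamma-1}{\theta+2-\gamma}\right)}{\Gamma\left(\frac{\gamma-1}{\theta+2-\gamma}-\frac{k-2}2\right)}\right]^{\frac p{p-1}}&\text{if }k\text{ is even},\\[3ex](\eta+1)\left[(\gamma-1)(\theta+2-\gamma)^{k-2}\dfrac{\Gamma\left(\frac{k+1}2\right)\Gamma\left(\frac{\gamma-1}{\theta+2-\gamma}\right)}{\Gamma\left(\frac{\gamma-1}{\theta+2-\gamma}-\frac{k-3}2\right)}\right]^{\frac p{p-1}}&\text{if }k\text{ is odd}.\end{cases}$$ Let $F:[0,\infty)\times[0,\infty)\to[0,\infty)$, $(r,t)\mapsto F(r,t)$, be measurable in $r$ for each $t$, continuous in $t$ for each $r$, and bounded on every bounded subset of $[0,\infty)\times[0,\infty)$, and suppose that $$\lim_{t\to0^+}F(r,t)\,t^{-p}=0\quad\text{and}\quad\lim_{t\to\infty}F(r,t)\,t^{\frac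 p{p-1}}\exp\left(-\beta_{0,k}t^{\frac p{p-1}}\right)=0,\quad\text{both uniformly in }r\in[0,\infty).$$ If $(u_n)$ is a sequence in $X^{k,p}_\infty$ that converges weakly in $X^{k,p}_\infty$ to some $u_0\in X^{k,p}_\infty$, and $\|\nabla^k_Lu_n\|_{L^p_\nu}\le1$ for all $n$, where $\nu=\alpha_k+\lfloor k/2\rfloor(\theta-\gamma)p$, then $\int_0^\infty F(r,|u_n|)r^\eta\,dr$ (for every $n$) and $\int_0^\infty F(r,|u_0|)r^\eta\,dr$ are finite and $$\int_0^\infty F(r,|u_n|)\,r^\eta\,dr\longrightarrow\int_0^\infty F(r,|u_0|)\,r^\eta\,dr\qquad(n\to\infty).$$ -/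

import Mathlib

open MeasureTheory Set Filter Topology
open scoped ENNReal NNReal ContDiff

noncomputable section

/-- The measure `r ^ a dr` on the half-line `(0, ∞)`. -/
def weightMeasure (a : ℝ) : Measure ℝ :=
  (volume.restrict (Ioi (0 : ℝ))).withDensity (fun r => ENNReal.ofReal (r ^ a))

/-- `g` is a weak derivative of order `j` of `f` on `(0, ∞)`: both are locally integrable there and
`∫ f φ⁽ʲ⁾ = (-1)ʲ ∫ g φ` for all `φ ∈ C_c^∞(0, ∞)`. -/
def HasWeakDeriv (j : ℕ) (f g : ℝ → ℝ) : Prop :=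
  LocallyIntegrableOn f (Ioi 0) ∧ LocallyIntegrableOn g (Ioi 0) ∧
    ∀ φ : ℝ → ℝ, ContDiff ℝ ∞ φ → HasCompactSupport φ → tsupport φ ⊆ Ioi 0 →
      ∫ r in Ioi (0 : ℝ), f r * iteratedDeriv j φ r =
        (-1) ^ j * ∫ r in Ioi (0 : ℝ), g r * φ r

open Classical in
/-- The first order weak derivative on `(0, ∞)`, unique up to null sets if it exists
(and the zero function otherwise). -/
def weakDeriv (f : ℝ → ℝ) : ℝ → ℝ :=
  if h : ∃ g, HasWeakDeriv 1 f g then h.choose else 0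

/-- The operator `L u = - r ^ (-θ) (r ^ γ u')'` on `(0, ∞)`, with weak derivatives. -/
def opL (θ γ : ℝ) (u : ℝ → ℝ) : ℝ → ℝ :=
  fun r => -(r ^ (-θ) * weakDeriv (fun s => s ^ γ * weakDeriv u s) r)

/-- The generalized gradient of order `k`: `L ^ (k / 2) u` for even `k`, and
`(L ^ ((k - 1) / 2) u)'` for odd `k`. -/
def gradL (θ γ : ℝ) (k : ℕ) (u : ℝ → ℝ) : ℝ → ℝ :=
  if Even k then (opL θ γ)^[k / 2] u else weakDeriv ((opL θ γ)^[(k - 1) / 2] u)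

instance factOneLeOfReal (p : ℝ) [hp : Fact (1 ≤ p)] : Fact (1 ≤ ENNReal.ofReal p) :=
  ⟨by simpa using ENNReal.ofReal_le_ofReal hp.out⟩

/-- The product of the weighted spaces `L^p_{α_j}(0, ∞)`, `j = 0, …, k`, with the norm
`(∑ ‖f_j‖ ^ p) ^ (1 / p)`. -/
abbrev JetSpace (k : ℕ) (p : ℝ) (α : Fin (k + 1) → ℝ) : Type :=
  PiLp (ENNReal.ofReal p)
    (fun j : Fin (k + 1) => Lp ℝ (ENNReal.ofReal p) (weightMeasure (α j)))

lemma ae_eq_of_weightMeasure {a : ℝ} {f g : ℝ → ℝ} (h : f =ᵐ[weightMeasure a] g) :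
    g =ᵐ[volume.restrict (Ioi (0 : ℝ))] f := by
  refine EventuallyEq.symm ?_
  refine (withDensity_absolutelyContinuous' ?_ ?_).ae_le h
  · exact (ENNReal.measurable_ofReal.comp (measurable_id.pow_const a)).aemeasurable
  · filter_upwards [ae_restrict_mem measurableSet_Ioi] with r hr
    simpa using Real.rpow_pos_of_pos hr a

lemma integrableOn_mul_test {f φ : ℝ → ℝ}
    (hf : LocallyIntegrableOn f (Ioi 0)) (hc : Continuous φ) (hs : HasCompactSupport φ)
    (ht : tsupport φ ⊆ Ioi 0) : IntegrableOn (fun r => f r * φ r) (Ioi 0) := by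
  have h1 : IntegrableOn f (tsupport φ) := hf.integrableOn_compact_subset ht hs
  have h2 : IntegrableOn (fun r => f r * φ r) (tsupport φ) :=
    h1.mul_continuousOn hc.continuousOn hs
  refine (integrableOn_iff_integrable_of_support_subset ?_).1 h2 |>.integrableOn
  intro r hr
  apply subset_tsupport
  intro h0
  exact hr (by simp [h0])

lemma iteratedDeriv_test {φ : ℝ → ℝ} (j : ℕ) (h1 : ContDiff ℝ ∞ φ) (h2 : HasCompactSupport φ)
    (h3 : tsupport φ ⊆ Ioi 0) : Continuous (iteratedDeriv j φ) ∧
      HasCompactSupport (iteratedDeriv j φ) ∧ tsupport (iteratedDeriv j φ) ⊆ Ioi 0 := by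
  have hsub : ∀ i : ℕ, tsupport (iteratedDeriv i φ) ⊆ tsupport φ := by
    intro i
    induction i with
    | zero => simp
    | succ i ih =>
      rw [iteratedDeriv_succ]
      exact (closure_minimal (support_deriv_subset) (isClosed_tsupport _)).trans ih
  refine ⟨h1.continuous_iteratedDeriv j (by exact_mod_cast le_top), ?_, (hsub j).trans h3⟩
  exact h2.of_isClosed_subset (isClosed_tsupport _) (hsub j)

lemma HasWeakDeriv.congr {j : ℕ} {f g f' g' : ℝ → ℝ} (h : HasWeakDeriv j f g)
    (hf : f =ᵐ[volume.restrict (Ioi 0)] f') (hg : g =ᵐ[volume.restrict (Ioi 0)] g') :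
    HasWeakDeriv j f' g' := by
  refine ⟨h.1.congr hf, h.2.1.congr hg, fun φ h1 h2 h3 => ?_⟩
  have e1 : ∫ r in Ioi (0 : ℝ), f' r * iteratedDeriv j φ r =
      ∫ r in Ioi (0 : ℝ), f r * iteratedDeriv j φ r :=
    integral_congr_ae (by filter_upwards [hf] with r hr; rw [hr])
  have e2 : ∫ r in Ioi (0 : ℝ), g' r * φ r = ∫ r in Ioi (0 : ℝ), g r * φ r :=
    integral_congr_ae (by filter_upwards [hg] with r hr; rw [hr])
  rw [e1, e2]
  exact h.2.2 φ h1 h2 h3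

lemma HasWeakDeriv.add {j : ℕ} {f g f' g' : ℝ → ℝ} (h : HasWeakDeriv j f g)
    (h' : HasWeakDeriv j f' g') : HasWeakDeriv j (f + f') (g + g') := by
  refine ⟨h.1.add h'.1, h.2.1.add h'.2.1, fun φ h1 h2 h3 => ?_⟩
  obtain ⟨c1, c2, c3⟩ := iteratedDeriv_test j h1 h2 h3
  simp only [Pi.add_apply, add_mul]
  rw [integral_add (integrableOn_mul_test h.1 c1 c2 c3) (integrableOn_mul_test h'.1 c1 c2 c3),
    integral_add (integrableOn_mul_test h.2.1 h1.continuous h2 h3)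
      (integrableOn_mul_test h'.2.1 h1.continuous h2 h3),
    h.2.2 φ h1 h2 h3, h'.2.2 φ h1 h2 h3, mul_add]

lemma HasWeakDeriv.smul {j : ℕ} {f g : ℝ → ℝ} (c : ℝ) (h : HasWeakDeriv j f g) :
    HasWeakDeriv j (c • f) (c • g) := by
  refine ⟨h.1.smul c, h.2.1.smul c, fun φ h1 h2 h3 => ?_⟩
  simp only [Pi.smul_apply, smul_eq_mul, mul_assoc, integral_const_mul]
  rw [h.2.2 φ h1 h2 h3]
  ring

lemma HasWeakDeriv.zero (j : ℕ) : HasWeakDeriv j (0 : ℝ → ℝ) 0 :=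
  ⟨locallyIntegrableOn_zero, locallyIntegrableOn_zero, fun φ _ _ _ => by simp⟩

/-- The weighted Sobolev space `X^{k,p}_∞(α_0, …, α_k)`: all `u` whose weak derivatives satisfy
`u⁽ʲ⁾ ∈ L^p_{α_j}(0, ∞)` for `j = 0, …, k`, with the norm `(∑ ‖u⁽ʲ⁾‖ ^ p) ^ (1 / p)`. The function
`u` is stored with its derivatives, as the element `(u, u', …, u⁽ᵏ⁾)` of the product space. -/
def sobolevX (k : ℕ) (p : ℝ) [Fact (1 ≤ p)] (α : Fin (k + 1) → ℝ) :
    Submodule ℝ (JetSpace k p α) where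
  carrier := {f | ∀ j : Fin (k + 1), HasWeakDeriv (j : ℕ) (f 0 : ℝ → ℝ) (f j : ℝ → ℝ)}
  zero_mem' := fun j => (HasWeakDeriv.zero j).congr
    (ae_eq_of_weightMeasure (Lp.coeFn_zero ℝ _ _))
    (ae_eq_of_weightMeasure (Lp.coeFn_zero ℝ _ _))
  add_mem' := fun {f g} hf hg j => ((hf j).add (hg j)).congr
    (ae_eq_of_weightMeasure (Lp.coeFn_add (f 0) (g 0)))
    (ae_eq_of_weightMeasure (Lp.coeFn_add (f j) (g j)))
  smul_mem' := fun c f hf j => ((hf j).smul c).congr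
    (ae_eq_of_weightMeasure (Lp.coeFn_smul c (f 0)))
    (ae_eq_of_weightMeasure (Lp.coeFn_smul c (f j)))

/-- The underlying function `u` of an element of `X^{k,p}_∞`. -/
def sobolevFn {k : ℕ} {p : ℝ} [Fact (1 ≤ p)] {α : Fin (k + 1) → ℝ} (u : sobolevX k p α) :
    ℝ → ℝ := ((u : JetSpace k p α) 0 : ℝ → ℝ)

/-- The critical constant `β_{0,k}`. -/
def betaCrit (k : ℕ) (p η θ γ : ℝ) : ℝ :=
  if Even k then
    (η + 1) * ((γ - 1) * (θ + 2 - γ) ^ ((k : ℝ) - 2) *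
      (Real.Gamma ((k : ℝ) / 2) * Real.Gamma ((γ - 1) / (θ + 2 - γ)) /
        Real.Gamma ((γ - 1) / (θ + 2 - γ) - ((k : ℝ) - 2) / 2))) ^ (p / (p - 1))
  else
    (η + 1) * ((γ - 1) * (θ + 2 - γ) ^ ((k : ℝ) - 2) *
      (Real.Gamma (((k : ℝ) + 1) / 2) * Real.Gamma ((γ - 1) / (θ + 2 - γ)) /
        Real.Gamma ((γ - 1) / (θ + 2 - γ) - ((k : ℝ) - 3) / 2))) ^ (p / (p - 1))

end

lemma exists_Ioo_of_test {φ : ℝ → ℝ} (hs : HasCompactSupport φ) (ht : tsupport φ ⊆ Ioi 0) :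
    ∃ a b : ℝ, 0 < a ∧ a < b ∧ tsupport φ ⊆ Ioo a b := by
  rcases (tsupport φ).eq_empty_or_nonempty with h | h
  · exact ⟨1, 2, by norm_num, by norm_num, by simp [h]⟩
  · obtain ⟨x, hx, hx'⟩ := hs.exists_isLeast h
    obtain ⟨y, hy, hy'⟩ := hs.exists_isGreatest h
    have hx0 : 0 < x := ht hx
    have hxy : x ≤ y := hx' hy
    refine ⟨x / 2, y + 1, by linarith, by linarith, fun z hz => ⟨?_, ?_⟩⟩
    · have := hx' hz; linarith
    · have := hy' hz; linarith

lemma setIntegral_Ioi_eq_intervalIntegral {h : ℝ → ℝ} {a b : ℝ} (ha : 0 < a) (hab : a < b)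
    (hh : ∀ r, r ∉ Ioo a b → h r = 0) : ∫ r in Ioi (0 : ℝ), h r = ∫ r in a..b, h r := by
  rw [intervalIntegral.integral_of_le hab.le]
  refine setIntegral_eq_of_subset_of_forall_sdiff_eq_zero measurableSet_Ioi
    (fun x hx => ha.trans hx.1) fun x hx => hh x fun h' => hx.2 ⟨h'.1, h'.2.le⟩

lemma intervalIntegrable_of_locallyIntegrableOn {g : ℝ → ℝ} (hg : LocallyIntegrableOn g (Ioi 0))
    {a b : ℝ} (ha : 0 < a) (hb : 0 < b) : IntervalIntegrable g volume a b := by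
  rw [intervalIntegrable_iff]
  refine (hg.integrableOn_compact_subset (t := uIcc a b) ?_ isCompact_uIcc).mono_set
    uIoc_subset_uIcc
  intro x hx
  exact lt_of_lt_of_le (lt_min ha hb) hx.1

lemma continuousOn_primitive_Ioi {g : ℝ → ℝ} (hg : LocallyIntegrableOn g (Ioi 0)) :
    ContinuousOn (fun r => ∫ s in (1 : ℝ)..r, g s) (Ioi 0) := by
  intro x hx
  have hx0 : (0 : ℝ) < x := hx
  have hm : 0 < min (x / 2) 1 := lt_min (by linarith) one_pos
  have h1 := intervalIntegrable_of_locallyIntegrableOn hg hm (show 0 < x + 1 by linarith)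
  have h2 := intervalIntegral.continuousOn_primitive_interval' (a := 1) h1
    (by rw [uIcc_of_le (by linarith [min_le_right (x / 2) 1])]
        exact ⟨min_le_right _ _, by linarith⟩)
  refine (h2.continuousAt ?_).continuousWithinAt
  rw [uIcc_of_le (by linarith [min_le_right (x / 2) 1])]
  exact Icc_mem_nhds (by linarith [min_le_left (x / 2) 1]) (by linarith)

lemma hasWeakDeriv_primitive {g : ℝ → ℝ} (hg : LocallyIntegrableOn g (Ioi 0)) :
    HasWeakDeriv 1 (fun r => ∫ s in (1 : ℝ)..r, g s) g := by
  refine ⟨(continuousOn_primitive_Ioi hg).locallyIntegrableOn measurableSet_Ioi, hg,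
    fun φ h1 h2 h3 => ?_⟩
  obtain ⟨a, b, ha, hab, hsub⟩ := exists_Ioo_of_test h2 h3
  have hb : 0 < b := ha.trans hab
  have hφ0 : ∀ r, r ∉ Ioo a b → φ r = 0 := fun r hr =>
    image_eq_zero_of_notMem_tsupport fun h => hr (hsub h)
  have hφ1 : ∀ r, r ∉ Ioo a b → deriv φ r = 0 := fun r hr => by
    by_contra hne
    exact hr (hsub (support_deriv_subset hne))
  rw [iteratedDeriv_one, setIntegral_Ioi_eq_intervalIntegral ha hab
      (fun r hr => by rw [hφ1 r hr, mul_zero]),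
    setIntegral_Ioi_eq_intervalIntegral ha hab (fun r hr => by rw [hφ0 r hr, mul_zero])]
  have hgi := intervalIntegrable_of_locallyIntegrableOn hg ha hb
  set G : ℝ → ℝ := fun r => ∫ s in a..r, g s
  have hG : AbsolutelyContinuousOnInterval G a b :=
    hgi.absolutelyContinuousOnInterval_intervalIntegral left_mem_uIcc
  have hφc : ContDiff ℝ 1 φ := h1.of_le (by exact_mod_cast le_top)
  have hφ : AbsolutelyContinuousOnInterval φ a b := by
    obtain ⟨K, hK⟩ := hφc.lipschitzWith_of_hasCompactSupport h2 (by norm_num)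
    exact (hK.lipschitzOnWith).absolutelyContinuousOnInterval
  have hparts := hG.integral_mul_deriv_eq_deriv_mul hφ
  rw [hφ0 a (by simp), hφ0 b (by simp)] at hparts
  have e1 : ∫ r in a..b, (∫ s in (1 : ℝ)..r, g s) * deriv φ r =
      (∫ s in (1 : ℝ)..a, g s) * (∫ r in a..b, deriv φ r) + ∫ r in a..b, G r * deriv φ r := by
    rw [← intervalIntegral.integral_const_mul, ← intervalIntegral.integral_add]
    · refine intervalIntegral.integral_congr fun r hr => ?_
      rw [uIcc_of_le hab.le] at hr
      have := intervalIntegral.integral_add_adjacent_intervals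
        (intervalIntegrable_of_locallyIntegrableOn hg one_pos ha)
        (intervalIntegrable_of_locallyIntegrableOn hg ha (ha.trans_le hr.1))
      simp only [G]
      rw [← this]; ring
    · exact (continuous_const.mul (hφc.continuous_deriv le_rfl)).intervalIntegrable _ _
    · exact (hG.continuousOn.mul
        (hφc.continuous_deriv le_rfl).continuousOn).intervalIntegrable
  have e2 : ∫ r in a..b, deriv φ r = 0 := by
    rw [intervalIntegral.integral_deriv_eq_sub
      (fun x _ => (hφc.differentiable (by norm_num)).differentiableAt)
      ((hφc.continuous_deriv le_rfl).intervalIntegrable _ _), hφ0 a (by simp), hφ0 b (by simp)]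
    simp
  have e3 : ∫ r in a..b, deriv G r * φ r = ∫ r in a..b, g r * φ r := by
    refine intervalIntegral.integral_congr_ae ?_
    filter_upwards [hgi.ae_hasDerivAt_integral] with r hr hr'
    rw [(hr (uIoc_subset_uIcc hr') a left_mem_uIcc).deriv]
  rw [e1, e2, hparts, e3]
  ring

lemma HasWeakDeriv.sub {j : ℕ} {f g f' g' : ℝ → ℝ} (h : HasWeakDeriv j f g)
    (h' : HasWeakDeriv j f' g') : HasWeakDeriv j (f - f') (g - g') := by
  have := h.add (h'.smul (-1))
  simpa [sub_eq_add_neg] using this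

lemma ae_eq_zero_of_forall_test {w : ℝ → ℝ} (hw : LocallyIntegrableOn w (Ioi 0))
    (h : ∀ φ : ℝ → ℝ, ContDiff ℝ ∞ φ → HasCompactSupport φ → tsupport φ ⊆ Ioi 0 →
      ∫ r in Ioi (0 : ℝ), w r * φ r = 0) : w =ᵐ[volume.restrict (Ioi 0)] 0 := by
  have := isOpen_Ioi.ae_eq_zero_of_integral_contDiff_smul_eq_zero hw fun φ h1 h2 h3 => by
    rw [← h φ h1 h2 h3, ← integral_indicator measurableSet_Ioi]
    congr 1
    ext r
    by_cases hr : r ∈ Ioi (0 : ℝ)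
    · simp [indicator_of_mem hr, mul_comm]
    · simp [indicator_of_notMem hr,
        image_eq_zero_of_notMem_tsupport (fun h' => hr (h3 h') : r ∉ tsupport φ)]
  exact (ae_restrict_iff' measurableSet_Ioi).2 this

lemma HasWeakDeriv.unique {j : ℕ} {f g g' : ℝ → ℝ} (h : HasWeakDeriv j f g)
    (h' : HasWeakDeriv j f g') : g =ᵐ[volume.restrict (Ioi 0)] g' := by
  have h0 := h.sub h'
  rw [sub_self] at h0
  have := ae_eq_zero_of_forall_test h0.2.1 fun φ h1 h2 h3 => by
    have := h0.2.2 φ h1 h2 h3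
    simp only [Pi.zero_apply, zero_mul, integral_zero] at this
    have hp : ((-1 : ℝ)) ^ j ≠ 0 := by positivity
    exact (mul_eq_zero.1 this.symm).resolve_left hp
  filter_upwards [this] with r hr
  simpa [sub_eq_zero] using hr

lemma exists_test_integral_eq_one : ∃ φ : ℝ → ℝ, ContDiff ℝ ∞ φ ∧ HasCompactSupport φ ∧
    tsupport φ ⊆ Ioi 0 ∧ ∫ r, φ r = 1 := by
  let b : ContDiffBump (2 : ℝ) := ⟨1 / 2, 1, by norm_num, by norm_num⟩
  refine ⟨b.normed volume, b.contDiff_normed, b.hasCompactSupport_normed, ?_, b.integral_normed⟩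
  rw [b.tsupport_normed_eq]
  intro x hx
  rw [Metric.mem_closedBall, Real.dist_eq, abs_le] at hx
  have : b.rOut = 1 := rfl
  rw [this] at hx
  have := hx.1
  simp only [mem_Ioi]
  linarith

lemma exists_primitive_test {ψ : ℝ → ℝ} (h1 : ContDiff ℝ ∞ ψ) (h2 : HasCompactSupport ψ)
    (h3 : tsupport ψ ⊆ Ioi 0) (h0 : ∫ r, ψ r = 0) : ∃ φ : ℝ → ℝ, ContDiff ℝ ∞ φ ∧
      HasCompactSupport φ ∧ tsupport φ ⊆ Ioi 0 ∧ deriv φ = ψ := by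
  obtain ⟨a, b, ha, hab, hsub⟩ := exists_Ioo_of_test h2 h3
  have hψ0 : ∀ r, r ∉ Ioo a b → ψ r = 0 := fun r hr =>
    image_eq_zero_of_notMem_tsupport fun h => hr (hsub h)
  have hc := h1.continuous
  set φ : ℝ → ℝ := fun r => ∫ s in a..r, ψ s with hφ
  have hd : ∀ r, HasDerivAt φ (ψ r) r := fun r =>
    intervalIntegral.integral_hasDerivAt_right (hc.intervalIntegrable _ _)
      hc.aestronglyMeasurable.stronglyMeasurableAtFilter hc.continuousAt
  have hder : deriv φ = ψ := funext fun r => (hd r).deriv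
  have htot : ∫ s in a..b, ψ s = 0 := by
    rw [← h0, intervalIntegral.integral_of_le hab.le]
    refine setIntegral_eq_integral_of_forall_compl_eq_zero fun x hx => hψ0 x fun h => hx
      ⟨h.1, h.2.le⟩
  have hz : ∀ r, r ∉ Icc a b → φ r = 0 := by
    intro r hr
    rcases lt_or_ge r a with h | h
    · refine intervalIntegral.integral_zero_ae (Eventually.of_forall fun x hx => ?_)
      rw [uIoc_of_ge h.le] at hx
      exact hψ0 x fun h' => absurd hx.2 (not_le.2 h'.1)
    · have hb : b ≤ r := by
        by_contra hlt
        exact hr ⟨h, (not_le.1 hlt).le⟩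
      simp only [hφ]
      rw [← intervalIntegral.integral_add_adjacent_intervals (b := b)
        (hc.intervalIntegrable _ _) (hc.intervalIntegrable _ _), htot, zero_add]
      refine intervalIntegral.integral_zero_ae (Eventually.of_forall fun x hx => ?_)
      rw [uIoc_of_le hb] at hx
      exact hψ0 x fun h' => absurd hx.1 (not_lt.2 h'.2.le)
  have hts : tsupport φ ⊆ Icc a b :=
    closure_minimal (fun r hr => by by_contra h; exact hr (hz r h)) isClosed_Icc
  refine ⟨φ, ?_, isCompact_Icc.of_isClosed_subset (isClosed_tsupport _) hts,
    hts.trans fun x hx => ha.trans_le hx.1, hder⟩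
  rw [contDiff_infty_iff_deriv, hder]
  exact ⟨fun r => (hd r).differentiableAt, h1⟩

lemma HasWeakDeriv.ae_eq_const {w : ℝ → ℝ} (h : HasWeakDeriv 1 w 0) :
    ∃ c : ℝ, w =ᵐ[volume.restrict (Ioi 0)] fun _ => c := by
  obtain ⟨φ₀, p1, p2, p3, p4⟩ := exists_test_integral_eq_one
  refine ⟨∫ r in Ioi (0 : ℝ), w r * φ₀ r, ?_⟩
  set c := ∫ r in Ioi (0 : ℝ), w r * φ₀ r
  have hIoi : ∀ ψ : ℝ → ℝ, tsupport ψ ⊆ Ioi 0 → ∫ r in Ioi (0 : ℝ), ψ r = ∫ r, ψ r := fun ψ hψ =>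
    setIntegral_eq_integral_of_forall_compl_eq_zero fun x hx =>
      image_eq_zero_of_notMem_tsupport fun h => hx (hψ h)
  have hcl : LocallyIntegrableOn (fun _ : ℝ => c) (Ioi 0) :=
    continuousOn_const.locallyIntegrableOn measurableSet_Ioi
  have := ae_eq_zero_of_forall_test (w := fun r => w r - c) (h.1.sub hcl) fun ψ q1 q2 q3 => by
    set I := ∫ r, ψ r with hI
    have hp2 : HasCompactSupport (fun r => I * φ₀ r) := p2.mul_left
    have hs1 : HasCompactSupport (fun r => ψ r - I * φ₀ r) := q2.sub hp2
    have hs2 : tsupport (fun r => ψ r - I * φ₀ r) ⊆ Ioi 0 :=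
      (tsupport_sub ψ (fun r => I * φ₀ r)).trans
        (union_subset q3 ((closure_mono (Function.support_mul_subset_right _ _)).trans p3))
    obtain ⟨φ, f1, f2, f3, f4⟩ := exists_primitive_test
      (ψ := fun r => ψ r - I * φ₀ r) (q1.sub (contDiff_const.mul p1)) hs1 hs2 (by
        rw [integral_sub (q1.continuous.integrable_of_hasCompactSupport q2)
          ((p1.continuous.integrable_of_hasCompactSupport p2).const_mul _), integral_const_mul, p4]
        simp [hI])
    have h0 := h.2.2 φ f1 f2 f3
    rw [iteratedDeriv_one, f4] at h0
    simp only [Pi.zero_apply, zero_mul, integral_zero, mul_zero] at h0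
    have i1 := integrableOn_mul_test h.1 q1.continuous q2 q3
    have i2 := integrableOn_mul_test h.1 p1.continuous p2 p3
    have e : ∀ r, w r * (ψ r - I * φ₀ r) = w r * ψ r - I * (w r * φ₀ r) := fun r => by ring
    simp only [e] at h0
    rw [integral_sub i1 (i2.const_mul _), integral_const_mul] at h0
    simp only [sub_mul]
    rw [integral_sub i1 ((q1.continuous.integrable_of_hasCompactSupport q2).const_mul c).integrableOn,
      integral_const_mul, hIoi ψ q3]
    linarith
  filter_upwards [this] with r hr
  simpa [sub_eq_zero] using hr

/-- A function with a weak derivative has a locally absolutely continuous representative. -/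
lemma HasWeakDeriv.exists_repr {f g : ℝ → ℝ} (h : HasWeakDeriv 1 f g) :
    ∃ F : ℝ → ℝ, f =ᵐ[volume.restrict (Ioi 0)] F ∧ ContinuousOn F (Ioi 0) ∧
      ∀ a b, 0 < a → 0 < b → F b - F a = ∫ s in a..b, g s := by
  have h0 := h.sub (hasWeakDeriv_primitive h.2.1)
  rw [sub_self] at h0
  obtain ⟨c, hc⟩ := h0.ae_eq_const
  refine ⟨fun r => c + ∫ s in (1 : ℝ)..r, g s, ?_, continuousOn_const.add
    (continuousOn_primitive_Ioi h.2.1), fun a b ha hb => ?_⟩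
  · filter_upwards [hc] with r hr
    simp only [Pi.sub_apply] at hr
    linarith
  · have := intervalIntegral.integral_add_adjacent_intervals
      (intervalIntegrable_of_locallyIntegrableOn h.2.1 one_pos ha)
      (intervalIntegrable_of_locallyIntegrableOn h.2.1 ha hb)
    linarith

lemma HasWeakDeriv.weakDeriv_ae_eq {f g : ℝ → ℝ} (h : HasWeakDeriv 1 f g) :
    weakDeriv f =ᵐ[volume.restrict (Ioi 0)] g := by
  have hex : ∃ g, HasWeakDeriv 1 f g := ⟨g, h⟩
  rw [weakDeriv, dif_pos hex]
  exact hex.choose_spec.unique h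

lemma HasWeakDeriv.of_succ {j : ℕ} {f g g' : ℝ → ℝ} (h : HasWeakDeriv j f g)
    (h' : HasWeakDeriv (j + 1) f g') : HasWeakDeriv 1 g g' := by
  refine ⟨h.2.1, h'.2.1, fun φ h1 h2 h3 => ?_⟩
  obtain ⟨-, d2, d3⟩ := iteratedDeriv_test 1 h1 h2 h3
  rw [iteratedDeriv_one] at d2 d3
  have e1 := h.2.2 (deriv φ) (contDiff_infty_iff_deriv.1 h1).2 d2 d3
  have e2 := h'.2.2 φ h1 h2 h3
  rw [iteratedDeriv_succ', e1, pow_succ, mul_assoc] at e2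
  rw [iteratedDeriv_one, pow_one]
  exact mul_left_cancel₀ (by positivity) e2

lemma continuousOn_rpow_Ioi (b : ℝ) : ContinuousOn (fun r : ℝ => r ^ b) (Ioi 0) :=
  continuousOn_id.rpow_const fun _ hx => Or.inl (ne_of_gt hx)

lemma locallyIntegrableOn_rpow_mul {f : ℝ → ℝ} (hf : LocallyIntegrableOn f (Ioi 0)) (b : ℝ) :
    LocallyIntegrableOn (fun r => r ^ b * f r) (Ioi 0) :=
  hf.continuousOn_mul (continuousOn_rpow_Ioi b) isOpen_Ioi.isLocallyClosed

lemma HasWeakDeriv.rpow_mul {f g : ℝ → ℝ} (h : HasWeakDeriv 1 f g) (b : ℝ) :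
    HasWeakDeriv 1 (fun r => r ^ b * f r) (fun r => b * (r ^ (b - 1) * f r) + r ^ b * g r) := by
  have l1 := locallyIntegrableOn_rpow_mul h.1 (b - 1)
  have l2 := locallyIntegrableOn_rpow_mul h.2.1 b
  refine ⟨locallyIntegrableOn_rpow_mul h.1 b, (l1.smul b).add l2, fun φ h1 h2 h3 => ?_⟩
  have hφ0 : ∀ r, r ≤ 0 → φ r = 0 := fun r hr =>
    image_eq_zero_of_notMem_tsupport fun h' => absurd (h3 h') (not_lt.2 hr)
  have hsupp : tsupport (fun r => r ^ b * φ r) ⊆ tsupport φ :=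
    closure_mono (Function.support_mul_subset_right _ _)
  have hev : ∀ r, r ∉ tsupport φ → (fun r => r ^ b * φ r) =ᶠ[𝓝 r] 0 := fun r hr => by
    filter_upwards [(isClosed_tsupport φ).isOpen_compl.mem_nhds hr] with s hs
    simp [image_eq_zero_of_notMem_tsupport hs]
  have s1 : ContDiff ℝ ∞ (fun r => r ^ b * φ r) := by
    rw [contDiff_iff_contDiffAt]
    intro r
    by_cases hr : r ∈ tsupport φ
    · exact (Real.contDiffAt_rpow_const_of_ne (ne_of_gt (h3 hr))).mul h1.contDiffAt
    · exact contDiffAt_const.congr_of_eventuallyEq (hev r hr)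
  have s2 : HasCompactSupport (fun r => r ^ b * φ r) := h2.mul_left
  have e := h.2.2 _ s1 s2 (hsupp.trans h3)
  have hder : ∀ r ∈ Ioi (0 : ℝ), deriv (fun r => r ^ b * φ r) r =
      b * r ^ (b - 1) * φ r + r ^ b * deriv φ r := fun r hr => by
    have d1 := Real.hasDerivAt_rpow_const (x := r) (p := b) (Or.inl (ne_of_gt hr))
    have d2 := (h1.differentiable (by norm_num)).differentiableAt (x := r) |>.hasDerivAt
    exact (d1.mul d2).deriv
  obtain ⟨c1, c2, c3⟩ := iteratedDeriv_test 1 h1 h2 h3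
  have i1 := integrableOn_mul_test l1 h1.continuous h2 h3
  have i2 := integrableOn_mul_test l2 h1.continuous h2 h3
  have i3 := integrableOn_mul_test (locallyIntegrableOn_rpow_mul h.1 b) c1 c2 c3
  rw [iteratedDeriv_one] at e i3 ⊢
  have e1 : ∫ r in Ioi (0 : ℝ), f r * deriv (fun r => r ^ b * φ r) r =
      b * (∫ r in Ioi (0 : ℝ), r ^ (b - 1) * f r * φ r) +
        ∫ r in Ioi (0 : ℝ), r ^ b * f r * deriv φ r := by
    rw [← integral_const_mul, ← integral_add (i1.const_mul b) i3]
    refine setIntegral_congr_fun measurableSet_Ioi fun r hr => ?_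
    simp only [hder r hr]
    ring
  have e2 : ∫ r in Ioi (0 : ℝ), (b * (r ^ (b - 1) * f r) + r ^ b * g r) * φ r =
      b * (∫ r in Ioi (0 : ℝ), r ^ (b - 1) * f r * φ r) +
        ∫ r in Ioi (0 : ℝ), r ^ b * g r * φ r := by
    rw [← integral_const_mul, ← integral_add (i1.const_mul b) i2]
    exact setIntegral_congr_fun measurableSet_Ioi fun r _ => by ring
  have e3 : ∫ r in Ioi (0 : ℝ), g r * (r ^ b * φ r) = ∫ r in Ioi (0 : ℝ), r ^ b * g r * φ r :=
    setIntegral_congr_fun measurableSet_Ioi fun r _ => by ring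
  rw [e1, e3] at e
  rw [e2]
  linarith

/-- `∫ |w| ^ p r ^ b dr` over the set `S`. -/
noncomputable def powInt (p b : ℝ) (S : Set ℝ) (w : ℝ → ℝ) : ℝ≥0∞ :=
  ∫⁻ r in S, ‖w r‖ₑ ^ p * ENNReal.ofReal (r ^ b)

lemma measurable_ofReal_rpow (b : ℝ) : Measurable fun r : ℝ => ENNReal.ofReal (r ^ b) :=
  ENNReal.measurable_ofReal.comp (measurable_id.pow_const b)

/-- Schur's test for the kernel of a relation `Q` on `(0, ∞)` and power weights. -/
lemma lintegral_schur_rpow {p a : ℝ} (hp : 1 < p) (ha : a ≠ 0) {Q : Set (ℝ × ℝ)}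
    (hQ : MeasurableSet Q)
    (h1 : ∀ r, 0 < r → ∫⁻ s in Ioi (0 : ℝ), Q.indicator 1 (r, s) * ENNReal.ofReal (s ^ (-a - 1)) ≤
      ENNReal.ofReal (r ^ (-a) / |a|))
    (h2 : ∀ s, 0 < s → ∫⁻ r in Ioi (0 : ℝ), Q.indicator 1 (r, s) * ENNReal.ofReal (r ^ (a - 1)) ≤
      ENNReal.ofReal (s ^ a / |a|))
    {G : ℝ → ℝ≥0∞} (hG : AEMeasurable G (volume.restrict (Ioi 0))) :
    ∫⁻ r in Ioi (0 : ℝ), (∫⁻ s in Ioi (0 : ℝ), Q.indicator 1 (r, s) * G s) ^ p *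
        ENNReal.ofReal (r ^ (a * p - 1)) ≤
      ENNReal.ofReal (|a| ^ (-p)) *
        ∫⁻ s in Ioi (0 : ℝ), G s ^ p * ENNReal.ofReal (s ^ ((a + 1) * p - 1)) := by
  have ha' : 0 < |a| := abs_pos.2 ha
  set μ : Measure ℝ := volume.restrict (Ioi 0) with hμ
  have hχ : Measurable (fun x : ℝ × ℝ => (Q.indicator 1 x : ℝ≥0∞)) :=
    (measurable_one.indicator hQ)
  have hχr : ∀ r : ℝ, Measurable (fun s : ℝ => (Q.indicator 1 (r, s) : ℝ≥0∞)) := fun r =>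
    hχ.comp measurable_prodMk_left
  have hχs : ∀ s : ℝ, Measurable (fun r : ℝ => (Q.indicator 1 (r, s) : ℝ≥0∞)) := fun s =>
    hχ.comp measurable_prodMk_right
  have hχi : ∀ x : ℝ × ℝ, ∀ e : ℝ, 0 < e →
      (Q.indicator 1 x : ℝ≥0∞) ^ e = Q.indicator 1 x := fun x e he => by
    by_cases hx : x ∈ Q <;> simp [hx, he]
  have hχ2 : ∀ x : ℝ × ℝ, (Q.indicator 1 x : ℝ≥0∞) * Q.indicator 1 x = Q.indicator 1 x :=
    fun x => by by_cases hx : x ∈ Q <;> simp [hx]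
  have hpq : p.HolderConjugate (p / (p - 1)) := Real.HolderConjugate.conjExponent hp
  have hp0 : 0 < p := by linarith
  have hp1 : 0 < p - 1 := by linarith
  set b : ℝ := (a + 1) * (p - 1) / p with hb
  have hG' : AEMeasurable (fun x : ℝ × ℝ => G x.2) (μ.prod μ) := hG.comp_snd
  have key : ∀ r, 0 < r → (∫⁻ s, Q.indicator 1 (r, s) * G s ∂μ) ^ p *
      ENNReal.ofReal (r ^ (a * p - 1)) ≤
      ENNReal.ofReal (|a| ^ (-(p - 1))) * ∫⁻ s, Q.indicator 1 (r, s) *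
        (G s ^ p * ENNReal.ofReal (s ^ (b * p)) * ENNReal.ofReal (r ^ (a - 1))) ∂μ := by
    intro r hr
    have e0 : ∫⁻ s, Q.indicator 1 (r, s) * G s ∂μ = ∫⁻ s, ((fun s => Q.indicator 1 (r, s) *
        (G s * ENNReal.ofReal (s ^ b))) * fun s => Q.indicator 1 (r, s) *
          ENNReal.ofReal (s ^ (-b))) s ∂μ := by
      refine setLIntegral_congr_fun measurableSet_Ioi fun s hs => ?_
      have hs0 : (0 : ℝ) < s := hs
      simp only [Pi.mul_apply]
      rw [mul_mul_mul_comm, hχ2, mul_assoc (G s), ← ENNReal.ofReal_mul (by positivity),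
        ← Real.rpow_add hs0]
      simp
    have m1 : AEMeasurable (fun s => Q.indicator 1 (r, s) * (G s * ENNReal.ofReal (s ^ b))) μ :=
      (hχr r).aemeasurable.mul (hG.mul (measurable_ofReal_rpow b).aemeasurable)
    have m2 : AEMeasurable (fun s => Q.indicator 1 (r, s) * ENNReal.ofReal (s ^ (-b))) μ :=
      (hχr r).aemeasurable.mul (measurable_ofReal_rpow _).aemeasurable
    have hold := ENNReal.lintegral_mul_le_Lp_mul_Lq μ hpq m1 m2
    rw [← e0] at hold
    have e1 : ∫⁻ s, (Q.indicator 1 (r, s) * (G s * ENNReal.ofReal (s ^ b))) ^ p ∂μ =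
        ∫⁻ s, Q.indicator 1 (r, s) * (G s ^ p * ENNReal.ofReal (s ^ (b * p))) ∂μ := by
      refine setLIntegral_congr_fun measurableSet_Ioi fun s hs => ?_
      have hs0 : (0 : ℝ) < s := hs
      rw [ENNReal.mul_rpow_of_nonneg _ _ hp0.le, ENNReal.mul_rpow_of_nonneg _ _ hp0.le,
        hχi _ _ hp0, ENNReal.ofReal_rpow_of_pos (by positivity), ← Real.rpow_mul hs0.le]
    have e2 : ∫⁻ s, (Q.indicator 1 (r, s) * ENNReal.ofReal (s ^ (-b))) ^ (p / (p - 1)) ∂μ =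
        ∫⁻ s, Q.indicator 1 (r, s) * ENNReal.ofReal (s ^ (-a - 1)) ∂μ := by
      refine setLIntegral_congr_fun measurableSet_Ioi fun s hs => ?_
      have hs0 : (0 : ℝ) < s := hs
      have hq : 0 < p / (p - 1) := by positivity
      rw [ENNReal.mul_rpow_of_nonneg _ _ hq.le, hχi _ _ hq,
        ENNReal.ofReal_rpow_of_pos (by positivity), ← Real.rpow_mul hs0.le]
      congr 3
      rw [hb]; field_simp; ring
    rw [e1, e2] at hold
    have h3 : (∫⁻ s, Q.indicator 1 (r, s) * G s ∂μ) ^ p ≤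
        (∫⁻ s, Q.indicator 1 (r, s) * (G s ^ p * ENNReal.ofReal (s ^ (b * p))) ∂μ) *
          ENNReal.ofReal ((r ^ (-a) / |a|) ^ (p - 1)) := by
      calc _ ≤ _ := ENNReal.rpow_le_rpow hold hp0.le
        _ = (∫⁻ s, Q.indicator 1 (r, s) * (G s ^ p * ENNReal.ofReal (s ^ (b * p))) ∂μ) *
          (∫⁻ s, Q.indicator 1 (r, s) * ENNReal.ofReal (s ^ (-a - 1)) ∂μ) ^ (p - 1) := by
            rw [ENNReal.mul_rpow_of_nonneg _ _ hp0.le, ← ENNReal.rpow_mul, ← ENNReal.rpow_mul]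
            have : 1 / (p / (p - 1)) * p = p - 1 := by field_simp
            rw [this, one_div_mul_cancel hp0.ne', ENNReal.rpow_one]
        _ ≤ _ := by
            rw [← ENNReal.ofReal_rpow_of_pos (by positivity)]
            gcongr
            exact h1 r hr
    calc _ ≤ _ := mul_le_mul_left h3 _
      _ = ENNReal.ofReal (|a| ^ (-(p - 1))) * (ENNReal.ofReal (r ^ (a - 1)) *
          ∫⁻ s, Q.indicator 1 (r, s) * (G s ^ p * ENNReal.ofReal (s ^ (b * p))) ∂μ) := by
          rw [mul_assoc, mul_comm, ← mul_assoc, ← ENNReal.ofReal_mul (by positivity),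
            ← ENNReal.ofReal_mul (by positivity)]
          congr 2
          rw [Real.div_rpow (by positivity) ha'.le, ← Real.rpow_mul hr.le, Real.rpow_neg ha'.le,
            div_mul_eq_mul_div, ← Real.rpow_add hr, div_eq_inv_mul]
          congr 2
          ring
      _ = _ := by
          rw [← lintegral_const_mul' _ _ ENNReal.ofReal_ne_top]
          congr 1
          refine lintegral_congr fun s => ?_
          ring
  calc _ ≤ ∫⁻ r, ENNReal.ofReal (|a| ^ (-(p - 1))) * ∫⁻ s, Q.indicator 1 (r, s) *
        (G s ^ p * ENNReal.ofReal (s ^ (b * p)) * ENNReal.ofReal (r ^ (a - 1))) ∂μ ∂μ :=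
        setLIntegral_mono_ae' measurableSet_Ioi (Eventually.of_forall fun r hr => key r hr)
    _ = ENNReal.ofReal (|a| ^ (-(p - 1))) * ∫⁻ r, ∫⁻ s, Q.indicator 1 (r, s) *
        (G s ^ p * ENNReal.ofReal (s ^ (b * p)) * ENNReal.ofReal (r ^ (a - 1))) ∂μ ∂μ :=
        lintegral_const_mul' _ _ ENNReal.ofReal_ne_top
    _ = ENNReal.ofReal (|a| ^ (-(p - 1))) * ∫⁻ s, ∫⁻ r, Q.indicator 1 (r, s) *
        (G s ^ p * ENNReal.ofReal (s ^ (b * p)) * ENNReal.ofReal (r ^ (a - 1))) ∂μ ∂μ := by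
        rw [lintegral_lintegral_swap]
        exact hχ.aemeasurable.mul (((hG'.pow_const p).mul
          ((measurable_ofReal_rpow _).comp measurable_snd).aemeasurable).mul
          ((measurable_ofReal_rpow _).comp measurable_fst).aemeasurable)
    _ ≤ ENNReal.ofReal (|a| ^ (-(p - 1))) * ∫⁻ s, ENNReal.ofReal (|a|⁻¹) *
          (G s ^ p * ENNReal.ofReal (s ^ ((a + 1) * p - 1))) ∂μ := by
        refine mul_le_mul' le_rfl ?_
        refine setLIntegral_mono_ae' measurableSet_Ioi (Eventually.of_forall fun s hs => ?_)
        have hs0 : (0 : ℝ) < s := hs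
        calc _ = (G s ^ p * ENNReal.ofReal (s ^ (b * p))) *
              ∫⁻ r, Q.indicator 1 (r, s) * ENNReal.ofReal (r ^ (a - 1)) ∂μ := by
              have hm : Measurable fun r => Q.indicator 1 (r, s) * ENNReal.ofReal (r ^ (a - 1)) :=
                (hχs s).mul (measurable_ofReal_rpow _)
              rw [← lintegral_const_mul _ hm]
              refine lintegral_congr fun r => ?_
              ring
          _ ≤ _ := mul_le_mul_right (h2 s hs0) _
          _ = _ := by
              rw [mul_assoc, ← ENNReal.ofReal_mul (by positivity), mul_left_comm,
                ← ENNReal.ofReal_mul (by positivity), div_eq_mul_inv, ← mul_assoc,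
                ← Real.rpow_add hs0, mul_comm]
              have : b * p + a = (a + 1) * p - 1 := by rw [hb]; field_simp; ring
              rw [this, mul_comm (G s ^ p), mul_comm (s ^ _)]
    _ = _ := by
        rw [lintegral_const_mul' _ _ ENNReal.ofReal_ne_top, ← mul_assoc,
          ← ENNReal.ofReal_mul (by positivity)]
        congr 2
        rw [← Real.rpow_neg_one, ← Real.rpow_add ha']
        congr 1
        ring

lemma lintegral_Ioi_rpow {a r : ℝ} (ha : 0 < a) (hr : 0 < r) :
    ∫⁻ s in Ioi r, ENNReal.ofReal (s ^ (-a - 1)) = ENNReal.ofReal (r ^ (-a) / a) := by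
  rw [← ofReal_integral_eq_lintegral_ofReal (integrableOn_Ioi_rpow_of_lt (by linarith) hr),
    integral_Ioi_rpow_of_lt (by linarith) hr]
  · congr 1
    rw [show -a - 1 + 1 = -a by ring, neg_div_neg_eq]
  · filter_upwards [ae_restrict_mem measurableSet_Ioi] with s hs
    have : 0 < s := hr.trans hs
    positivity

lemma lintegral_Ioo_rpow {a s : ℝ} (ha : 0 < a) (hs : 0 < s) :
    ∫⁻ r in Ioo 0 s, ENNReal.ofReal (r ^ (a - 1)) = ENNReal.ofReal (s ^ a / a) := by
  rw [restrict_Ioo_eq_restrict_Ioc, ← ofReal_integral_eq_lintegral_ofReal, ←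
    intervalIntegral.integral_of_le hs.le, integral_rpow (Or.inl (by linarith))]
  · simp [Real.zero_rpow ha.ne']
  · exact (intervalIntegrable_iff_integrableOn_Ioc_of_le hs.le).1
      (intervalIntegral.intervalIntegrable_rpow' (by linarith))
  · filter_upwards [ae_restrict_mem measurableSet_Ioc] with r hr
    have : 0 < r := hr.1
    positivity

lemma setLIntegral_indicator_slice {S : Set ℝ} (hS : MeasurableSet S) (hS0 : S ⊆ Ioi 0)
    (g : ℝ → ℝ≥0∞) : ∫⁻ s in Ioi (0 : ℝ), S.indicator 1 s * g s = ∫⁻ s in S, g s := by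
  have : ∀ s, S.indicator 1 s * g s = S.indicator g s := fun s => by
    by_cases hs : s ∈ S <;> simp [hs]
  simp_rw [this]
  rw [setLIntegral_indicator hS, inter_eq_left.2 hS0]

lemma lintegral_hardy_Ioi {p a : ℝ} (hp : 1 < p) (ha : 0 < a)
    {G : ℝ → ℝ≥0∞} (hG : AEMeasurable G (volume.restrict (Ioi 0))) :
    ∫⁻ r in Ioi (0 : ℝ), (∫⁻ s in Ioi r, G s) ^ p * ENNReal.ofReal (r ^ (a * p - 1)) ≤
      ENNReal.ofReal (|a| ^ (-p)) *
        ∫⁻ s in Ioi (0 : ℝ), G s ^ p * ENNReal.ofReal (s ^ ((a + 1) * p - 1)) := by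
  have hQ : MeasurableSet {x : ℝ × ℝ | x.1 < x.2} := measurableSet_lt measurable_fst measurable_snd
  have e1 : ∀ r : ℝ, 0 < r → ∀ g : ℝ → ℝ≥0∞, ∫⁻ s in Ioi (0 : ℝ),
      {x : ℝ × ℝ | x.1 < x.2}.indicator 1 (r, s) * g s = ∫⁻ s in Ioi r, g s := fun r hr g => by
    rw [← setLIntegral_indicator_slice measurableSet_Ioi (Ioi_subset_Ioi hr.le)]
    rfl
  have e2 : ∀ s : ℝ, ∀ g : ℝ → ℝ≥0∞, ∫⁻ r in Ioi (0 : ℝ),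
      {x : ℝ × ℝ | x.1 < x.2}.indicator 1 (r, s) * g r = ∫⁻ r in Ioo 0 s, g r := fun s g => by
    rw [← setLIntegral_indicator_slice measurableSet_Ioo Ioo_subset_Ioi_self]
    refine setLIntegral_congr_fun measurableSet_Ioi fun r hr => ?_
    have hr' : 0 < r := hr
    by_cases h : r < s <;> simp [h, hr']
  have := lintegral_schur_rpow hp ha.ne' hQ
    (fun r hr => by rw [e1 r hr, lintegral_Ioi_rpow ha hr, abs_of_pos ha])
    (fun s hs => by rw [e2, lintegral_Ioo_rpow ha hs, abs_of_pos ha]) hG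
  refine le_trans (le_of_eq ?_) this
  refine setLIntegral_congr_fun measurableSet_Ioi fun r hr => ?_
  simp only [e1 r hr]

lemma lintegral_hardy_Ioo {p a : ℝ} (hp : 1 < p) (ha : a < 0)
    {G : ℝ → ℝ≥0∞} (hG : AEMeasurable G (volume.restrict (Ioi 0))) :
    ∫⁻ r in Ioi (0 : ℝ), (∫⁻ s in Ioo 0 r, G s) ^ p * ENNReal.ofReal (r ^ (a * p - 1)) ≤
      ENNReal.ofReal (|a| ^ (-p)) *
        ∫⁻ s in Ioi (0 : ℝ), G s ^ p * ENNReal.ofReal (s ^ ((a + 1) * p - 1)) := by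
  have hQ : MeasurableSet {x : ℝ × ℝ | x.2 < x.1} := measurableSet_lt measurable_snd measurable_fst
  have e1 : ∀ s : ℝ, 0 < s → ∀ g : ℝ → ℝ≥0∞, ∫⁻ r in Ioi (0 : ℝ),
      {x : ℝ × ℝ | x.2 < x.1}.indicator 1 (r, s) * g r = ∫⁻ r in Ioi s, g r := fun s hs g => by
    rw [← setLIntegral_indicator_slice measurableSet_Ioi (Ioi_subset_Ioi hs.le)]
    rfl
  have e2 : ∀ r : ℝ, ∀ g : ℝ → ℝ≥0∞, ∫⁻ s in Ioi (0 : ℝ),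
      {x : ℝ × ℝ | x.2 < x.1}.indicator 1 (r, s) * g s = ∫⁻ s in Ioo 0 r, g s := fun r g => by
    rw [← setLIntegral_indicator_slice measurableSet_Ioo Ioo_subset_Ioi_self]
    refine setLIntegral_congr_fun measurableSet_Ioi fun s hs => ?_
    have hs' : 0 < s := hs
    by_cases h : s < r <;> simp [h, hs']
  have ha' : 0 < -a := by linarith
  have := lintegral_schur_rpow hp ha.ne hQ
    (fun r hr => by rw [e2, lintegral_Ioo_rpow ha' hr, abs_of_neg ha])
    (fun s hs => by
      have := lintegral_Ioi_rpow ha' hs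
      rw [neg_neg] at this
      rw [e1 s hs, this, abs_of_neg ha]) hG
  refine le_trans (le_of_eq ?_) this
  refine setLIntegral_congr_fun measurableSet_Ioi fun r hr => ?_
  simp only [e2 r]

lemma enorm_sub_le_lintegral {W g : ℝ → ℝ}
    (hW : ∀ a b, 0 < a → 0 < b → W b - W a = ∫ s in a..b, g s) {a b : ℝ} (ha : 0 < a)
    (hab : a ≤ b) : ‖W b - W a‖ₑ ≤ ∫⁻ s in Ioo a b, ‖g s‖ₑ := by
  rw [hW a b ha (ha.trans_le hab), intervalIntegral.integral_of_le hab,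
    restrict_Ioo_eq_restrict_Ioc]
  exact enorm_integral_le_lintegral_enorm _

lemma lintegral_Ioi_inv_eq_top {R : ℝ} (hR : 0 < R) :
    ∫⁻ r in Ioi R, ENNReal.ofReal (r ^ (-1 : ℝ)) = ⊤ := by
  by_contra h
  refine not_integrableOn_Ioi_inv (a := R) ?_
  refine (lintegral_ofReal_ne_top_iff_integrable (f := fun r : ℝ => r⁻¹) ?_ ?_).1 ?_
  · exact measurable_inv.aestronglyMeasurable
  · filter_upwards [ae_restrict_mem measurableSet_Ioi] with r hr
    have : 0 < r := hR.trans hr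
    simp only [Pi.zero_apply]
    positivity
  · simpa [Real.rpow_neg_one] using h

lemma lintegral_Ioo_inv_eq_top {R : ℝ} (hR : 0 < R) :
    ∫⁻ r in Ioo 0 R, ENNReal.ofReal (r ^ (-1 : ℝ)) = ⊤ := by
  by_contra h
  have h1 : IntegrableOn (fun r : ℝ => r⁻¹) (Ioo 0 R) := by
    refine (lintegral_ofReal_ne_top_iff_integrable (f := fun r : ℝ => r⁻¹) ?_ ?_).1 ?_
    · exact measurable_inv.aestronglyMeasurable
    · filter_upwards [ae_restrict_mem measurableSet_Ioo] with r hr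
      have : 0 < r := hr.1
      simp only [Pi.zero_apply]
      positivity
    · simpa [Real.rpow_neg_one] using h
  rw [IntegrableOn, restrict_Ioo_eq_restrict_Ioc] at h1
  have := (intervalIntegrable_iff_integrableOn_Ioc_of_le hR.le).2 h1
  rw [intervalIntegrable_inv_iff] at this
  rcases this with h | h
  · exact hR.ne h
  · exact h left_mem_uIcc

/-- If `∫ |w| ^ p dr / r` is finite near infinity, then `w` is bounded by the integral of its
derivative up to infinity. -/
lemma enorm_le_lintegral_Ioi {p : ℝ} (hp : 0 < p) {W g : ℝ → ℝ}
    (hW : ∀ a b, 0 < a → 0 < b → W b - W a = ∫ s in a..b, g s)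
    (hfin : powInt p (-1) (Ioi 1) W < ⊤) {r : ℝ} (hr : 0 < r) :
    ‖W r‖ₑ ≤ ∫⁻ s in Ioi r, ‖g s‖ₑ := by
  by_contra! hlt
  set ε := ‖W r‖ₑ - ∫⁻ s in Ioi r, ‖g s‖ₑ
  have hε : ε ≠ 0 := (tsub_pos_of_lt hlt).ne'
  have hle : ∀ s, r ≤ s → ε ≤ ‖W s‖ₑ := fun s hs => by
    refine tsub_le_iff_right.2 ?_
    calc ‖W r‖ₑ = ‖W s - (W s - W r)‖ₑ := by ring_nf
      _ ≤ ‖W s‖ₑ + ‖W s - W r‖ₑ := enorm_sub_le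
      _ ≤ _ := by
        gcongr
        exact (enorm_sub_le_lintegral hW hr hs).trans (lintegral_mono_set Ioo_subset_Ioi_self)
  have hm : 0 < max r 1 := lt_max_of_lt_left hr
  have : ε ^ p * ∫⁻ s in Ioi (max r 1), ENNReal.ofReal (s ^ (-1 : ℝ)) ≤ powInt p (-1) (Ioi 1) W := by
    rw [← lintegral_const_mul _ (measurable_ofReal_rpow _), powInt]
    calc _ ≤ ∫⁻ s in Ioi (max r 1), ‖W s‖ₑ ^ p * ENNReal.ofReal (s ^ (-1 : ℝ)) := by
          refine setLIntegral_mono_ae' measurableSet_Ioi (Eventually.of_forall fun s hs => ?_)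
          gcongr
          exact hle s ((le_max_left _ _).trans (le_of_lt hs))
      _ ≤ _ := lintegral_mono_set (Ioi_subset_Ioi (le_max_right _ _))
  rw [lintegral_Ioi_inv_eq_top hm, ENNReal.mul_top (by simp [hε, hp, hp.le])] at this
  exact absurd hfin (not_lt.2 this)

/-- If `∫ |w| ^ p dr / r` is finite near zero, then `w` is bounded by the integral of its
derivative from zero. -/
lemma enorm_le_lintegral_Ioo {p : ℝ} (hp : 0 < p) {W g : ℝ → ℝ}
    (hW : ∀ a b, 0 < a → 0 < b → W b - W a = ∫ s in a..b, g s)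
    (hfin : powInt p (-1) (Ioo 0 1) W < ⊤) {r : ℝ} (hr : 0 < r) :
    ‖W r‖ₑ ≤ ∫⁻ s in Ioo 0 r, ‖g s‖ₑ := by
  by_contra! hlt
  set ε := ‖W r‖ₑ - ∫⁻ s in Ioo 0 r, ‖g s‖ₑ
  have hε : ε ≠ 0 := (tsub_pos_of_lt hlt).ne'
  have hle : ∀ s, 0 < s → s ≤ r → ε ≤ ‖W s‖ₑ := fun s hs0 hs => by
    refine tsub_le_iff_right.2 ?_
    calc ‖W r‖ₑ = ‖W s + (W r - W s)‖ₑ := by ring_nf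
      _ ≤ ‖W s‖ₑ + ‖W r - W s‖ₑ := enorm_add_le _ _
      _ ≤ _ := by
        gcongr
        exact (enorm_sub_le_lintegral hW hs0 hs).trans
          (lintegral_mono_set (Ioo_subset_Ioo_left hs0.le))
  have hm : 0 < min r 1 := lt_min hr one_pos
  have : ε ^ p * ∫⁻ s in Ioo 0 (min r 1), ENNReal.ofReal (s ^ (-1 : ℝ)) ≤
      powInt p (-1) (Ioo 0 1) W := by
    rw [← lintegral_const_mul _ (measurable_ofReal_rpow _), powInt]
    calc _ ≤ ∫⁻ s in Ioo 0 (min r 1), ‖W s‖ₑ ^ p * ENNReal.ofReal (s ^ (-1 : ℝ)) := by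
          refine setLIntegral_mono_ae' measurableSet_Ioo (Eventually.of_forall fun s hs => ?_)
          gcongr
          exact hle s hs.1 (hs.2.le.trans (min_le_left _ _))
      _ ≤ _ := lintegral_mono_set (Ioo_subset_Ioo_right (min_le_right _ _))
  rw [lintegral_Ioo_inv_eq_top hm, ENNReal.mul_top (by simp [hε, hp, hp.le])] at this
  exact absurd hfin (not_lt.2 this)

lemma powInt_congr {p b : ℝ} {S : Set ℝ} (hS : S ⊆ Ioi 0) {f g : ℝ → ℝ}
    (h : f =ᵐ[volume.restrict (Ioi 0)] g) : powInt p b S f = powInt p b S g := by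
  refine lintegral_congr_ae ?_
  filter_upwards [ae_restrict_of_ae_restrict_of_subset hS h] with r hr
  rw [hr]

lemma HasWeakDeriv.aemeasurable_enorm {j : ℕ} {f g : ℝ → ℝ} (h : HasWeakDeriv j f g) :
    AEMeasurable (fun r => ‖g r‖ₑ) (volume.restrict (Ioi 0)) :=
  (h.2.1.aestronglyMeasurable).enorm

/-- Hardy's inequality on `(R, ∞)` for functions that are small at infinity. -/
lemma HasWeakDeriv.hardy_Ioi {p a R : ℝ} (hp : 1 < p) (ha : 0 < a) (hR : 0 ≤ R) {w g : ℝ → ℝ}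
    (h : HasWeakDeriv 1 w g) (hfin : powInt p (-1) (Ioi 1) w < ⊤) :
    powInt p (a * p - 1) (Ioi R) w ≤
      ENNReal.ofReal (|a| ^ (-p)) * powInt p ((a + 1) * p - 1) (Ioi R) g := by
  obtain ⟨W, hwW, -, hW⟩ := h.exists_repr
  have hR' : Ioi R ⊆ Ioi 0 := Ioi_subset_Ioi hR
  have hp0 : 0 < p := by linarith
  rw [powInt_congr hR' hwW]
  rw [powInt_congr (Ioi_subset_Ioi zero_le_one) hwW] at hfin
  have := lintegral_hardy_Ioi hp ha (G := (Ioi R).indicator fun r => ‖g r‖ₑ)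
    (h.aemeasurable_enorm.indicator measurableSet_Ioi)
  have e : ∫⁻ s in Ioi (0 : ℝ), (Ioi R).indicator (fun r => ‖g r‖ₑ) s ^ p *
      ENNReal.ofReal (s ^ ((a + 1) * p - 1)) = powInt p ((a + 1) * p - 1) (Ioi R) g := by
    rw [powInt, ← setLIntegral_indicator_slice measurableSet_Ioi hR']
    refine lintegral_congr fun s => ?_
    by_cases hs : s ∈ Ioi R <;> simp [indicator_of_mem, indicator_of_notMem, hs, hp0]
  rw [e] at this
  refine le_trans ?_ this
  refine le_trans ?_ (lintegral_mono_set hR')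
  refine setLIntegral_mono_ae' measurableSet_Ioi (Eventually.of_forall fun r hr => ?_)
  gcongr
  refine (enorm_le_lintegral_Ioi hp0 hW hfin (hR' hr)).trans (le_of_eq ?_)
  refine setLIntegral_congr_fun measurableSet_Ioi fun s hs => ?_
  have : s ∈ Ioi R := lt_trans (mem_Ioi.1 hr) hs
  simp [indicator_of_mem this]

/-- Hardy's inequality for functions that are small at zero. -/
lemma HasWeakDeriv.hardy_zero {p a : ℝ} (hp : 1 < p) (ha : a < 0) {w g : ℝ → ℝ}
    (h : HasWeakDeriv 1 w g) (hfin : powInt p (-1) (Ioo 0 1) w < ⊤) :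
    powInt p (a * p - 1) (Ioi 0) w ≤
      ENNReal.ofReal (|a| ^ (-p)) * powInt p ((a + 1) * p - 1) (Ioi 0) g := by
  obtain ⟨W, hwW, -, hW⟩ := h.exists_repr
  have hp0 : 0 < p := by linarith
  rw [powInt_congr subset_rfl hwW]
  rw [powInt_congr Ioo_subset_Ioi_self hwW] at hfin
  refine le_trans ?_ (lintegral_hardy_Ioo hp ha h.aemeasurable_enorm)
  refine setLIntegral_mono_ae' measurableSet_Ioi (Eventually.of_forall fun r hr => ?_)
  gcongr
  exact enorm_le_lintegral_Ioo hp0 hW hfin hr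

lemma powInt_mono_rpow {p b c : ℝ} {S : Set ℝ} (hS : MeasurableSet S) {w : ℝ → ℝ}
    (h : ∀ r ∈ S, r ^ b ≤ r ^ c) : powInt p b S w ≤ powInt p c S w := by
  refine setLIntegral_mono_ae' hS (Eventually.of_forall fun r hr => ?_)
  exact mul_le_mul' le_rfl (ENNReal.ofReal_le_ofReal (h r hr))

lemma powInt_Ioi_one_mono {p b c : ℝ} (hbc : b ≤ c) (w : ℝ → ℝ) :
    powInt p b (Ioi 1) w ≤ powInt p c (Ioi 1) w :=
  powInt_mono_rpow measurableSet_Ioi fun _ hr => Real.rpow_le_rpow_of_exponent_le (le_of_lt hr) hbc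

lemma powInt_mono_set {p b : ℝ} {S T : Set ℝ} (hST : S ⊆ T) (w : ℝ → ℝ) :
    powInt p b S w ≤ powInt p b T w := lintegral_mono_set hST

/-- Hardy's inequality on `(0, ∞)` with the sharp constant. -/
lemma HasWeakDeriv.hardy {p a : ℝ} (hp : 1 < p) (ha : a ≠ 0) {w g : ℝ → ℝ}
    (h : HasWeakDeriv 1 w g) (hfin : powInt p (a * p - 1) (Ioi 0) w < ⊤) :
    powInt p (a * p - 1) (Ioi 0) w ≤
      ENNReal.ofReal (|a| ^ (-p)) * powInt p ((a + 1) * p - 1) (Ioi 0) g := by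
  have hp0 : 0 < p := by linarith
  rcases ha.lt_or_gt with ha | ha
  · refine h.hardy_zero hp ha (lt_of_le_of_lt ?_ hfin)
    refine le_trans (powInt_mono_rpow measurableSet_Ioo fun r hr => ?_)
      (powInt_mono_set Ioo_subset_Ioi_self _)
    exact Real.rpow_le_rpow_of_exponent_ge hr.1 hr.2.le (by nlinarith)
  · refine h.hardy_Ioi hp ha le_rfl (lt_of_le_of_lt ?_ hfin)
    exact (powInt_Ioi_one_mono (by nlinarith) _).trans
      (powInt_mono_set (Ioi_subset_Ioi zero_le_one) _)

/-- The span of the functions `r ^ (b + j) f_j`, `j = 1, …, n`, up to null sets. -/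
inductive InSpan (f : ℕ → ℝ → ℝ) (n : ℕ) (b : ℝ) : (ℝ → ℝ) → Prop
  | basic (j : ℕ) (h1 : 1 ≤ j) (hn : j ≤ n) : InSpan f n b (fun r => r ^ (b + j) * f j r)
  | add {v w : ℝ → ℝ} (hv : InSpan f n b v) (hw : InSpan f n b w) : InSpan f n b (v + w)
  | smul (c : ℝ) {w : ℝ → ℝ} (hw : InSpan f n b w) : InSpan f n b (c • w)
  | congr {v w : ℝ → ℝ} (hv : InSpan f n b v) (h : v =ᵐ[volume.restrict (Ioi 0)] w) :
      InSpan f n b w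

lemma InSpan.rpow_mul {f : ℕ → ℝ → ℝ} {n : ℕ} {b : ℝ} {w : ℝ → ℝ} (h : InSpan f n b w) (a : ℝ) :
    InSpan f n (a + b) (fun r => r ^ a * w r) := by
  induction h with
  | basic j h1 hn =>
    refine (InSpan.basic j h1 hn).congr ?_
    filter_upwards [ae_restrict_mem measurableSet_Ioi] with r hr
    rw [← mul_assoc, ← Real.rpow_add hr, add_assoc]
  | add _ _ h1 h2 =>
    refine (h1.add h2).congr (Eventually.of_forall fun r => ?_)
    simp [mul_add]
  | smul c _ h1 =>
    refine (h1.smul c).congr (Eventually.of_forall fun r => ?_)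
    simp [mul_left_comm]
  | congr _ he h1 =>
    refine h1.congr ?_
    filter_upwards [he] with r hr
    rw [hr]

lemma InSpan.locallyIntegrableOn {f : ℕ → ℝ → ℝ} {n : ℕ} {b : ℝ} {w : ℝ → ℝ}
    (h : InSpan f n b w) (hf : ∀ j, 1 ≤ j → j ≤ n → LocallyIntegrableOn (f j) (Ioi 0)) :
    LocallyIntegrableOn w (Ioi 0) := by
  induction h with
  | basic j h1 hn => exact locallyIntegrableOn_rpow_mul (hf j h1 hn) _
  | add _ _ h1 h2 => exact h1.add h2
  | smul c _ h1 => exact h1.smul c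
  | congr _ he h1 => exact h1.congr he

lemma InSpan.exists_hasWeakDeriv {f : ℕ → ℝ → ℝ} {n : ℕ} {b : ℝ} {w : ℝ → ℝ}
    (h : InSpan f n b w) (hf : ∀ j, 1 ≤ j → j ≤ n → HasWeakDeriv 1 (f j) (f (j + 1))) :
    ∃ w', HasWeakDeriv 1 w w' ∧ InSpan f (n + 1) (b - 1) w' := by
  induction h with
  | basic j h1 hn =>
    refine ⟨_, (hf j h1 hn).rpow_mul (b + j), ?_⟩
    have i1 := (InSpan.basic (f := f) (n := n + 1) (b := b - 1) j h1 (by omega)).smul (b + j)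
    have i2 := InSpan.basic (f := f) (n := n + 1) (b := b - 1) (j + 1) (by omega) (by omega)
    refine (i1.add i2).congr (Eventually.of_forall fun r => ?_)
    simp only [Pi.add_apply, Pi.smul_apply, smul_eq_mul, Nat.cast_add, Nat.cast_one]
    rw [show b - 1 + (j : ℝ) = b + j - 1 by ring, show b - 1 + ((j : ℝ) + 1) = b + j by ring]
  | add _ _ h1 h2 =>
    obtain ⟨v', d1, s1⟩ := h1
    obtain ⟨w', d2, s2⟩ := h2
    exact ⟨_, d1.add d2, s1.add s2⟩
  | smul c _ h1 =>
    obtain ⟨v', d1, s1⟩ := h1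
    exact ⟨_, d1.smul c, s1.smul c⟩
  | congr _ he h1 =>
    obtain ⟨v', d1, s1⟩ := h1
    exact ⟨v', d1.congr he (EventuallyEq.refl _ _), s1⟩

lemma powInt_rpow_mul {p : ℝ} (hp : 0 < p) (a b : ℝ) (w : ℝ → ℝ) :
    powInt p b (Ioi 0) (fun r => r ^ a * w r) = powInt p (a * p + b) (Ioi 0) w := by
  refine setLIntegral_congr_fun measurableSet_Ioi fun r hr => ?_
  have hr0 : (0 : ℝ) < r := hr
  rw [enorm_mul, ENNReal.mul_rpow_of_nonneg _ _ hp.le, Real.enorm_of_nonneg (by positivity),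
    ENNReal.ofReal_rpow_of_pos (by positivity), ← Real.rpow_mul hr0.le, mul_right_comm,
    ← ENNReal.ofReal_mul (by positivity), ← Real.rpow_add hr0, mul_comm]

lemma powInt_add_le {p b : ℝ} (hp : 1 ≤ p) {v w : ℝ → ℝ}
    (hv : LocallyIntegrableOn v (Ioi 0)) :
    powInt p b (Ioi 0) (v + w) ≤
      2 ^ (p - 1) * (powInt p b (Ioi 0) v + powInt p b (Ioi 0) w) := by
  have m1 : AEMeasurable (fun r => ‖v r‖ₑ ^ p * ENNReal.ofReal (r ^ b)) (volume.restrict (Ioi 0)) :=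
    (hv.aestronglyMeasurable.enorm.pow_const p).mul (measurable_ofReal_rpow b).aemeasurable
  have h2 : (2 : ℝ≥0∞) ^ (p - 1) ≠ ⊤ := ENNReal.rpow_ne_top_of_nonneg (by linarith) (by simp)
  rw [powInt, powInt, powInt, ← lintegral_add_left' m1, ← lintegral_const_mul' _ _ h2]
  refine lintegral_mono fun r => ?_
  rw [← add_mul, ← mul_assoc]
  gcongr
  calc ‖(v + w) r‖ₑ ^ p ≤ (‖v r‖ₑ + ‖w r‖ₑ) ^ p := by
        gcongr
        exact enorm_add_le _ _
    _ ≤ _ := ENNReal.rpow_add_le_mul_rpow_add_rpow _ _ hp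

lemma powInt_smul {p b : ℝ} (hp : 0 < p) (c : ℝ) (S : Set ℝ) (w : ℝ → ℝ) :
    powInt p b S (c • w) = ‖c‖ₑ ^ p * powInt p b S w := by
  rw [powInt, powInt, ← lintegral_const_mul' _ _ (ENNReal.rpow_ne_top_of_nonneg hp.le (by simp))]
  refine lintegral_congr fun r => ?_
  simp only [Pi.smul_apply, smul_eq_mul]
  rw [enorm_mul, ENNReal.mul_rpow_of_nonneg _ _ hp.le, mul_assoc]

lemma InSpan.powInt_lt_top {p : ℝ} (hp : 1 < p) {f : ℕ → ℝ → ℝ} {n : ℕ} {a : ℝ} {w : ℝ → ℝ}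
    (h : InSpan f n (-a) w) (hf : ∀ j, 1 ≤ j → j ≤ n → LocallyIntegrableOn (f j) (Ioi 0))
    (hfin : ∀ j : ℕ, 1 ≤ j → j ≤ n → powInt p (j * p - 1) (Ioi 0) (f j) < ⊤) :
    powInt p (a * p - 1) (Ioi 0) w < ⊤ := by
  have hp0 : 0 < p := by linarith
  induction h with
  | basic j h1 hn =>
    rw [powInt_rpow_mul hp0]
    convert hfin j h1 hn using 2
    ring
  | add hv _ h1 h2 =>
    refine (powInt_add_le hp.le (hv.locallyIntegrableOn hf)).trans_lt ?_
    exact ENNReal.mul_lt_top (ENNReal.rpow_lt_top_of_nonneg (by linarith) (by simp))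
      (ENNReal.add_lt_top.2 ⟨h1, h2⟩)
  | smul c _ h1 =>
    rw [powInt_smul hp0]
    exact ENNReal.mul_lt_top (ENNReal.rpow_lt_top_of_nonneg hp0.le (by simp)) h1
  | congr _ he h1 => rwa [← powInt_congr subset_rfl he]

lemma gradL_zero (θ γ : ℝ) (u : ℝ → ℝ) : gradL θ γ 0 u = u := by
  simp [gradL]

lemma gradL_odd (θ γ : ℝ) (i : ℕ) (u : ℝ → ℝ) :
    gradL θ γ (2 * i + 1) u = weakDeriv (gradL θ γ (2 * i) u) := by
  have h : ¬ Even (2 * i + 1) := by simp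
  simp [gradL, h]

lemma gradL_even_succ (θ γ : ℝ) (i : ℕ) (u : ℝ → ℝ) :
    gradL θ γ (2 * i + 2) u =
      fun r => -(r ^ (-θ) * weakDeriv (fun s => s ^ γ * gradL θ γ (2 * i + 1) u s) r) := by
  have h : Even (2 * i + 2) := ⟨i + 1, by ring⟩
  have h2 : (2 * i + 2) / 2 = i + 1 := by omega
  rw [gradL_odd]
  simp only [gradL, h, if_true, h2, Function.iterate_succ', Function.comp]
  simp only [even_two_mul, if_true, show 2 * i / 2 = i by omega]
  rfl

/-- The scaling exponent of the gradient of order `j`. -/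
noncomputable def gradExp (θ γ : ℝ) (j : ℕ) : ℝ :=
  ((j / 2 : ℕ) : ℝ) * (θ + 2 - γ) + ((j % 2 : ℕ) : ℝ)

/-- The Hardy constant between the gradients of order `j` and `j + 1`. -/
noncomputable def hardyConst (θ γ : ℝ) (j : ℕ) : ℝ :=
  if Even j then ((j / 2 : ℕ) : ℝ) * (θ + 2 - γ) else γ - 1 - ((j / 2 : ℕ) : ℝ) * (θ + 2 - γ)

lemma gradL_step {p θ γ : ℝ} (hp : 1 < p) {f : ℕ → ℝ → ℝ} {k j : ℕ} (hj : 1 ≤ j) (hjk : j < k)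
    (hd : ∀ i, 1 ≤ i → i < k → HasWeakDeriv 1 (f i) (f (i + 1)))
    (hfin : ∀ i : ℕ, 1 ≤ i → i ≤ k → powInt p (i * p - 1) (Ioi 0) (f i) < ⊤)
    (hc : hardyConst θ γ j ≠ 0)
    (h : InSpan f j (-gradExp θ γ j) (gradL θ γ j (f 0))) :
    InSpan f (j + 1) (-gradExp θ γ (j + 1)) (gradL θ γ (j + 1) (f 0)) ∧
    powInt p (gradExp θ γ j * p - 1) (Ioi 0) (gradL θ γ j (f 0)) ≤
      ENNReal.ofReal (|hardyConst θ γ j| ^ (-p)) *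
        powInt p (gradExp θ γ (j + 1) * p - 1) (Ioi 0) (gradL θ γ (j + 1) (f 0)) := by
  have hp0 : 0 < p := by linarith
  have hd' : ∀ i, 1 ≤ i → i ≤ j → HasWeakDeriv 1 (f i) (f (i + 1)) := fun i h1 h2 =>
    hd i h1 (by omega)
  have hloc : ∀ i, 1 ≤ i → i ≤ j → LocallyIntegrableOn (f i) (Ioi 0) := fun i h1 h2 =>
    (hd' i h1 h2).1
  have hfin' : ∀ i : ℕ, 1 ≤ i → i ≤ j → powInt p (i * p - 1) (Ioi 0) (f i) < ⊤ :=
    fun i h1 h2 => hfin i h1 (by omega)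
  have hw := h.powInt_lt_top hp hloc hfin'
  rcases Nat.even_or_odd' j with ⟨i, rfl | rfl⟩
  · obtain ⟨w', d, s⟩ := h.exists_hasWeakDeriv hd'
    have he := d.weakDeriv_ae_eq
    rw [gradL_odd]
    have e1 : gradExp θ γ (2 * i + 1) = gradExp θ γ (2 * i) + 1 := by
      have h1 : (2 * i + 1) / 2 = i := by omega
      simp [gradExp, h1]
    have e2 : hardyConst θ γ (2 * i) = gradExp θ γ (2 * i) := by
      simp [gradExp, hardyConst]
    rw [e2] at hc ⊢
    rw [e1]
    refine ⟨?_, ?_⟩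
    · rw [neg_add]
      exact s.congr he.symm
    · rw [powInt_congr subset_rfl he]
      exact d.hardy hp hc hw
  · obtain ⟨w', d, s⟩ := (h.rpow_mul γ).exists_hasWeakDeriv hd'
    have he := d.weakDeriv_ae_eq
    have hg : (fun r => -1 * (r ^ (-θ) * w' r)) =ᵐ[volume.restrict (Ioi 0)]
        gradL θ γ (2 * i + 1 + 1) (f 0) := by
      rw [gradL_even_succ]
      filter_upwards [he] with r hr
      rw [hr]; ring
    have h1 : (2 * i + 1) / 2 = i := by omega
    have h2 : (2 * i + 1 + 1) / 2 = i + 1 := by omega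
    have h3 : (2 * i + 1 + 1) % 2 = 0 := by omega
    have h4 : ¬ Even (2 * i + 1) := by simp
    have e1 : gradExp θ γ (2 * i + 1 + 1) = gradExp θ γ (2 * i + 1) + θ + 1 - γ := by
      simp [gradExp, h1, h2, h3]; ring
    have e2 : hardyConst θ γ (2 * i + 1) = -(gradExp θ γ (2 * i + 1) - γ) := by
      simp [gradExp, hardyConst, h1, h4]; ring
    rw [e2] at hc ⊢
    rw [e1]
    refine ⟨?_, ?_⟩
    · have := ((s.rpow_mul (-θ)).smul (-1)).congr hg
      convert this using 1
      ring
    · have hz := d.hardy (a := gradExp θ γ (2 * i + 1) - γ) hp (neg_ne_zero.1 hc) (by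
        rw [powInt_rpow_mul hp0]
        convert hw using 2
        ring)
      rw [powInt_rpow_mul hp0] at hz
      rw [← powInt_congr subset_rfl hg]
      have := powInt_smul (b := (gradExp θ γ (2 * i + 1) + θ + 1 - γ) * p - 1) hp0 (-1) (Ioi 0)
        (fun r => r ^ (-θ) * w' r)
      simp only [enorm_neg, enorm_one, ENNReal.one_rpow, one_mul] at this
      have h5 : powInt p ((gradExp θ γ (2 * i + 1) + θ + 1 - γ) * p - 1) (Ioi 0)
          (fun r => -1 * (r ^ (-θ) * w' r)) =
          powInt p ((gradExp θ γ (2 * i + 1) - γ + 1) * p - 1) (Ioi 0) w' := by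
        refine this.trans ?_
        rw [powInt_rpow_mul hp0]
        congr 1
        ring
      rw [h5, abs_neg]
      refine le_trans (le_of_eq ?_) hz
      congr 1
      ring

lemma gradL_chain {p θ γ : ℝ} (hp : 1 < p) {f : ℕ → ℝ → ℝ} {k : ℕ} (hk : 1 ≤ k)
    (hd0 : HasWeakDeriv 1 (f 0) (f 1))
    (hd : ∀ i, 1 ≤ i → i < k → HasWeakDeriv 1 (f i) (f (i + 1)))
    (hfin : ∀ i : ℕ, 1 ≤ i → i ≤ k → powInt p (i * p - 1) (Ioi 0) (f i) < ⊤)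
    (hc : ∀ j, 1 ≤ j → j < k → hardyConst θ γ j ≠ 0) :
    powInt p (p - 1) (Ioi 0) (f 1) ≤
      ENNReal.ofReal (|∏ j ∈ Finset.Ico 1 k, hardyConst θ γ j| ^ (-p)) *
        powInt p (gradExp θ γ k * p - 1) (Ioi 0) (gradL θ γ k (f 0)) := by
  have hae : gradL θ γ 1 (f 0) =ᵐ[volume.restrict (Ioi 0)] f 1 := by
    rw [show 1 = 2 * 0 + 1 from rfl, gradL_odd, mul_zero, gradL_zero]
    exact hd0.weakDeriv_ae_eq
  have key : ∀ n, 1 ≤ n → n ≤ k →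
      InSpan f n (-gradExp θ γ n) (gradL θ γ n (f 0)) ∧
      powInt p (p - 1) (Ioi 0) (f 1) ≤
      ENNReal.ofReal (|∏ j ∈ Finset.Ico 1 n, hardyConst θ γ j| ^ (-p)) *
        powInt p (gradExp θ γ n * p - 1) (Ioi 0) (gradL θ γ n (f 0)) := by
    intro n hn
    induction n, hn using Nat.le_induction with
    | base =>
      intro _
      have e : gradExp θ γ 1 = 1 := by simp [gradExp]
      rw [e]
      refine ⟨?_, ?_⟩
      · refine (InSpan.basic 1 le_rfl le_rfl).congr ?_
        filter_upwards [hae] with r hr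
        simp [hr]
      · rw [powInt_congr subset_rfl hae]
        simp
    | succ n hn ih =>
      intro hnk
      obtain ⟨i1, i2⟩ := ih (by omega)
      obtain ⟨j1, j2⟩ := gradL_step hp hn (by omega) hd hfin (hc n hn (by omega)) i1
      refine ⟨j1, i2.trans ((mul_le_mul' le_rfl j2).trans (le_of_eq ?_))⟩
      rw [← mul_assoc, ← ENNReal.ofReal_mul (by positivity), Finset.prod_Ico_succ_top hn, abs_mul,
        Real.mul_rpow (abs_nonneg _) (abs_nonneg _)]
  exact (key k hk le_rfl).2

lemma powInt_deriv_lt_top {p : ℝ} (hp : 1 < p) {f : ℕ → ℝ → ℝ} {k : ℕ} {α : ℕ → ℝ}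
    (hd : ∀ i, i < k → HasWeakDeriv 1 (f i) (f (i + 1)))
    (hα : ∀ i : ℕ, 1 ≤ i → i ≤ k → i * p - 1 ≤ α i) (hαk : α k = k * p - 1)
    (hfin : ∀ i : ℕ, i ≤ k → powInt p (α i) (Ioi 0) (f i) < ⊤) (i : ℕ) (hi : 1 ≤ i) (hik : i ≤ k) :
    powInt p (i * p - 1) (Ioi 0) (f i) < ⊤ := by
  have key : ∀ n i : ℕ, i + n = k → 1 ≤ i → powInt p (i * p - 1) (Ioi 0) (f i) < ⊤ := by
    intro n
    induction n with
    | zero =>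
      intro i hin hi
      have : i = k := by omega
      rw [this, ← hαk]
      exact hfin k le_rfl
    | succ n ih =>
      intro i hin hi
      have hi0 : (1 : ℝ) ≤ i := by exact_mod_cast hi
      have h1 := ih (i + 1) (by omega) (by omega)
      push_cast at h1
      refine ((hd i (by omega)).hardy_Ioi hp (a := i) (R := 0) (by linarith) le_rfl ?_).trans_lt
        (ENNReal.mul_lt_top ENNReal.ofReal_lt_top h1)
      refine lt_of_le_of_lt ?_ (hfin i (by omega))
      refine (powInt_Ioi_one_mono ?_ _).trans (powInt_mono_set (Ioi_subset_Ioi zero_le_one) _)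
      have := hα i hi (by omega)
      nlinarith
  exact key (k - i) i (by omega) hi

lemma hardyConst_pos {θ γ : ℝ} {k j : ℕ} (hσ : γ < θ + 2)
    (hθ : ((k / 2 : ℕ) : ℝ) * (θ + 2 - γ) - 1 < θ) (hj : 1 ≤ j) (hjk : j < k) :
    0 < hardyConst θ γ j := by
  rw [hardyConst]
  split_ifs with h
  · have h2 : 0 < j / 2 := by
      obtain ⟨i, rfl⟩ := h
      omega
    have : (0 : ℝ) < ((j / 2 : ℕ) : ℝ) := by exact_mod_cast h2
    exact mul_pos this (by linarith)
  · have h2 : j / 2 + 1 ≤ k / 2 := by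
      obtain ⟨i, rfl⟩ := Nat.not_even_iff_odd.1 h
      omega
    have : ((j / 2 : ℕ) : ℝ) + 1 ≤ ((k / 2 : ℕ) : ℝ) := by exact_mod_cast h2
    nlinarith

lemma prod_hardyConst_odd {θ γ : ℝ} (hσ : γ < θ + 2) (hγ : 1 < γ) (m : ℕ)
    (hm : ∀ i : ℕ, i < m → 0 < γ - 1 - i * (θ + 2 - γ)) :
    ∏ j ∈ Finset.Ico 1 (2 * m + 1), hardyConst θ γ j =
      (γ - 1) * (θ + 2 - γ) ^ (2 * (m : ℝ) - 1) *
      (Real.Gamma (m + 1) * Real.Gamma ((γ - 1) / (θ + 2 - γ)) /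
        Real.Gamma ((γ - 1) / (θ + 2 - γ) - (m - 1))) := by
  set σ := θ + 2 - γ with hσd
  have hσ0 : 0 < σ := by simp only [hσd]; linarith
  set x := (γ - 1) / σ with hx
  have hxσ : γ - 1 = x * σ := by rw [hx]; field_simp
  have hx0 : 0 < x := div_pos (by linarith) hσ0
  induction m with
  | zero =>
    have h1 := (Real.Gamma_pos_of_pos hx0).ne'
    simp only [mul_zero, zero_add, Finset.Ico_self, Finset.prod_empty, Nat.cast_zero, zero_sub,
      Real.Gamma_one, sub_neg_eq_add, one_mul]
    rw [Real.Gamma_add_one hx0.ne', Real.rpow_neg_one, hxσ]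
    field_simp
  | succ m ih =>
    have hmm : 0 < x - m := by
      have := hm m (by omega)
      rw [hxσ] at this
      by_contra hle
      nlinarith
    rw [show 2 * (m + 1) + 1 = (2 * m + 1 + 1) + 1 by ring, Finset.prod_Ico_succ_top (by omega),
      Finset.prod_Ico_succ_top (by omega), ih fun i hi => hm i (by omega)]
    have e1 : hardyConst θ γ (2 * m + 1) = σ * (x - m) := by
      have h1 : (2 * m + 1) / 2 = m := by omega
      have h4 : ¬ Even (2 * m + 1) := by simp
      simp only [hardyConst, h1, h4, if_false, ← hσd]
      rw [hxσ]; ring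
    have e2 : hardyConst θ γ (2 * m + 1 + 1) = (m + 1) * σ := by
      have h1 : (2 * m + 1 + 1) / 2 = m + 1 := by omega
      have h4 : Even (2 * m + 1 + 1) := ⟨m + 1, by ring⟩
      simp [hardyConst, h1, h4, ← hσd]
    have g1 : Real.Gamma (x - (m - 1)) = (x - m) * Real.Gamma (x - m) := by
      rw [← Real.Gamma_add_one hmm.ne']
      congr 1
      ring
    have g2 : Real.Gamma ((m : ℝ) + 1 + 1) = (m + 1) * Real.Gamma (m + 1) :=
      Real.Gamma_add_one (by positivity)
    have g3 : σ ^ (2 * ((m : ℝ) + 1) - 1) = σ ^ (2 * (m : ℝ) - 1) * σ ^ (2 : ℕ) := by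
      rw [← Real.rpow_add_natCast hσ0.ne']
      congr 1
      push_cast
      ring
    have g4 := (Real.Gamma_pos_of_pos hmm).ne'
    push_cast
    rw [e1, e2, g1, g2, g3, add_sub_cancel_right]
    field_simp

lemma betaCrit_eq {θ γ p η : ℝ} {k : ℕ} (hk : 1 ≤ k) (hσ : γ < θ + 2) (hγ : 1 < γ)
    (hθ : ((k / 2 : ℕ) : ℝ) * (θ + 2 - γ) - 1 < θ) :
    betaCrit k p η θ γ =
      (η + 1) * (∏ j ∈ Finset.Ico 1 k, hardyConst θ γ j) ^ (p / (p - 1)) := by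
  have hm : ∀ i : ℕ, i < k / 2 → 0 < γ - 1 - i * (θ + 2 - γ) := fun i hi => by
    have : (i : ℝ) + 1 ≤ ((k / 2 : ℕ) : ℝ) := by exact_mod_cast hi
    nlinarith
  rcases Nat.even_or_odd' k with ⟨m, rfl | rfl⟩
  · obtain ⟨m, rfl⟩ : ∃ n, m = n + 1 := ⟨m - 1, by omega⟩
    have hdiv : 2 * (m + 1) / 2 = m + 1 := by omega
    rw [hdiv] at hm
    have h0 := prod_hardyConst_odd hσ hγ m fun i hi => hm i (by omega)
    have hmm := hm m (by omega)
    have hev : Even (2 * (m + 1)) := ⟨m + 1, by ring⟩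
    rw [betaCrit, if_pos hev, show 2 * (m + 1) = 2 * m + 1 + 1 by ring,
      Finset.prod_Ico_succ_top (by omega), h0]
    congr 2
    set σ := θ + 2 - γ with hσd
    have hσ0 : 0 < σ := by simp only [hσd]; linarith
    set x := (γ - 1) / σ with hx
    have hxσ : γ - 1 = x * σ := by rw [hx]; field_simp
    have hmx : 0 < x - m := by
      rw [hxσ] at hmm
      by_contra hle
      nlinarith
    have e1 : hardyConst θ γ (2 * m + 1) = σ * (x - m) := by
      have h1 : (2 * m + 1) / 2 = m := by omega
      have h4 : ¬ Even (2 * m + 1) := by simp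
      simp only [hardyConst, h1, h4, if_false, ← hσd]
      rw [hxσ]; ring
    have g1 : Real.Gamma (x - (m - 1)) = (x - m) * Real.Gamma (x - m) := by
      rw [← Real.Gamma_add_one hmx.ne']
      congr 1
      ring
    have g3 : σ ^ (((2 * m + 1 + 1 : ℕ) : ℝ) - 2) = σ ^ (2 * (m : ℝ) - 1) * σ := by
      rw [← Real.rpow_add_one hσ0.ne']
      congr 1
      push_cast
      ring
    have g4 := (Real.Gamma_pos_of_pos hmx).ne'
    have a1 : ((2 * m + 1 + 1 : ℕ) : ℝ) / 2 = m + 1 := by push_cast; ring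
    have a2 : (((2 * m + 1 + 1 : ℕ) : ℝ) - 2) / 2 = m := by push_cast; ring
    rw [e1, a1, a2, g1, g3]
    field_simp
  · have hdiv : (2 * m + 1) / 2 = m := by omega
    rw [hdiv] at hm
    have hev : ¬ Even (2 * m + 1) := by simp
    rw [betaCrit, if_neg hev, prod_hardyConst_odd hσ hγ m hm]
    congr 3
    · congr 2
      push_cast; ring
    · congr 2
      · congr 1
        push_cast; ring
      · push_cast; ring

/-- `v` has `p`-energy at most one, where `E t` bounds the energy on `(t, ∞)`, and
`∫ |v| ^ p e ^ t dt ≤ A`. -/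
structure EnergyBound (p A : ℝ) (v E : ℝ → ℝ) : Prop where
  cont : Continuous v
  anti : Antitone E
  nonneg : ∀ t, 0 ≤ E t
  le_one : ∀ t, E t ≤ 1
  holder : ∀ s t, s ≤ t → |v s - v t| ≤ (E s - E t) ^ (1 / p) * (t - s) ^ ((p - 1) / p)
  mass : ∫⁻ t, ‖v t‖ₑ ^ p * ENNReal.ofReal (Real.exp t) ≤ ENNReal.ofReal A

lemma ofReal_mul_le_lintegral_of_le {f : ℝ → ℝ≥0∞} {a b c : ℝ} (hc : 0 ≤ c)
    (h : ∀ s ∈ Icc a b, ENNReal.ofReal c ≤ f s) :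
    ENNReal.ofReal (c * (b - a)) ≤ ∫⁻ s, f s := by
  calc ENNReal.ofReal (c * (b - a)) = ∫⁻ _ in Icc a b, ENNReal.ofReal c := by
        rw [setLIntegral_const, Real.volume_Icc, ENNReal.ofReal_mul hc]
    _ ≤ ∫⁻ s in Icc a b, f s :=
        setLIntegral_mono_ae' measurableSet_Icc (Eventually.of_forall h)
    _ ≤ _ := setLIntegral_le_lintegral _ _

lemma rpow_convex_combination_le (a b x y : ℝ) (ha : 0 ≤ a) (hb : 0 ≤ b) (hx : 0 ≤ x) (hy : 0 ≤ y)
    (hab : a + b = 1) {q : ℝ} (hq : 1 ≤ q) : (a * x + b * y) ^ q ≤ a * x ^ q + b * y ^ q :=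
  (convexOn_rpow hq).2 hx hy ha hb hab

namespace EnergyBound

variable {p A : ℝ} {v E : ℝ → ℝ}

lemma window (h : EnergyBound p A v E) (hp : 1 < p) (hA : 0 < A) {t L : ℝ} (hv : 0 < |v t|)
    (hL : 1 ≤ L) (hE : E t * L ^ (p - 1) ≤ |v t| ^ p) :
    (|v t| / (2 * (p / (p - 1)) * L)) ^ p * Real.exp (t + L - 1) / 2 ≤ A := by
  have hp0 : 0 < p := by linarith
  have hp1 : 0 < p - 1 := by linarith
  have hL0 : 0 < L := by linarith
  have hlow : ∀ s ∈ Icc (t + L - 1) (t + L - 1 / 2), |v t| / (2 * (p / (p - 1)) * L) ≤ |v s| := by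
    intro s hs
    have hts : t ≤ s := by linarith [hs.1]
    have h1 := h.holder t s hts
    have hEt : (E t - E s) ^ (1 / p) ≤ |v t| * L ^ (-((p - 1) / p)) := by
      calc (E t - E s) ^ (1 / p) ≤ (|v t| ^ p * L ^ (-(p - 1))) ^ (1 / p) := by
            refine Real.rpow_le_rpow (sub_nonneg.2 (h.anti hts)) ?_ (by positivity)
            rw [Real.rpow_neg hL0.le, ← div_eq_mul_inv, le_div_iff₀ (by positivity)]
            refine le_trans ?_ hE
            gcongr
            linarith [h.nonneg s]
        _ = _ := by
            rw [Real.mul_rpow (by positivity) (by positivity), ← Real.rpow_mul hv.le,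
              ← Real.rpow_mul hL0.le, mul_one_div_cancel hp0.ne', Real.rpow_one]
            congr 2
            ring
    have hst : (s - t) ^ ((p - 1) / p) ≤ (L - 1 / 2) ^ ((p - 1) / p) := by
      refine Real.rpow_le_rpow (by linarith) (by linarith [hs.2]) (by positivity)
    have hbern : (L - 1 / 2) ^ ((p - 1) / p) ≤
        L ^ ((p - 1) / p) * (1 - (p - 1) / p * (1 / (2 * L))) := by
      have hb := rpow_one_add_le_one_add_mul_self (s := -(1 / (2 * L))) (p := (p - 1) / p)
        (by rw [neg_le_neg_iff, div_le_one (by positivity)]; linarith)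
        (by positivity) (by rw [div_le_one hp0]; linarith)
      have e : L - 1 / 2 = L * (1 + -(1 / (2 * L))) := by field_simp; ring
      have hb0 : 0 ≤ 1 + -(1 / (2 * L)) := by
        have : 1 / (2 * L) ≤ 1 := by rw [div_le_one (by positivity)]; linarith
        linarith
      rw [e, Real.mul_rpow hL0.le hb0]
      gcongr
      linarith
    have h2 : (E t - E s) ^ (1 / p) * (s - t) ^ ((p - 1) / p) ≤
        |v t| * (1 - (p - 1) / p * (1 / (2 * L))) := by
      calc _ ≤ (|v t| * L ^ (-((p - 1) / p))) *
            (L ^ ((p - 1) / p) * (1 - (p - 1) / p * (1 / (2 * L)))) := by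
            refine mul_le_mul hEt (hst.trans hbern) ?_ (by positivity)
            exact Real.rpow_nonneg (by linarith) _
        _ = _ := by
            rw [Real.rpow_neg hL0.le]
            have : L ^ ((p - 1) / p) ≠ 0 := (Real.rpow_pos_of_pos hL0 _).ne'
            field_simp
    have h3 := abs_sub_abs_le_abs_sub (v t) (v s)
    have e4 : |v t| / (2 * (p / (p - 1)) * L) = |v t| * ((p - 1) / p * (1 / (2 * L))) := by
      field_simp
    rw [e4]
    nlinarith
  set c := |v t| / (2 * (p / (p - 1)) * L)
  have hc : 0 < c := by positivity
  have := (ofReal_mul_le_lintegral_of_le (f := fun t => ‖v t‖ₑ ^ p * ENNReal.ofReal (Real.exp t))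
    (a := t + L - 1) (b := t + L - 1 / 2) (c := c ^ p * Real.exp (t + L - 1)) (by positivity)
    fun s hs => by
      rw [ENNReal.ofReal_mul (by positivity), ← ENNReal.ofReal_rpow_of_pos hc,
        Real.enorm_eq_ofReal_abs]
      gcongr
      · exact hlow s hs
      · exact hs.1).trans h.mass
  rw [ENNReal.ofReal_le_ofReal_iff hA.le] at this
  linarith

/-- The constant in the descending growth estimate. -/
noncomputable def growthConst (p A : ℝ) : ℝ :=
  |Real.log (2 * A * (2 * (p / (p - 1))) ^ p)| + 1

lemma growthConst_pos (p A : ℝ) : 0 < growthConst p A := by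
  unfold growthConst; positivity

lemma descending_growth (h : EnergyBound p A v E) (hp : 1 < p) (hA : 0 < A) {t L : ℝ}
    (hv : 0 < |v t|) (hL : 1 ≤ L) (hE : E t * L ^ (p - 1) ≤ |v t| ^ p) :
    t + L ≤ growthConst p A + p * Real.log L - p * Real.log |v t| := by
  have hp1 : 0 < p - 1 := by linarith
  have hL0 : 0 < L := by linarith
  have hw := h.window hp hA hv hL hE
  have hP : 0 < 2 * (p / (p - 1)) := by positivity
  have h1 : Real.exp (t + L - 1) ≤ 2 * A * (2 * (p / (p - 1))) ^ p * (L ^ p / |v t| ^ p) := by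
    rw [Real.div_rpow hv.le (by positivity), Real.mul_rpow hP.le hL0.le, div_mul_eq_mul_div,
      div_div, div_le_iff₀ (by positivity)] at hw
    rw [← mul_div_assoc, le_div_iff₀ (by positivity)]
    linarith
  have h2 := Real.log_le_log (Real.exp_pos _) h1
  rw [Real.log_exp, Real.log_mul (by positivity) (by positivity),
    Real.log_div (by positivity) (by positivity), Real.log_rpow hL0, Real.log_rpow hv] at h2
  have := le_abs_self (Real.log (2 * A * (2 * (p / (p - 1))) ^ p))
  unfold growthConst
  linarith

lemma log_rpow_conj (hp : 1 < p) {y : ℝ} (hy : 0 < y) :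
    (p - 1) * Real.log (y ^ (p / (p - 1))) = p * Real.log y := by
  have hp1 : p - 1 ≠ 0 := by linarith
  rw [Real.log_rpow hy]
  field_simp

lemma rpow_conj_rpow (hp : 1 < p) {y : ℝ} (hy : 0 ≤ y) :
    (y ^ (p / (p - 1))) ^ (p - 1) = y ^ p := by
  have hp1 : p - 1 ≠ 0 := by linarith
  rw [← Real.rpow_mul hy]
  congr 1
  field_simp

lemma level_le (h : EnergyBound p A v E) (hp : 1 < p) (hA : 0 < A) {t : ℝ} (hv : 1 ≤ |v t|) :
    t + |v t| ^ (p / (p - 1)) - Real.log (|v t| ^ (p / (p - 1))) ≤ growthConst p A := by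
  have hv0 : 0 < |v t| := by linarith
  have hp1 : 0 < p - 1 := by linarith
  have hx : 1 ≤ |v t| ^ (p / (p - 1)) := Real.one_le_rpow hv (by positivity)
  have := h.descending_growth hp hA hv0 hx (by
    rw [rpow_conj_rpow hp hv0.le]
    exact mul_le_of_le_one_left (by positivity) (h.le_one t))
  rw [← log_rpow_conj hp hv0] at this
  linarith

lemma one_sub_energy_le (h : EnergyBound p A v E) (hp : 1 < p) (hA : 0 < A) {t lam : ℝ}
    (hv : 1 ≤ |v t|) (hlam : 0 ≤ lam)
    (hlev : -lam ≤ t + |v t| ^ (p / (p - 1)) - Real.log (|v t| ^ (p / (p - 1))))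
    (hx : 2 * p ≤ |v t| ^ (p / (p - 1))) :
    1 - E t ≤ p * (2 * (growthConst p A + lam) + 1) / |v t| ^ (p / (p - 1)) := by
  have hv0 : 0 < |v t| := by linarith
  have hp1 : 0 < p - 1 := by linarith
  have hC := growthConst_pos p A
  set x := |v t| ^ (p / (p - 1)) with hxd
  set K := 2 * (growthConst p A + lam) + 1 with hK
  have hx0 : 0 < x := by linarith
  have hK0 : 0 < K := by rw [hK]; positivity
  have h1 : x ^ (p - 1) < E t * (x + K) ^ (p - 1) := by
    by_contra! hle
    have hd := h.descending_growth hp hA hv0 (L := x + K) (by linarith)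
      (by rwa [← rpow_conj_rpow hp hv0.le])
    rw [← log_rpow_conj hp hv0, ← hxd] at hd
    have hl : Real.log (x + K) ≤ Real.log x + K / x := by
      have h2 := Real.log_le_sub_one_of_pos (x := (x + K) / x) (by positivity)
      rw [Real.log_div (by positivity) hx0.ne', add_div, div_self hx0.ne'] at h2
      linarith
    have h3 : p * (K / x) ≤ K / 2 := by
      rw [← mul_div_assoc, div_le_div_iff₀ hx0 two_pos]
      nlinarith
    nlinarith
  have h2 : (x / (x + K)) ^ (p - 1) ≤ E t := by
    rw [Real.div_rpow hx0.le (by positivity), div_le_iff₀ (by positivity)]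
    exact h1.le
  have hy1 : x / (x + K) ≤ 1 := by rw [div_le_one (by positivity)]; linarith
  have h3 : (x / (x + K)) ^ p ≤ (x / (x + K)) ^ (p - 1) :=
    Real.rpow_le_rpow_of_exponent_ge (by positivity) hy1 (by linarith)
  have h4 := one_add_mul_self_le_rpow_one_add (s := x / (x + K) - 1) (p := p)
    (by linarith [show 0 ≤ x / (x + K) by positivity]) hp.le
  rw [add_sub_cancel] at h4
  have h5 : x / (x + K) - 1 = -(K / (x + K)) := by field_simp; ring
  have h6 : K / (x + K) ≤ K / x := by gcongr; linarith
  rw [h5] at h4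
  rw [mul_div_assoc]
  nlinarith

lemma rpow_add_le_convex (hp : 1 < p) {y e d : ℝ} (hy : 0 ≤ y) (he : 0 < e) (he' : e ≤ 1 / 4)
    (hd : 0 ≤ d) :
    (y + e ^ (1 / p) * d ^ ((p - 1) / p)) ^ (p / (p - 1)) ≤
      y ^ (p / (p - 1)) * (1 + 4 * 2 ^ (1 / (p - 1) + 1) * e) + 2 ^ (-(1 / (p - 1))) * d := by
  have hp0 : 0 < p := by linarith
  have hp1 : 0 < p - 1 := by linarith
  have hP : 1 ≤ p / (p - 1) := by rw [le_div_iff₀ hp1]; linarith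
  have hw : 0 < 1 - 2 * e := by linarith
  have hq : p / (p - 1) = 1 + 1 / (p - 1) := by field_simp; ring
  set z := e ^ (1 / p) * d ^ ((p - 1) / p) with hz
  have hz0 : 0 ≤ z := by positivity
  have hconv := rpow_convex_combination_le (1 - 2 * e) (2 * e) (y / (1 - 2 * e))
    (z / (2 * e)) hw.le (by positivity) (by positivity) (by positivity) (by ring) hP
  have e1 : (1 - 2 * e) * (y / (1 - 2 * e)) + 2 * e * (z / (2 * e)) = y + z := by field_simp
  rw [e1] at hconv
  refine hconv.trans (add_le_add ?_ (le_of_eq ?_))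
  · rw [Real.div_rpow hy hw.le, mul_div_assoc', mul_comm (1 - 2 * e), mul_div_assoc]
    gcongr
    have h1 : (1 - 2 * e) / (1 - 2 * e) ^ (p / (p - 1)) = ((1 - 2 * e)⁻¹) ^ (1 / (p - 1)) := by
      rw [hq, Real.rpow_add hw, Real.rpow_one, Real.inv_rpow hw.le]
      field_simp
    have h2 : (1 - 2 * e)⁻¹ ≤ 1 + 4 * e := by
      rw [inv_le_comm₀ hw (by positivity), ← one_div, div_le_iff₀ (by positivity)]
      nlinarith
    have hq1 : 1 ≤ 1 / (p - 1) + 1 := by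
      have : 0 < 1 / (p - 1) := by positivity
      linarith
    have h3 := rpow_convex_combination_le (1 - 4 * e) (4 * e) 1 2
      (by linarith) (by positivity) zero_le_one two_pos.le (by ring) hq1
    rw [Real.one_rpow] at h3
    rw [h1]
    calc _ ≤ (1 + 4 * e) ^ (1 / (p - 1)) := by gcongr
      _ ≤ (1 + 4 * e) ^ (1 / (p - 1) + 1) :=
          Real.rpow_le_rpow_of_exponent_le (by linarith) (by linarith)
      _ = ((1 - 4 * e) * 1 + 4 * e * 2) ^ (1 / (p - 1) + 1) := by congr 1; ring
      _ ≤ _ := by nlinarith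
  · rw [Real.div_rpow hz0 (by positivity), hz, Real.mul_rpow (by positivity) (by positivity),
      ← Real.rpow_mul he.le, ← Real.rpow_mul hd,
      show (p - 1) / p * (p / (p - 1)) = 1 by field_simp, Real.rpow_one,
      show 1 / p * (p / (p - 1)) = 1 / (p - 1) by field_simp, hq, Real.rpow_add (by positivity),
      Real.rpow_one, Real.mul_rpow two_pos.le he.le, Real.rpow_neg two_pos.le]
    have : e ^ (1 / (p - 1)) ≠ 0 := (Real.rpow_pos_of_pos he _).ne'
    field_simp

lemma sub_log_le {x X : ℝ} (hx : 1 ≤ x) (hX : x ≤ X) : x - Real.log x ≤ X - Real.log X := by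
  have hx0 : 0 < x := by linarith
  have hX0 : 0 < X := by linarith
  have h := Real.log_le_sub_one_of_pos (x := X / x) (by positivity)
  rw [Real.log_div hX0.ne' hx0.ne'] at h
  have : X / x - 1 ≤ X - x := by
    rw [← sub_nonneg]
    have : X - x - (X / x - 1) = (X - x) * (x - 1) / x := by field_simp
    rw [this]
    exact div_nonneg (mul_nonneg (by linarith) (by linarith)) hx0.le
  linarith

lemma level_diam (h : EnergyBound p A v E) (hp : 1 < p) (hA : 0 < A) {s t lam : ℝ} (hst : s < t)
    (hlam : 0 ≤ lam) (hvt : 1 ≤ |v t|) (hvs : 1 ≤ |v s|)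
    (hlt : -lam ≤ t + |v t| ^ (p / (p - 1)) - Real.log (|v t| ^ (p / (p - 1))))
    (hls : -lam ≤ s + |v s| ^ (p / (p - 1)) - Real.log (|v s| ^ (p / (p - 1))))
    (hx : 4 * p * (2 * (growthConst p A + lam) + 1) ≤ |v t| ^ (p / (p - 1))) :
    (1 - 2 ^ (-(1 / (p - 1)))) * (t - s) ≤ growthConst p A + lam +
      4 * 2 ^ (1 / (p - 1) + 1) * p * (2 * (growthConst p A + lam) + 1) := by
  have hp0 : 0 < p := by linarith
  have hp1 : 0 < p - 1 := by linarith
  have hC := growthConst_pos p A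
  have hlev := h.level_le hp hA hvt
  set C := growthConst p A
  set K := 2 * (C + lam) + 1 with hK
  have hK1 : 1 ≤ K := by rw [hK]; linarith
  have hE := h.one_sub_energy_le hp hA hvt hlam hlt (by nlinarith)
  rw [← hK] at hE
  set x := |v t| ^ (p / (p - 1)) with hxd
  have hx0 : 0 < x := by nlinarith
  set e := p * K / x with he
  have he0 : 0 < e := by positivity
  have he1 : e ≤ 1 / 4 := by
    rw [he, div_le_div_iff₀ hx0 (by norm_num)]
    linarith
  have hvs' : |v s| ≤ |v t| + e ^ (1 / p) * (t - s) ^ ((p - 1) / p) := by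
    have h1 := h.holder s t hst.le
    have h2 := abs_sub_abs_le_abs_sub (v s) (v t)
    have h3 : (E s - E t) ^ (1 / p) ≤ e ^ (1 / p) :=
      Real.rpow_le_rpow (sub_nonneg.2 (h.anti hst.le)) (by linarith [h.le_one s]) (by positivity)
    have h4 : (0 : ℝ) ≤ (t - s) ^ ((p - 1) / p) := Real.rpow_nonneg (by linarith) _
    nlinarith
  have hX : |v s| ^ (p / (p - 1)) ≤
      x * (1 + 4 * 2 ^ (1 / (p - 1) + 1) * e) + 2 ^ (-(1 / (p - 1))) * (t - s) :=
    (Real.rpow_le_rpow (abs_nonneg _) hvs' (by positivity)).trans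
      (rpow_add_le_convex hp (abs_nonneg _) he0 he1 (by linarith))
  have hex : x * (1 + 4 * 2 ^ (1 / (p - 1) + 1) * e) = x + 4 * 2 ^ (1 / (p - 1) + 1) * p * K := by
    rw [he]; field_simp
  rw [hex] at hX
  have hs1 : 1 ≤ |v s| ^ (p / (p - 1)) := Real.one_le_rpow hvs (by positivity)
  have h1 := sub_log_le hs1 hX
  have hc0 : (0 : ℝ) ≤ 2 ^ (-(1 / (p - 1))) * (t - s) :=
    mul_nonneg (by positivity) (by linarith)
  have h2 : Real.log x ≤ Real.log (x + 4 * 2 ^ (1 / (p - 1) + 1) * p * K +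
      2 ^ (-(1 / (p - 1))) * (t - s)) := by
    refine Real.log_le_log hx0 ?_
    have : (0 : ℝ) ≤ 4 * 2 ^ (1 / (p - 1) + 1) * p * K := by positivity
    linarith
  nlinarith

/-- The level set on which the exponential density is at least `e ^ (-lam)`. -/
def levelSet (p : ℝ) (v : ℝ → ℝ) (lam : ℝ) : Set ℝ :=
  {t | 1 ≤ |v t| ∧ -lam ≤ t + |v t| ^ (p / (p - 1)) - Real.log (|v t| ^ (p / (p - 1)))}

/-- The growth rate of the measure of the level sets. -/
noncomputable def levelConst (p A : ℝ) : ℝ :=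
  (growthConst p A + 1 + 4 * p * (2 * (growthConst p A + 1) + 1)) +
    (growthConst p A + 1 +
      4 * 2 ^ (1 / (p - 1) + 1) * p * (2 * (growthConst p A + 1) + 1)) /
      (1 - 2 ^ (-(1 / (p - 1))))

lemma volume_levelSet_le (h : EnergyBound p A v E) (hp : 1 < p) (hA : 0 < A) {lam : ℝ}
    (hlam : 0 ≤ lam) :
    volume (levelSet p v lam) ≤ ENNReal.ofReal (levelConst p A * (lam + 1)) := by
  have hp0 : 0 < p := by linarith
  have hp1 : 0 < p - 1 := by linarith
  have hC := growthConst_pos p A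
  set C := growthConst p A with hCd
  set c : ℝ := 1 - 2 ^ (-(1 / (p - 1))) with hc
  have hc0 : 0 < c := by
    have : (2 : ℝ) ^ (-(1 / (p - 1))) < 1 :=
      Real.rpow_lt_one_of_one_lt_of_neg one_lt_two (by
        have : 0 < 1 / (p - 1) := by positivity
        linarith)
    rw [hc]; linarith
  set B := 4 * p * (2 * (C + lam) + 1) with hB
  set D := (C + lam + 4 * 2 ^ (1 / (p - 1) + 1) * p * (2 * (C + lam) + 1)) / c with hD
  have hsub : levelSet p v lam ⊆ Icc (-lam - B) C ∪
      {t | t ∈ levelSet p v lam ∧ B ≤ |v t| ^ (p / (p - 1))} := by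
    intro t ht
    by_cases hb : B ≤ |v t| ^ (p / (p - 1))
    · exact Or.inr ⟨ht, hb⟩
    · left
      have hx : 1 ≤ |v t| ^ (p / (p - 1)) := Real.one_le_rpow ht.1 (by positivity)
      have h1 := h.level_le hp hA ht.1
      have h2 := ht.2
      have h3 := Real.log_nonneg hx
      have h4 := Real.log_le_self (show 0 ≤ |v t| ^ (p / (p - 1)) by linarith)
      push Not at hb
      exact ⟨by linarith, by linarith⟩
  have hbig : volume {t | t ∈ levelSet p v lam ∧ B ≤ |v t| ^ (p / (p - 1))} ≤
      ENNReal.ofReal D := by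
    refine (Real.volume_le_diam _).trans (Metric.ediam_le fun s hs t ht => ?_)
    have key : ∀ s t, s < t → s ∈ {t | t ∈ levelSet p v lam ∧ B ≤ |v t| ^ (p / (p - 1))} →
        t ∈ {t | t ∈ levelSet p v lam ∧ B ≤ |v t| ^ (p / (p - 1))} → t - s ≤ D := by
      intro s t hst hs ht
      have := h.level_diam hp hA hst hlam ht.1.1 hs.1.1 ht.1.2 hs.1.2 ht.2
      rw [hD, le_div_iff₀ hc0]
      linarith
    rw [edist_dist, Real.dist_eq]
    refine ENNReal.ofReal_le_ofReal ?_
    rcases lt_trichotomy s t with hlt | rfl | hlt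
    · rw [abs_of_neg (by linarith)]
      have := key s t hlt hs ht
      linarith
    · rw [sub_self, abs_zero]; positivity
    · rw [abs_of_pos (by linarith)]
      exact key t s hlt ht hs
  have hD0 : 0 ≤ D := by positivity
  have hB0 : 0 ≤ B := by positivity
  calc _ ≤ _ := measure_mono hsub
    _ ≤ _ := measure_union_le _ _
    _ ≤ ENNReal.ofReal (C - (-lam - B)) + ENNReal.ofReal D := by
        rw [Real.volume_Icc]
        gcongr
    _ = ENNReal.ofReal (C + lam + B + D) := by
        rw [← ENNReal.ofReal_add (by linarith) hD0]
        congr 1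
        ring
    _ ≤ _ := by
        refine ENNReal.ofReal_le_ofReal ?_
        have hCl : C + lam ≤ (C + 1) * (lam + 1) := by nlinarith
        have hK : 2 * (C + lam) + 1 ≤ (2 * (C + 1) + 1) * (lam + 1) := by nlinarith
        have hB' : B ≤ 4 * p * ((2 * (C + 1) + 1) * (lam + 1)) := by
          rw [hB]; gcongr
        have hD' : D ≤ (C + 1 + 4 * 2 ^ (1 / (p - 1) + 1) * p * (2 * (C + 1) + 1)) / c *
            (lam + 1) := by
          rw [hD, div_mul_eq_mul_div]
          gcongr
          have : 4 * 2 ^ (1 / (p - 1) + 1) * p * (2 * (C + lam) + 1) ≤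
              4 * 2 ^ (1 / (p - 1) + 1) * p * ((2 * (C + 1) + 1) * (lam + 1)) := by gcongr
          linarith
        rw [levelConst, ← hCd, ← hc]
        linarith

lemma measurableSet_levelSet (hv : Continuous v) (lam : ℝ) :
    MeasurableSet (levelSet p v lam) := by
  have hm : Measurable fun t => |v t| ^ (p / (p - 1)) :=
    (measurable_abs.comp hv.measurable).pow_const _
  exact (measurableSet_le measurable_const (measurable_abs.comp hv.measurable)).inter
    (measurableSet_le measurable_const
      ((measurable_id.add hm).sub (Real.measurable_log.comp hm)))

end EnergyBound

/-- The one-dimensional exponential inequality with exact growth. -/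
theorem exists_exact_growth_bound {p : ℝ} (hp : 1 < p) (A : ℝ) :
    ∃ C : ℝ≥0∞, C ≠ ⊤ ∧ ∀ v E : ℝ → ℝ, EnergyBound p A v E →
      ∫⁻ t in {t | 1 ≤ |v t|},
        ENNReal.ofReal (Real.exp (t + |v t| ^ (p / (p - 1))) / |v t| ^ (p / (p - 1))) ≤ C := by
  have hp1 : 0 < p - 1 := by linarith
  set A' := max A 1
  have hA' : 0 < A' := lt_max_of_lt_right one_pos
  set G := EnergyBound.growthConst p A'
  set D := EnergyBound.levelConst p A'
  have hG : 0 < G := EnergyBound.growthConst_pos p A'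
  have hs : Summable fun n : ℕ => Real.exp (G + 1 - n) * (D * (n + 1)) := by
    have s1 := Real.summable_pow_mul_exp_neg_nat_mul 1 (r := 1) one_pos
    have s0 := Real.summable_pow_mul_exp_neg_nat_mul 0 (r := 1) one_pos
    refine ((s1.add s0).mul_left (D * Real.exp (G + 1))).congr fun n => ?_
    rw [sub_eq_add_neg (G + 1), Real.exp_add (G + 1), neg_one_mul]
    ring
  refine ⟨∑' n : ℕ, ENNReal.ofReal (Real.exp (G + 1 - n) * (D * (n + 1))), ?_, ?_⟩
  · exact hs.tsum_ofReal_ne_top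
  intro v E h
  have h' : EnergyBound p A' v E := ⟨h.cont, h.anti, h.nonneg, h.le_one, h.holder,
    h.mass.trans (ENNReal.ofReal_le_ofReal (le_max_left _ _))⟩
  have hmeas : MeasurableSet {t | 1 ≤ |v t|} :=
    measurableSet_le measurable_const (measurable_abs.comp h.cont.measurable)
  have hptw : ∀ t ∈ {t | 1 ≤ |v t|},
      ENNReal.ofReal (Real.exp (t + |v t| ^ (p / (p - 1))) / |v t| ^ (p / (p - 1))) ≤
      ∑' n : ℕ, (EnergyBound.levelSet p v n).indicator
        (fun _ => ENNReal.ofReal (Real.exp (G + 1 - n))) t := by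
    intro t ht
    have hv : 1 ≤ |v t| := ht
    have hx : 1 ≤ |v t| ^ (p / (p - 1)) := Real.one_le_rpow hv (by positivity)
    have hlev := h'.level_le hp hA' hv
    set y := t + |v t| ^ (p / (p - 1)) - Real.log (|v t| ^ (p / (p - 1))) with hy
    have e : Real.exp (t + |v t| ^ (p / (p - 1))) / |v t| ^ (p / (p - 1)) = Real.exp y := by
      rw [hy, Real.exp_sub, Real.exp_log (by linarith)]
    rw [e]
    have hmem : t ∈ EnergyBound.levelSet p v (⌈-y⌉₊ : ℕ) :=
      ⟨hv, by linarith [Nat.le_ceil (-y)]⟩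
    refine le_trans ?_ (ENNReal.le_tsum ⌈-y⌉₊)
    rw [indicator_of_mem hmem]
    refine ENNReal.ofReal_le_ofReal (Real.exp_le_exp.2 ?_)
    rcases le_or_gt 0 y with h0 | h0
    · rw [Nat.ceil_eq_zero.2 (by linarith)]
      simp only [Nat.cast_zero]
      linarith
    · have := Nat.ceil_lt_add_one (show 0 ≤ -y by linarith)
      linarith
  calc _ ≤ ∫⁻ t in {t | 1 ≤ |v t|}, ∑' n : ℕ, (EnergyBound.levelSet p v n).indicator
        (fun _ => ENNReal.ofReal (Real.exp (G + 1 - n))) t :=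
        setLIntegral_mono_ae' hmeas (Eventually.of_forall hptw)
    _ ≤ ∫⁻ t, ∑' n : ℕ, (EnergyBound.levelSet p v n).indicator
        (fun _ => ENNReal.ofReal (Real.exp (G + 1 - n))) t := setLIntegral_le_lintegral _ _
    _ = ∑' n : ℕ, ∫⁻ t, (EnergyBound.levelSet p v n).indicator
        (fun _ => ENNReal.ofReal (Real.exp (G + 1 - n))) t :=
        lintegral_tsum fun n => (measurable_const.indicator
          (EnergyBound.measurableSet_levelSet h.cont _)).aemeasurable
    _ ≤ _ := by
        refine ENNReal.tsum_le_tsum fun n => ?_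
        rw [lintegral_indicator (EnergyBound.measurableSet_levelSet h.cont _), setLIntegral_const,
          ENNReal.ofReal_mul (Real.exp_pos _).le]
        exact mul_le_mul' le_rfl (h'.volume_levelSet_le hp hA' n.cast_nonneg)

lemma tendsto_dual_of_tendsto_weak {X : Type*} [NormedAddCommGroup X] [NormedSpace ℝ X]
    {u : ℕ → X} {u₀ : X}
    (h : Tendsto (fun n => toWeakSpace ℝ X (u n)) atTop (𝓝 (toWeakSpace ℝ X u₀)))
    (f : StrongDual ℝ X) : Tendsto (fun n => f (u n)) atTop (𝓝 (f u₀)) :=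
  ((WeakBilin.eval_continuous (topDualPairing ℝ X).flip f).tendsto _).comp h

lemma exists_norm_le_of_tendsto_weak {X : Type*} [NormedAddCommGroup X] [NormedSpace ℝ X]
    {u : ℕ → X} {u₀ : X}
    (h : Tendsto (fun n => toWeakSpace ℝ X (u n)) atTop (𝓝 (toWeakSpace ℝ X u₀))) :
    ∃ M : ℝ, ∀ n, ‖u n‖ ≤ M := by
  obtain ⟨M, hM⟩ := banach_steinhaus
    (g := fun n => NormedSpace.inclusionInDoubleDual ℝ X (u n)) fun f => by
      obtain ⟨C, hC⟩ := (tendsto_dual_of_tendsto_weak h f).norm.bddAbove_range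
      exact ⟨C, fun n => hC ⟨n, rfl⟩⟩
  exact ⟨M, fun n => ((NormedSpace.inclusionInDoubleDualLi ℝ).norm_map (u n)).symm.le.trans (hM n)⟩

lemma lintegral_weightMeasure (a : ℝ) (g : ℝ → ℝ≥0∞) :
    ∫⁻ r, g r ∂weightMeasure a = ∫⁻ r in Ioi (0 : ℝ), g r * ENNReal.ofReal (r ^ a) := by
  rw [weightMeasure, lintegral_withDensity_eq_lintegral_mul_non_measurable _
    (measurable_ofReal_rpow a) (Eventually.of_forall fun _ => ENNReal.ofReal_lt_top)]
  exact lintegral_congr fun r => mul_comm _ _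

lemma eLpNorm_weightMeasure_rpow {p : ℝ} (hp : 0 < p) (a : ℝ) (f : ℝ → ℝ) :
    eLpNorm f (ENNReal.ofReal p) (weightMeasure a) ^ p = powInt p a (Ioi 0) f := by
  rw [eLpNorm_eq_lintegral_rpow_enorm_toReal (by simpa using hp) ENNReal.ofReal_ne_top,
    ENNReal.toReal_ofReal hp.le, ← ENNReal.rpow_mul, one_div_mul_cancel hp.ne', ENNReal.rpow_one,
    lintegral_weightMeasure, powInt]

lemma lintegral_holder_rpow {p a b : ℝ} (hp : 1 < p) (β : ℝ) (ha : 0 < a) {f : ℝ → ℝ}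
    (hf : LocallyIntegrableOn f (Ioi 0)) :
    ∫⁻ r in Ioc a b, ‖f r‖ₑ ≤ powInt p β (Ioc a b) f ^ (1 / p) *
      (∫⁻ r in Ioc a b, ENNReal.ofReal (r ^ (-(β / (p - 1))))) ^ ((p - 1) / p) := by
  have hp0 : 0 < p := by linarith
  have hp1 : 0 < p - 1 := by linarith
  have hsub : Ioc a b ⊆ Ioi 0 := fun r hr => ha.trans hr.1
  have hpq : p.HolderConjugate (p / (p - 1)) := Real.HolderConjugate.conjExponent hp
  have hfm : AEMeasurable (fun r => ‖f r‖ₑ) (volume.restrict (Ioc a b)) :=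
    (hf.aestronglyMeasurable.mono_set hsub).enorm
  have e0 : ∫⁻ r in Ioc a b, ‖f r‖ₑ = ∫⁻ r in Ioc a b,
      ((fun r => ‖f r‖ₑ * ENNReal.ofReal (r ^ (β / p))) *
        fun r => ENNReal.ofReal (r ^ (-(β / p)))) r := by
    refine setLIntegral_congr_fun measurableSet_Ioc fun r hr => ?_
    have hr0 : 0 < r := hsub hr
    simp only [Pi.mul_apply]
    rw [mul_assoc, ← ENNReal.ofReal_mul (by positivity), ← Real.rpow_add hr0]
    simp
  rw [e0]
  refine (ENNReal.lintegral_mul_le_Lp_mul_Lq _ hpq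
    (hfm.mul (measurable_ofReal_rpow _).aemeasurable)
    (measurable_ofReal_rpow _).aemeasurable).trans (le_of_eq ?_)
  have e3 : 1 / (p / (p - 1)) = (p - 1) / p := by field_simp
  rw [e3]
  congr 2
  · refine setLIntegral_congr_fun measurableSet_Ioc fun r hr => ?_
    have hr0 : 0 < r := hsub hr
    rw [Pi.mul_apply, ENNReal.mul_rpow_of_nonneg _ _ hp0.le,
      ENNReal.ofReal_rpow_of_pos (by positivity), ← Real.rpow_mul hr0.le, div_mul_cancel₀ _ hp0.ne']
  · refine setLIntegral_congr_fun measurableSet_Ioc fun r hr => ?_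
    have hr0 : 0 < r := hsub hr
    rw [ENNReal.ofReal_rpow_of_pos (by positivity), ← Real.rpow_mul hr0.le]
    congr 2
    field_simp

lemma lintegral_Ioc_rpow_lt_top {a b : ℝ} (ha : 0 < a) (c : ℝ) :
    ∫⁻ r in Ioc a b, ENNReal.ofReal (r ^ c) < ⊤ := by
  have h : IntegrableOn (fun r : ℝ => r ^ c) (Ioc a b) := by
    refine (ContinuousOn.integrableOn_Icc ?_).mono_set Ioc_subset_Icc_self
    exact (continuousOn_rpow_Ioi c).mono fun r hr => ha.trans_le hr.1
  exact h.lintegral_lt_top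

section Jet

variable {k : ℕ} {p : ℝ} [Fact (1 ≤ p)] {α : Fin (k + 1) → ℝ}

/-- The weak derivatives of an element of `X^{k,p}_∞`, indexed by natural numbers. -/
noncomputable def jetFn (u : sobolevX k p α) (j : ℕ) : ℝ → ℝ :=
  if h : j < k + 1 then ((u : JetSpace k p α) ⟨j, h⟩ : ℝ → ℝ) else 0

lemma jetFn_of_lt (u : sobolevX k p α) {j : ℕ} (h : j < k + 1) :
    jetFn u j = ((u : JetSpace k p α) ⟨j, h⟩ : ℝ → ℝ) := dif_pos h

lemma jetFn_zero (u : sobolevX k p α) : jetFn u 0 = sobolevFn u := jetFn_of_lt u (by omega)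

lemma hasWeakDeriv_jetFn_zero (u : sobolevX k p α) {j : ℕ} (h : j ≤ k) :
    HasWeakDeriv j (jetFn u 0) (jetFn u j) := by
  rw [jetFn_zero, jetFn_of_lt u (Nat.lt_succ_of_le h)]
  exact u.2 ⟨j, Nat.lt_succ_of_le h⟩

lemma hasWeakDeriv_jetFn (u : sobolevX k p α) {j : ℕ} (h : j < k) :
    HasWeakDeriv 1 (jetFn u j) (jetFn u (j + 1)) :=
  (hasWeakDeriv_jetFn_zero u h.le).of_succ (hasWeakDeriv_jetFn_zero u h)

lemma powInt_jetFn_le (u : sobolevX k p α) (hp : 0 < p) {j : ℕ} (h : j < k + 1) :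
    powInt p (α ⟨j, h⟩) (Ioi 0) (jetFn u j) ≤ ‖u‖ₑ ^ p := by
  rw [← eLpNorm_weightMeasure_rpow hp, jetFn_of_lt u h, ← Lp.enorm_def]
  gcongr
  exact PiLp.enorm_apply_le (u : JetSpace k p α) _

/-- Integration of a weak derivative over an interval, as a continuous functional. -/
lemma exists_dual_integral_jetFn (hp : 1 < p) {j : ℕ} (h : j ≤ k) {a b : ℝ} (ha : 0 < a)
    (hab : a ≤ b) :
    ∃ T : StrongDual ℝ (sobolevX k p α), ∀ u, T u = ∫ r in a..b, jetFn u j r := by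
  have hlt := Nat.lt_succ_of_le h
  have hp0 : 0 < p := by linarith
  have hsub : Ioc a b ⊆ Ioi 0 := fun r hr => ha.trans hr.1
  have hint : ∀ u : sobolevX k p α, IntervalIntegrable (jetFn u j) volume a b := fun u =>
    intervalIntegrable_of_locallyIntegrableOn (hasWeakDeriv_jetFn_zero u h).2.1 ha
      (ha.trans_le hab)
  have hcongr : ∀ {f g : ℝ → ℝ}, f =ᵐ[weightMeasure (α ⟨j, hlt⟩)] g →
      ∫ r in a..b, f r = ∫ r in a..b, g r := fun {f g} hfg => by
    rw [intervalIntegral.integral_of_le hab, intervalIntegral.integral_of_le hab]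
    exact integral_congr_ae (ae_restrict_of_ae_restrict_of_subset hsub
      (ae_eq_of_weightMeasure hfg).symm)
  let T₀ : sobolevX k p α →ₗ[ℝ] ℝ :=
    { toFun := fun u => ∫ r in a..b, jetFn u j r
      map_add' := fun u v => by
        rw [← intervalIntegral.integral_add (hint u) (hint v), jetFn_of_lt _ hlt, jetFn_of_lt _ hlt,
          jetFn_of_lt _ hlt]
        exact hcongr (Lp.coeFn_add ((u : JetSpace k p α) ⟨j, hlt⟩) ((v : JetSpace k p α) ⟨j, hlt⟩))
      map_smul' := fun c u => by
        rw [RingHom.id_apply, smul_eq_mul, ← intervalIntegral.integral_const_mul,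
          jetFn_of_lt _ hlt, jetFn_of_lt _ hlt]
        exact hcongr (Lp.coeFn_smul c ((u : JetSpace k p α) ⟨j, hlt⟩)) }
  set D := (∫⁻ r in Ioc a b, ENNReal.ofReal (r ^ (-(α ⟨j, hlt⟩ / (p - 1))))) ^ ((p - 1) / p) with hD
  have hDtop : D ≠ ⊤ := by
    have hp1 : 0 ≤ (p - 1) / p := div_nonneg (by linarith) hp0.le
    exact ENNReal.rpow_ne_top_of_nonneg hp1 (lintegral_Ioc_rpow_lt_top ha _).ne
  refine ⟨T₀.mkContinuous D.toReal fun u => ?_, fun u => rfl⟩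
  have h1 : ‖T₀ u‖ₑ ≤ D * ‖u‖ₑ := by
    calc ‖T₀ u‖ₑ ≤ ∫⁻ r in Ioc a b, ‖jetFn u j r‖ₑ := by
          simp only [T₀, LinearMap.coe_mk, AddHom.coe_mk, intervalIntegral.integral_of_le hab]
          exact enorm_integral_le_lintegral_enorm _
      _ ≤ _ := lintegral_holder_rpow hp (α ⟨j, hlt⟩) ha (hasWeakDeriv_jetFn_zero u h).2.1
      _ ≤ ‖u‖ₑ * D := by
          gcongr
          calc _ ≤ (‖u‖ₑ ^ p) ^ (1 / p) := by
                gcongr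
                exact (powInt_mono_set hsub _).trans (powInt_jetFn_le u hp0 hlt)
            _ = ‖u‖ₑ := by rw [← ENNReal.rpow_mul, mul_one_div_cancel hp0.ne', ENNReal.rpow_one]
      _ = _ := mul_comm _ _
  have h2 := ENNReal.toReal_mono (ENNReal.mul_ne_top hDtop (by simp)) h1
  simpa [ENNReal.toReal_mul] using h2

lemma tendsto_integral_jetFn (hp : 1 < p) {u : ℕ → sobolevX k p α} {u₀ : sobolevX k p α}
    (h : Tendsto (fun n => toWeakSpace ℝ (sobolevX k p α) (u n)) atTop
      (𝓝 (toWeakSpace ℝ (sobolevX k p α) u₀))) {j : ℕ} (hj : j ≤ k) {a b : ℝ} (ha : 0 < a)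
    (hab : a ≤ b) :
    Tendsto (fun n => ∫ r in a..b, jetFn (u n) j r) atTop (𝓝 (∫ r in a..b, jetFn u₀ j r)) := by
  obtain ⟨T, hT⟩ := exists_dual_integral_jetFn (α := α) hp hj ha hab
  simp_rw [← hT]
  exact tendsto_dual_of_tendsto_weak h T

lemma tendsto_repr (hp : 1 < p) (hk : 1 ≤ k) {u : ℕ → sobolevX k p α} {u₀ : sobolevX k p α}
    (h : Tendsto (fun n => toWeakSpace ℝ (sobolevX k p α) (u n)) atTop
      (𝓝 (toWeakSpace ℝ (sobolevX k p α) u₀))) {W : ℕ → ℝ → ℝ} {W₀ : ℝ → ℝ}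
    (hW : ∀ n, jetFn (u n) 0 =ᵐ[volume.restrict (Ioi 0)] W n)
    (hW₀ : jetFn u₀ 0 =ᵐ[volume.restrict (Ioi 0)] W₀)
    (hWc : ∀ n, ContinuousOn (W n) (Ioi 0)) (hWc₀ : ContinuousOn W₀ (Ioi 0))
    (hWd : ∀ n a b, 0 < a → 0 < b → W n b - W n a = ∫ s in a..b, jetFn (u n) 1 s)
    (hWd₀ : ∀ a b, 0 < a → 0 < b → W₀ b - W₀ a = ∫ s in a..b, jetFn u₀ 1 s)
    {r : ℝ} (hr : 0 < r) : Tendsto (fun n => W n r) atTop (𝓝 (W₀ r)) := by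
  have hp0 : 0 < p := by linarith
  have hlt : 1 < k + 1 := by omega
  obtain ⟨M, hM⟩ := exists_norm_le_of_tendsto_weak h
  have hsub : Ioc r (r + 1) ⊆ Ioi 0 := fun s hs => hr.trans hs.1
  have hci : ∀ V : ℝ → ℝ, ContinuousOn V (Ioi 0) → IntervalIntegrable V volume r (r + 1) :=
    fun V hV => (hV.mono fun s hs => by
      rw [uIcc_of_le (by linarith)] at hs
      exact hr.trans_le hs.1).intervalIntegrable
  have hcongr : ∀ {f g : ℝ → ℝ}, f =ᵐ[volume.restrict (Ioi 0)] g →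
      ∫ s in r..(r + 1), f s = ∫ s in r..(r + 1), g s := fun {f g} hfg => by
    rw [intervalIntegral.integral_of_le (by linarith),
      intervalIntegral.integral_of_le (by linarith)]
    exact integral_congr_ae (ae_restrict_of_ae_restrict_of_subset hsub hfg)
  have hsplit : ∀ V : ℝ → ℝ, ContinuousOn V (Ioi 0) →
      V r = (∫ s in r..(r + 1), V s) - ∫ s in r..(r + 1), (V s - V r) := fun V hV => by
    rw [intervalIntegral.integral_sub (hci V hV) (by simp)]
    simp
  have l1 : Tendsto (fun n => ∫ s in r..(r + 1), W n s) atTop (𝓝 (∫ s in r..(r + 1), W₀ s)) := by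
    rw [← hcongr hW₀]
    simp_rw [fun n => (hcongr (hW n)).symm]
    exact tendsto_integral_jetFn hp h (Nat.zero_le k) hr (by linarith)
  set D := (∫⁻ s in Ioc r (r + 1), ENNReal.ofReal (s ^ (-(α ⟨1, hlt⟩ / (p - 1))))) ^ ((p - 1) / p)
    with hD
  have hDtop : D ≠ ⊤ := ENNReal.rpow_ne_top_of_nonneg (div_nonneg (by linarith) hp0.le)
    (lintegral_Ioc_rpow_lt_top hr _).ne
  have hbd : ∀ n, ∀ s ∈ Ioc r (r + 1), ‖W n s - W n r‖ ≤ (ENNReal.ofReal M * D).toReal := by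
    intro n s hs
    have h1 : ‖W n s - W n r‖ₑ ≤ ENNReal.ofReal M * D := by
      calc _ ≤ ∫⁻ x in Ioo r s, ‖jetFn (u n) 1 x‖ₑ := enorm_sub_le_lintegral (hWd n) hr hs.1.le
        _ ≤ ∫⁻ x in Ioc r (r + 1), ‖jetFn (u n) 1 x‖ₑ :=
            lintegral_mono_set fun x hx => ⟨hx.1, hx.2.le.trans hs.2⟩
        _ ≤ _ := lintegral_holder_rpow hp (α ⟨1, hlt⟩) hr (hasWeakDeriv_jetFn_zero (u n) hk).2.1
        _ ≤ _ := by
            gcongr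
            calc _ ≤ (‖u n‖ₑ ^ p) ^ (1 / p) := by
                  gcongr
                  exact (powInt_mono_set hsub _).trans (powInt_jetFn_le (u n) hp0 hlt)
              _ = ‖u n‖ₑ := by
                  rw [← ENNReal.rpow_mul, mul_one_div_cancel hp0.ne', ENNReal.rpow_one]
              _ ≤ _ := by
                  rw [← ofReal_norm]
                  exact ENNReal.ofReal_le_ofReal (hM n)
    have := ENNReal.toReal_mono (ENNReal.mul_ne_top ENNReal.ofReal_ne_top hDtop) h1
    simpa using this
  have l2 : Tendsto (fun n => ∫ s in r..(r + 1), (W n s - W n r)) atTop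
      (𝓝 (∫ s in r..(r + 1), (W₀ s - W₀ r))) := by
    refine intervalIntegral.tendsto_integral_filter_of_dominated_convergence
      (fun _ => (ENNReal.ofReal M * D).toReal) (Eventually.of_forall fun n => ?_)
      (Eventually.of_forall fun n => Eventually.of_forall fun s hs => ?_) (by simp)
      (Eventually.of_forall fun s hs => ?_)
    · rw [uIoc_of_le (by linarith)]
      exact (hci _ (hWc n)).aestronglyMeasurable.sub aestronglyMeasurable_const
    · rw [uIoc_of_le (by linarith)] at hs
      exact hbd n s hs
    · rw [uIoc_of_le (by linarith)] at hs
      have hs0 : 0 < s := hr.trans hs.1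
      rw [hWd₀ r s hr hs0]
      simp only [fun n => hWd n r s hr hs0]
      exact tendsto_integral_jetFn hp h hk hr hs.1.le
  rw [hsplit W₀ hWc₀]
  exact (l1.sub l2).congr fun n => (hsplit (W n) (hWc n)).symm

end Jet

/-- `W` is locally absolutely continuous on `(0, ∞)` with derivative `g`, and
`∫ |g| ^ p r ^ (p - 1) dr ≤ C ^ (-p)`. -/
structure BoundedEnergy (p C : ℝ) (W g : ℝ → ℝ) : Prop where
  cont : ContinuousOn W (Ioi 0)
  repr : ∀ a b, 0 < a → 0 < b → W b - W a = ∫ s in a..b, g s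
  loc : LocallyIntegrableOn g (Ioi 0)
  energy : powInt p (p - 1) (Ioi 0) g ≤ ENNReal.ofReal (C ^ (-p))

lemma lintegral_Ioc_inv {a b : ℝ} (ha : 0 < a) (hab : a ≤ b) :
    ∫⁻ r in Ioc a b, ENNReal.ofReal (r ^ (-1 : ℝ)) = ENNReal.ofReal (Real.log (b / a)) := by
  simp_rw [Real.rpow_neg_one]
  rw [← ofReal_integral_eq_lintegral_ofReal, ← intervalIntegral.integral_of_le hab,
    integral_inv_of_pos ha (ha.trans_le hab)]
  · have hc : ContinuousOn (fun r : ℝ => r⁻¹) (Icc a b) :=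
      continuousOn_inv₀.mono fun r hr => (ha.trans_le hr.1).ne'
    exact hc.integrableOn_Icc.mono_set Ioc_subset_Icc_self
  · filter_upwards [ae_restrict_mem measurableSet_Ioc] with r hr
    have : 0 < r := ha.trans hr.1
    simp only [Pi.zero_apply]
    positivity

/-- The substitution `r = e ^ (t / N)`. -/
lemma lintegral_Ioi_eq_lintegral_exp {N : ℝ} (hN : 0 < N) (f : ℝ → ℝ≥0∞) :
    ∫⁻ r in Ioi (0 : ℝ), f r * ENNReal.ofReal (r ^ (N - 1)) =
      ENNReal.ofReal N⁻¹ * ∫⁻ t, f (Real.exp (t / N)) * ENNReal.ofReal (Real.exp t) := by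
  have himg : (fun t : ℝ => Real.exp (t / N)) '' univ = Ioi 0 := by
    ext r
    simp only [image_univ, mem_range, mem_Ioi]
    refine ⟨fun ⟨t, ht⟩ => ht ▸ Real.exp_pos _, fun hr => ⟨N * Real.log r, ?_⟩⟩
    rw [mul_div_cancel_left₀ _ hN.ne', Real.exp_log hr]
  have hinj : InjOn (fun t : ℝ => Real.exp (t / N)) univ := by
    intro x _ y _ hxy
    have := Real.exp_injective hxy
    field_simp at this
    exact this
  have hd : ∀ t ∈ (univ : Set ℝ), HasDerivWithinAt (fun t : ℝ => Real.exp (t / N))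
      (Real.exp (t / N) * (1 / N)) univ t := fun t _ =>
    ((hasDerivAt_id t).div_const N).exp.hasDerivWithinAt
  rw [← himg, lintegral_image_eq_lintegral_abs_deriv_mul MeasurableSet.univ hd hinj,
    Measure.restrict_univ, ← lintegral_const_mul' _ _ ENNReal.ofReal_ne_top]
  refine lintegral_congr fun t => ?_
  rw [abs_of_pos (by positivity), ← Real.exp_mul, mul_left_comm,
    ← ENNReal.ofReal_mul (by positivity), mul_left_comm (ENNReal.ofReal N⁻¹),
    ← ENNReal.ofReal_mul (by positivity)]
  congr 2
  rw [mul_right_comm, ← Real.exp_add, one_div, mul_comm N⁻¹]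
  congr 2
  field_simp
  ring

lemma powInt_union {p b : ℝ} {S T : Set ℝ} (hT : MeasurableSet T) (hST : Disjoint S T)
    (w : ℝ → ℝ) : powInt p b (S ∪ T) w = powInt p b S w + powInt p b T w :=
  lintegral_union hT hST

namespace BoundedEnergy

variable {p C : ℝ} {W g : ℝ → ℝ}

lemma enorm_sub_le (h : BoundedEnergy p C W g) (hp : 1 < p) {a b : ℝ} (ha : 0 < a) (hab : a ≤ b) :
    ‖W b - W a‖ₑ ≤ powInt p (p - 1) (Ioc a b) g ^ (1 / p) *
      ENNReal.ofReal (Real.log (b / a)) ^ ((p - 1) / p) := by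
  have hp1 : p - 1 ≠ 0 := by linarith
  have h1 := lintegral_holder_rpow (b := b) hp (p - 1) ha h.loc
  rw [div_self hp1, lintegral_Ioc_inv ha hab] at h1
  refine (enorm_sub_le_lintegral h.repr ha hab).trans (le_trans ?_ h1)
  exact lintegral_mono_set Ioo_subset_Ioc_self

lemma abs_sub_le (h : BoundedEnergy p C W g) (hp : 1 < p) (hC : 0 < C) {a b : ℝ} (ha : 0 < a)
    (hab : a ≤ b) : |W b - W a| ≤ C⁻¹ * Real.log (b / a) ^ ((p - 1) / p) := by
  have hp0 : 0 < p := by linarith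
  have hlog : 0 ≤ Real.log (b / a) := Real.log_nonneg (by rwa [le_div_iff₀ ha, one_mul])
  have hq : 0 ≤ (p - 1) / p := div_nonneg (by linarith) hp0.le
  have h1 : ‖W b - W a‖ₑ ≤ ENNReal.ofReal (C⁻¹ * Real.log (b / a) ^ ((p - 1) / p)) := by
    refine (h.enorm_sub_le hp ha hab).trans ?_
    rw [ENNReal.ofReal_mul (by positivity), ENNReal.ofReal_rpow_of_nonneg hlog hq]
    gcongr
    calc _ ≤ (ENNReal.ofReal (C ^ (-p))) ^ (1 / p) := by
          gcongr
          exact (powInt_mono_set (fun r hr => ha.trans hr.1) _).trans h.energy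
      _ = ENNReal.ofReal C⁻¹ := by
          rw [ENNReal.ofReal_rpow_of_pos (by positivity), ← Real.rpow_mul hC.le, neg_mul,
            mul_one_div_cancel hp0.ne', Real.rpow_neg_one]
  rw [Real.enorm_eq_ofReal_abs] at h1
  exact (ENNReal.ofReal_le_ofReal_iff (by positivity)).1 h1

lemma continuous_comp_exp (h : BoundedEnergy p C W g) (κ N : ℝ) :
    Continuous fun t => κ * W (Real.exp (t / N)) := by
  have hc : Continuous fun t : ℝ => Real.exp (t / N) := by fun_prop
  refine continuous_const.mul (continuous_iff_continuousAt.2 fun t => ?_)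
  exact ContinuousAt.comp (f := fun t => Real.exp (t / N))
    (h.cont.continuousAt (Ioi_mem_nhds (Real.exp_pos _))) hc.continuousAt

lemma energyBound (h : BoundedEnergy p C W g) (hp : 1 < p) (hC : 0 < C) {N A : ℝ} (hN : 0 < N)
    (hA : powInt p (N - 1) (Ioi 0) W ≤ ENNReal.ofReal A) :
    EnergyBound p ((N ^ ((p - 1) / p) * C) ^ p * N * A)
      (fun t => N ^ ((p - 1) / p) * C * W (Real.exp (t / N)))
      (fun t => C ^ p * (powInt p (p - 1) (Ioi (Real.exp (t / N))) g).toReal) := by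
  have hp0 : 0 < p := by linarith
  have hq : 0 ≤ (p - 1) / p := div_nonneg (by linarith) hp0.le
  have hle : ∀ t, powInt p (p - 1) (Ioi (Real.exp (t / N))) g ≤ ENNReal.ofReal (C ^ (-p)) :=
    fun t => (powInt_mono_set (Ioi_subset_Ioi (Real.exp_pos _).le) _).trans h.energy
  have hne : ∀ t, powInt p (p - 1) (Ioi (Real.exp (t / N))) g ≠ ⊤ := fun t =>
    ((hle t).trans_lt ENNReal.ofReal_lt_top).ne
  set κ := N ^ ((p - 1) / p) * C with hκ
  have hκ0 : 0 < κ := by positivity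
  have hexp : ∀ {s t : ℝ}, s ≤ t → Real.exp (s / N) ≤ Real.exp (t / N) := fun hst =>
    Real.exp_le_exp.2 (by gcongr)
  refine ⟨h.continuous_comp_exp κ N, fun s t hst => ?_, fun t => by positivity, fun t => ?_,
    fun s t hst => ?_, ?_⟩
  · have := ENNReal.toReal_mono (hne s) (powInt_mono_set (p := p) (b := p - 1)
      (Ioi_subset_Ioi (hexp hst)) g)
    gcongr
  · have := ENNReal.toReal_mono ENNReal.ofReal_ne_top (hle t)
    rw [ENNReal.toReal_ofReal (by positivity)] at this
    calc _ ≤ C ^ p * C ^ (-p) := by gcongr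
      _ = 1 := by rw [← Real.rpow_add hC]; simp
  · have hs : powInt p (p - 1) (Ioi (Real.exp (s / N))) g =
        powInt p (p - 1) (Ioc (Real.exp (s / N)) (Real.exp (t / N))) g +
        powInt p (p - 1) (Ioi (Real.exp (t / N))) g := by
      rw [← powInt_union measurableSet_Ioi, Ioc_union_Ioi_eq_Ioi (hexp hst)]
      exact disjoint_left.2 fun r h1 h2 => absurd h1.2 (not_le.2 h2)
    have hI : powInt p (p - 1) (Ioc (Real.exp (s / N)) (Real.exp (t / N))) g ≠ ⊤ :=
      ne_top_of_le_ne_top (hne s) (powInt_mono_set Ioc_subset_Ioi_self _)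
    set I := powInt p (p - 1) (Ioc (Real.exp (s / N)) (Real.exp (t / N))) g
    have h1 := h.enorm_sub_le hp (Real.exp_pos (s / N)) (hexp hst)
    have hlog : Real.log (Real.exp (t / N) / Real.exp (s / N)) = (t - s) / N := by
      rw [← Real.exp_sub, Real.log_exp]; ring
    have hts : 0 ≤ t - s := by linarith
    rw [hlog, Real.enorm_eq_ofReal_abs] at h1
    have h2 := ENNReal.toReal_mono (ENNReal.mul_ne_top
      (ENNReal.rpow_ne_top_of_nonneg (by positivity) hI)
      (ENNReal.rpow_ne_top_of_nonneg hq ENNReal.ofReal_ne_top)) h1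
    rw [ENNReal.toReal_mul, ← ENNReal.toReal_rpow, ← ENNReal.toReal_rpow,
      ENNReal.toReal_ofReal (abs_nonneg _), ENNReal.toReal_ofReal (by positivity)] at h2
    rw [hs, ENNReal.toReal_add hI (hne t), mul_add, add_sub_cancel_right, ← mul_sub, abs_mul,
      abs_of_pos hκ0, abs_sub_comm, Real.mul_rpow (by positivity) ENNReal.toReal_nonneg,
      ← Real.rpow_mul hC.le, mul_one_div_cancel hp0.ne', Real.rpow_one]
    calc _ ≤ κ * (I.toReal ^ (1 / p) * ((t - s) / N) ^ ((p - 1) / p)) := by gcongr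
      _ = _ := by
        rw [Real.div_rpow hts hN.le, hκ]
        field_simp
  · have hcv := lintegral_Ioi_eq_lintegral_exp hN fun r => ‖κ * W r‖ₑ ^ p
    have e : ∫⁻ r in Ioi (0 : ℝ), ‖κ * W r‖ₑ ^ p * ENNReal.ofReal (r ^ (N - 1)) =
        ENNReal.ofReal (κ ^ p) * powInt p (N - 1) (Ioi 0) W := by
      have := powInt_smul (b := N - 1) hp0 κ (Ioi 0) W
      rw [Real.enorm_of_nonneg hκ0.le, ENNReal.ofReal_rpow_of_pos hκ0] at this
      exact this
    rw [e] at hcv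
    have h1 : ∫⁻ t, ‖κ * W (Real.exp (t / N))‖ₑ ^ p * ENNReal.ofReal (Real.exp t) =
        ENNReal.ofReal N * (ENNReal.ofReal (κ ^ p) * powInt p (N - 1) (Ioi 0) W) := by
      rw [hcv, ← mul_assoc, ← ENNReal.ofReal_mul hN.le, mul_inv_cancel₀ hN.ne', ENNReal.ofReal_one,
        one_mul]
    rw [h1]
    calc _ ≤ ENNReal.ofReal N * (ENNReal.ofReal (κ ^ p) * ENNReal.ofReal A) := by gcongr
      _ = _ := by
        rw [← ENNReal.ofReal_mul (by positivity), ← ENNReal.ofReal_mul hN.le]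
        congr 1
        ring

end BoundedEnergy

/-- The exponential inequality with exact growth on the half-line. -/
lemma exists_exp_bound {p C N : ℝ} (hp : 1 < p) (hC : 0 < C) (hN : 0 < N) (A : ℝ) :
    ∃ K : ℝ≥0∞, K ≠ ⊤ ∧ ∀ W g, BoundedEnergy p C W g →
      powInt p (N - 1) (Ioi 0) W ≤ ENNReal.ofReal A →
      ∫⁻ r in Ioi (0 : ℝ), {r | 1 ≤ N ^ ((p - 1) / p) * C * |W r|}.indicator (fun r =>
        ENNReal.ofReal (Real.exp (N * C ^ (p / (p - 1)) * |W r| ^ (p / (p - 1))) /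
          (N * C ^ (p / (p - 1)) * |W r| ^ (p / (p - 1))))) r *
        ENNReal.ofReal (r ^ (N - 1)) ≤ K := by
  have hp0 : 0 < p := by linarith
  have hp1 : 0 < p - 1 := by linarith
  obtain ⟨K, hK, hb⟩ := exists_exact_growth_bound hp ((N ^ ((p - 1) / p) * C) ^ p * N * A)
  refine ⟨ENNReal.ofReal N⁻¹ * K, ENNReal.mul_ne_top ENNReal.ofReal_ne_top hK, fun W g h hA => ?_⟩
  have hE := hb _ _ (h.energyBound hp hC hN hA)
  rw [lintegral_Ioi_eq_lintegral_exp hN]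
  refine mul_le_mul' le_rfl (le_trans (le_of_eq ?_) hE)
  set κ := N ^ ((p - 1) / p) * C with hκ
  have hκ0 : 0 < κ := by positivity
  have hcont := h.continuous_comp_exp κ N
  have hmeas : MeasurableSet {t | 1 ≤ |κ * W (Real.exp (t / N))|} :=
    measurableSet_le measurable_const (measurable_abs.comp hcont.measurable)
  rw [← lintegral_indicator hmeas]
  refine lintegral_congr fun t => ?_
  have habs : |κ * W (Real.exp (t / N))| = κ * |W (Real.exp (t / N))| := by
    rw [abs_mul, abs_of_pos hκ0]
  have hpow : |κ * W (Real.exp (t / N))| ^ (p / (p - 1)) =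
      N * C ^ (p / (p - 1)) * |W (Real.exp (t / N))| ^ (p / (p - 1)) := by
    rw [habs, Real.mul_rpow hκ0.le (abs_nonneg _), hκ, Real.mul_rpow (by positivity) hC.le,
      ← Real.rpow_mul hN.le, show (p - 1) / p * (p / (p - 1)) = 1 by field_simp, Real.rpow_one]
  by_cases ht : 1 ≤ κ * |W (Real.exp (t / N))|
  · have ht' : 1 ≤ |κ * W (Real.exp (t / N))| := by rwa [habs]
    rw [indicator_of_mem (s := {r | 1 ≤ κ * |W r|}) ht,
      indicator_of_mem (s := {t | 1 ≤ |κ * W (Real.exp (t / N))|}) ht', hpow, Real.exp_add,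
      ← ENNReal.ofReal_mul (by positivity)]
    congr 1
    ring
  · have ht' : ¬ 1 ≤ |κ * W (Real.exp (t / N))| := by rwa [habs]
    rw [indicator_of_notMem (s := {r | 1 ≤ κ * |W r|}) ht,
      indicator_of_notMem (s := {t | 1 ≤ |κ * W (Real.exp (t / N))|}) ht', zero_mul]

/-- Uniform decay at infinity. -/
lemma exists_uniform_decay {p C a : ℝ} (hp : 1 < p) (hC : 0 < C) (ha : -1 < a) {M : ℝ}
    (hM : 0 ≤ M) {ε : ℝ} (hε : 0 < ε) :
    ∃ R : ℝ, 1 ≤ R ∧ ∀ W g, BoundedEnergy p C W g → powInt p a (Ioi 1) W ≤ ENNReal.ofReal M →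
      ∀ r, R ≤ r → |W r| < ε := by
  have hp0 : 0 < p := by linarith
  have hq : 0 < (p - 1) / p := div_pos (by linarith) hp0
  have ha1 : 0 < a + 1 := by linarith
  obtain ⟨δ, hδ, hδε⟩ : ∃ δ : ℝ, 0 < δ ∧ C⁻¹ * δ ^ ((p - 1) / p) ≤ ε / 2 := by
    refine ⟨(C * (ε / 2)) ^ (p / (p - 1)), by positivity, ?_⟩
    have hp1 : p - 1 ≠ 0 := by linarith
    rw [← Real.rpow_mul (by positivity), show p / (p - 1) * ((p - 1) / p) = 1 by field_simp,
      Real.rpow_one, inv_mul_cancel_left₀ hC.ne']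
  set c := (ε / 2) ^ p * δ with hc
  have hc0 : 0 < c := by positivity
  refine ⟨max 1 ((M / c + 1) ^ (1 / (a + 1))), le_max_left _ _, fun W g h hW r hr => ?_⟩
  by_contra! hlt
  have hr1 : 1 ≤ r := (le_max_left _ _).trans hr
  have hr0 : 0 < r := by linarith
  have hrb : r ≤ r * Real.exp δ := by nlinarith [Real.one_le_exp hδ.le]
  have hlow : ∀ s ∈ Ioc r (r * Real.exp δ),
      ENNReal.ofReal ((ε / 2) ^ p * r ^ (a + 1)) * ENNReal.ofReal (s ^ (-1 : ℝ)) ≤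
        ‖W s‖ₑ ^ p * ENNReal.ofReal (s ^ a) := by
    intro s hs
    have hs0 : 0 < s := hr0.trans hs.1
    have h1 := h.abs_sub_le hp hC hr0 hs.1.le
    have hl0 : 0 ≤ Real.log (s / r) := Real.log_nonneg (by rw [le_div_iff₀ hr0]; linarith [hs.1])
    have hl : Real.log (s / r) ≤ δ := by
      rw [Real.log_le_iff_le_exp (by positivity), div_le_iff₀ hr0]
      linarith [hs.2]
    have h2 : C⁻¹ * Real.log (s / r) ^ ((p - 1) / p) ≤ ε / 2 :=
      le_trans (by gcongr) hδε
    have h3 : ε / 2 ≤ |W s| := by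
      have := abs_sub_abs_le_abs_sub (W r) (W s)
      rw [abs_sub_comm] at this
      linarith
    rw [ENNReal.ofReal_mul (by positivity), mul_assoc, ← ENNReal.ofReal_mul (by positivity),
      ← ENNReal.ofReal_rpow_of_pos (by positivity), Real.enorm_eq_ofReal_abs]
    gcongr
    calc r ^ (a + 1) * s ^ (-1 : ℝ) ≤ s ^ (a + 1) * s ^ (-1 : ℝ) := by
          gcongr
          exact hs.1.le
      _ = s ^ a := by rw [← Real.rpow_add hs0]; congr 1; ring
  have h4 : ENNReal.ofReal ((ε / 2) ^ p * r ^ (a + 1)) * ENNReal.ofReal δ ≤ ENNReal.ofReal M := by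
    calc _ = ∫⁻ s in Ioc r (r * Real.exp δ),
          ENNReal.ofReal ((ε / 2) ^ p * r ^ (a + 1)) * ENNReal.ofReal (s ^ (-1 : ℝ)) := by
          rw [lintegral_const_mul' _ _ ENNReal.ofReal_ne_top, lintegral_Ioc_inv hr0 hrb,
            mul_div_cancel_left₀ _ hr0.ne', Real.log_exp]
      _ ≤ powInt p a (Ioc r (r * Real.exp δ)) W :=
          setLIntegral_mono_ae' measurableSet_Ioc (Eventually.of_forall hlow)
      _ ≤ _ := (powInt_mono_set (fun s hs => lt_of_le_of_lt hr1 hs.1) _).trans hW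
  rw [← ENNReal.ofReal_mul (by positivity), ENNReal.ofReal_le_ofReal_iff hM] at h4
  have h5 : M / c + 1 ≤ r ^ (a + 1) := by
    calc M / c + 1 = ((M / c + 1) ^ (1 / (a + 1))) ^ (a + 1) := by
          rw [← Real.rpow_mul (by positivity), one_div_mul_cancel ha1.ne', Real.rpow_one]
      _ ≤ _ := by
          gcongr
          exact (le_max_right _ _).trans hr
  have h6 : r ^ (a + 1) ≤ M / c := by
    rw [le_div_iff₀ hc0, hc]
    linarith
  linarith

/-- Control of the weighted norm near zero by the energy. -/
lemma exists_mass_bound {p C a N : ℝ} (hp : 1 < p) (hC : 0 < C) (ha : -1 < a) (hN : 0 < N)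
    {M : ℝ} (hM : 0 ≤ M) {M' : ℝ≥0∞} (hM' : M' ≠ ⊤) :
    ∃ A : ℝ, ∀ W g, BoundedEnergy p C W g → powInt p a (Ioi 1) W ≤ ENNReal.ofReal M →
      powInt p (N - 1) (Ioi 1) W ≤ M' → powInt p (N - 1) (Ioi 0) W ≤ ENNReal.ofReal A := by
  have hp0 : 0 < p := by linarith
  have hq : 0 ≤ (p - 1) / p := div_nonneg (by linarith) hp0.le
  have hq1 : (p - 1) / p ≤ 1 := by rw [div_le_one hp0]; linarith
  obtain ⟨R, hR, hdec⟩ := exists_uniform_decay hp hC ha hM one_pos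
  have hR0 : 0 < R := by linarith
  set s := N / (2 * p) with hs
  have hs0 : 0 < s := by positivity
  set K := 1 + C⁻¹ * (1 + 1 / s) with hK
  have hK0 : 0 < K := by positivity
  set B := ∫⁻ r in Ioo 0 (2 * R),
    ENNReal.ofReal ((K * R ^ s) ^ p) * ENNReal.ofReal (r ^ (N / 2 - 1)) with hB
  have hBtop : B ≠ ⊤ := by
    rw [hB, lintegral_const_mul' _ _ ENNReal.ofReal_ne_top,
      lintegral_Ioo_rpow (by positivity) (by positivity)]
    exact ENNReal.mul_ne_top ENNReal.ofReal_ne_top ENNReal.ofReal_ne_top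
  refine ⟨(B + M').toReal, fun W g h h1 h2 => ?_⟩
  rw [ENNReal.ofReal_toReal (ENNReal.add_ne_top.2 ⟨hBtop, hM'⟩)]
  have hsplit : Ioi (0 : ℝ) = Ioc 0 R ∪ Ioi R := (Ioc_union_Ioi_eq_Ioi hR0.le).symm
  rw [hsplit, powInt_union measurableSet_Ioi
    (disjoint_left.2 fun r h1 h2 => absurd h1.2 (not_le.2 h2))]
  refine add_le_add ?_ ((powInt_mono_set (Ioi_subset_Ioi hR) _).trans h2)
  have hlow : ∀ r ∈ Ioc 0 R, ‖W r‖ₑ ^ p * ENNReal.ofReal (r ^ (N - 1)) ≤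
      ENNReal.ofReal ((K * R ^ s) ^ p) * ENNReal.ofReal (r ^ (N / 2 - 1)) := by
    intro r hr
    have hr0 : 0 < r := hr.1
    have hy : 1 ≤ R / r := by rw [le_div_iff₀ hr0]; linarith [hr.2]
    have h3 := h.abs_sub_le hp hC hr0 hr.2
    have h4 := hdec W g h h1 R le_rfl
    have hl0 : 0 ≤ Real.log (R / r) := Real.log_nonneg hy
    have hl1 : Real.log (R / r) ^ ((p - 1) / p) ≤ 1 + Real.log (R / r) := by
      calc _ ≤ (1 + Real.log (R / r)) ^ ((p - 1) / p) := by gcongr; linarith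
        _ ≤ (1 + Real.log (R / r)) ^ (1 : ℝ) :=
            Real.rpow_le_rpow_of_exponent_le (by linarith) hq1
        _ = _ := Real.rpow_one _
    have hl2 : Real.log (R / r) ≤ (R / r) ^ s / s := Real.log_le_rpow_div (by positivity) hs0
    have hl3 : 1 ≤ (R / r) ^ s := Real.one_le_rpow hy hs0.le
    have h5 : |W r| ≤ K * (R / r) ^ s := by
      have h6 := abs_sub_abs_le_abs_sub (W r) (W R)
      rw [abs_sub_comm] at h6
      have h7 : C⁻¹ * Real.log (R / r) ^ ((p - 1) / p) ≤
          C⁻¹ * ((R / r) ^ s + (R / r) ^ s / s) := by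
        gcongr
        linarith
      calc |W r| ≤ (R / r) ^ s + C⁻¹ * ((R / r) ^ s + (R / r) ^ s / s) := by linarith
        _ = _ := by rw [hK]; ring
    have h8 : (K * (R / r) ^ s) ^ p * r ^ (N - 1) = (K * R ^ s) ^ p * r ^ (N / 2 - 1) := by
      have e : (r ^ s) ^ p = r ^ (N / 2) := by
        rw [← Real.rpow_mul hr0.le, hs]
        congr 1
        field_simp
      rw [Real.div_rpow hR0.le hr0.le, ← mul_div_assoc, Real.div_rpow (by positivity)
        (by positivity), e, div_mul_eq_mul_div, mul_div_assoc, ← Real.rpow_sub hr0]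
      congr 2
      ring
    rw [← ENNReal.ofReal_mul (by positivity), ← h8, ENNReal.ofReal_mul (by positivity),
      ← ENNReal.ofReal_rpow_of_nonneg (by positivity) hp0.le, Real.enorm_eq_ofReal_abs]
    gcongr
  calc _ ≤ ∫⁻ r in Ioc 0 R,
        ENNReal.ofReal ((K * R ^ s) ^ p) * ENNReal.ofReal (r ^ (N / 2 - 1)) :=
        setLIntegral_mono_ae' measurableSet_Ioc (Eventually.of_forall hlow)
    _ ≤ B := lintegral_mono_set fun r hr => ⟨hr.1, by linarith [hr.2]⟩

/-- Hardy's inequality near infinity, iterated. -/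
lemma exists_hardy_tail {p η : ℝ} (hp : 1 < p) (hη : -1 < η) (j : ℕ) :
    ∃ K : ℝ≥0∞, K ≠ ⊤ ∧ ∀ f : ℕ → ℝ → ℝ,
      (∀ i, i < j → HasWeakDeriv 1 (f i) (f (i + 1))) →
      (∀ i, i < j → powInt p (-1) (Ioi 1) (f i) < ⊤) →
      powInt p η (Ioi 1) (f 0) ≤ K * powInt p (η + j * p) (Ioi 1) (f j) := by
  have hp0 : 0 < p := by linarith
  induction j with
  | zero => exact ⟨1, ENNReal.one_ne_top, fun f _ _ => by simp⟩
  | succ j ih =>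
    obtain ⟨K, hK, hb⟩ := ih
    set a := (η + 1) / p + j with ha
    have ha0 : 0 < a := add_pos_of_pos_of_nonneg (div_pos (by linarith) hp0) j.cast_nonneg
    refine ⟨K * ENNReal.ofReal (|a| ^ (-p)), ENNReal.mul_ne_top hK ENNReal.ofReal_ne_top,
      fun f hd hf => ?_⟩
    refine (hb f (fun i hi => hd i (by omega)) fun i hi => hf i (by omega)).trans ?_
    rw [mul_assoc]
    refine mul_le_mul' le_rfl ?_
    have := (hd j (by omega)).hardy_Ioi hp ha0 zero_le_one (hf j (by omega))
    have e1 : a * p - 1 = η + j * p := by rw [ha]; field_simp; ring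
    have e2 : (a + 1) * p - 1 = η + (j + 1 : ℕ) * p := by
      rw [ha]; push_cast; field_simp; ring
    rwa [e1, e2] at this

/-- Convergence of integrals for sequences that are dominated up to a uniformly small error. -/
lemma tendsto_lintegral_of_approx_dominated {X : Type*} [MeasurableSpace X] {μ : Measure X}
    {Φ : ℕ → X → ℝ≥0∞} {Φ₀ : X → ℝ≥0∞} (hm : ∀ n, AEMeasurable (Φ n) μ)
    (hlim : ∀ᵐ x ∂μ, Tendsto (fun n => Φ n x) atTop (𝓝 (Φ₀ x))) {Q : ℝ≥0∞} (hQ : Q ≠ ⊤)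
    (hdom : ∀ ε : ℝ, 0 < ε → ∃ H : X → ℝ≥0∞, AEMeasurable H μ ∧ ∫⁻ x, H x ∂μ ≠ ⊤ ∧
      ∀ n, ∫⁻ x, (Φ n x - H x) ∂μ ≤ ENNReal.ofReal ε * Q) :
    (∀ n, ∫⁻ x, Φ n x ∂μ ≠ ⊤) ∧ ∫⁻ x, Φ₀ x ∂μ ≠ ⊤ ∧
      Tendsto (fun n => ∫⁻ x, Φ n x ∂μ) atTop (𝓝 (∫⁻ x, Φ₀ x ∂μ)) := by
  have hfatou : ∫⁻ x, Φ₀ x ∂μ ≤ liminf (fun n => ∫⁻ x, Φ n x ∂μ) atTop := by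
    refine le_trans (le_of_eq (lintegral_congr_ae ?_)) (lintegral_liminf_le' hm)
    filter_upwards [hlim] with x hx
    exact hx.liminf_eq.symm
  have hsplit : ∀ (n : ℕ) (H : X → ℝ≥0∞), AEMeasurable H μ →
      ∫⁻ x, Φ n x ∂μ = ∫⁻ x, min (Φ n x) (H x) ∂μ + ∫⁻ x, (Φ n x - H x) ∂μ := fun n H hH => by
    rw [← lintegral_add_left' ((hm n).min hH)]
    refine lintegral_congr fun x => ?_
    rcases le_total (Φ n x) (H x) with h | h
    · rw [min_eq_left h, tsub_eq_zero_of_le h, add_zero]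
    · rw [min_eq_right h, add_tsub_cancel_of_le h]
  obtain ⟨H₁, m₁, f₁, b₁⟩ := hdom 1 one_pos
  have hbound : ∀ n, ∫⁻ x, Φ n x ∂μ ≤ ∫⁻ x, H₁ x ∂μ + Q := fun n => by
    rw [hsplit n H₁ m₁]
    refine add_le_add (lintegral_mono fun x => min_le_right _ _) ((b₁ n).trans (by simp))
  have hfin : ∫⁻ x, H₁ x ∂μ + Q < ⊤ := ENNReal.add_lt_top.2 ⟨f₁.lt_top, hQ.lt_top⟩
  have hsup : limsup (fun n => ∫⁻ x, Φ n x ∂μ) atTop ≤ ∫⁻ x, Φ₀ x ∂μ := by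
    have key : ∀ ε : ℝ, 0 < ε → limsup (fun n => ∫⁻ x, Φ n x ∂μ) atTop ≤
        ∫⁻ x, Φ₀ x ∂μ + ENNReal.ofReal ε * Q := fun ε hε => by
      obtain ⟨H, mH, fH, bH⟩ := hdom ε hε
      have ht : Tendsto (fun n => ∫⁻ x, min (Φ n x) (H x) ∂μ) atTop
          (𝓝 (∫⁻ x, min (Φ₀ x) (H x) ∂μ)) := by
        refine tendsto_lintegral_of_dominated_convergence' H (fun n => (hm n).min mH)
          (fun n => Eventually.of_forall fun x => min_le_right _ _) fH ?_
        filter_upwards [hlim] with x hx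
        exact hx.min tendsto_const_nhds
      have ht2 := ht.add_const (ENNReal.ofReal ε * Q)
      calc _ ≤ limsup (fun n => ∫⁻ x, min (Φ n x) (H x) ∂μ + ENNReal.ofReal ε * Q) atTop := by
            refine limsup_le_limsup (Eventually.of_forall fun n => ?_)
            simp only
            rw [hsplit n H mH]
            gcongr
            exact bH n
        _ = _ := ht2.limsup_eq
        _ ≤ _ := by
            gcongr
            exact min_le_left _ _
    have hl : Tendsto (fun ε : ℝ => ∫⁻ x, Φ₀ x ∂μ + ENNReal.ofReal ε * Q) (𝓝[>] 0)
        (𝓝 (∫⁻ x, Φ₀ x ∂μ)) := by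
      have h1 : Tendsto (fun ε : ℝ => ENNReal.ofReal ε * Q) (𝓝[>] 0) (𝓝 (0 * Q)) := by
        refine ENNReal.Tendsto.mul_const ?_ (Or.inr hQ)
        have := (ENNReal.continuous_ofReal.tendsto 0).mono_left
          (nhdsWithin_le_nhds (s := Ioi (0 : ℝ)))
        simpa using this
      simpa using h1.const_add (∫⁻ x, Φ₀ x ∂μ)
    exact ge_of_tendsto hl (by
      filter_upwards [self_mem_nhdsWithin] with ε hε
      exact key ε hε)
  refine ⟨fun n => ((hbound n).trans_lt hfin).ne, ?_,
    tendsto_of_le_liminf_of_limsup_le hfatou hsup⟩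
  refine ne_top_of_le_ne_top hfin.ne (hfatou.trans ?_)
  refine (liminf_le_limsup).trans ?_
  exact limsup_le_of_le (by isBoundedDefault) (Eventually.of_forall hbound)

/-- A Caratheodory function composed with a measurable one is measurable. -/
lemma aemeasurable_caratheodory {μ : Measure ℝ} {F : ℝ → ℝ → ℝ}
    (hFmeas : ∀ t, 0 ≤ t → AEMeasurable (fun r => F r t) μ)
    (hFcont : ∀ᵐ r ∂μ, ContinuousOn (F r) (Ici 0)) {w : ℝ → ℝ} (hw : AEMeasurable w μ) :
    AEMeasurable (fun r => F r |w r|) μ := by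
  set v := fun r => |hw.mk w r| with hv
  have hvm : Measurable v := measurable_abs.comp hw.measurable_mk
  have hcong : (fun r => F r |w r|) =ᵐ[μ] fun r => F r (v r) := by
    filter_upwards [hw.ae_eq_mk] with r hr
    rw [hr]
  refine AEMeasurable.congr ?_ hcong.symm
  have happrox : ∀ n : ℕ, AEMeasurable (fun r => F r ((⌊v r * n⌋₊ : ℝ) / n)) μ := by
    intro n
    have hfl : Measurable fun r => ⌊v r * n⌋₊ := Nat.measurable_floor.comp (hvm.mul_const _)
    have hU : (⋃ i : ℕ, {r | ⌊v r * n⌋₊ = i}) = univ := by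
      ext r; simp
    rw [← Measure.restrict_univ (μ := μ), ← hU, aemeasurable_iUnion_iff]
    intro i
    refine ((hFmeas ((i : ℝ) / n) (by positivity)).restrict).congr ?_
    filter_upwards [ae_restrict_mem (hfl (measurableSet_singleton i))] with r hr
    have : ⌊v r * n⌋₊ = i := hr
    rw [this]
  refine aemeasurable_of_tendsto_metrizable_ae atTop happrox ?_
  filter_upwards [hFcont] with r hr
  have h0 : 0 ≤ v r := abs_nonneg _
  have h1 : Tendsto (fun n : ℕ => (⌊v r * n⌋₊ : ℝ) / n) atTop (𝓝 (v r)) :=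
    (tendsto_nat_floor_mul_div_atTop h0).comp tendsto_natCast_atTop_atTop
  refine (hr (v r) h0).tendsto.comp (tendsto_nhdsWithin_iff.2 ⟨h1, Eventually.of_forall fun n => ?_⟩)
  exact mem_Ici.2 (by positivity)

lemma exists_le_mul_rpow_of_small {F : ℝ → ℝ → ℝ} {p : ℝ} (hp : 0 < p)
    (hFcont : ∀ r, 0 ≤ r → ContinuousOn (F r) (Ici 0))
    (hFzero : TendstoUniformlyOn (fun t r => F r t * t ^ (-p)) (fun _ => 0) (𝓝[>] 0) (Ici 0))
    {ε : ℝ} (hε : 0 < ε) :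
    ∃ δ : ℝ, 0 < δ ∧ ∀ r, 0 ≤ r → ∀ t, 0 ≤ t → t < δ → F r t ≤ ε * t ^ p := by
  obtain ⟨δ, hδ, h⟩ := mem_nhdsGT_iff_exists_Ioo_subset.1
    (Metric.tendstoUniformlyOn_iff.1 hFzero ε hε)
  have key : ∀ r, 0 ≤ r → ∀ t, 0 < t → t < δ → F r t ≤ ε * t ^ p := fun r hr t ht htδ => by
    have h1 := h ⟨ht, htδ⟩ r hr
    rw [dist_zero_left, Real.norm_eq_abs] at h1
    have h2 := (le_abs_self _).trans h1.le
    rwa [Real.rpow_neg ht.le, ← div_eq_mul_inv, div_le_iff₀ (by positivity)] at h2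
  refine ⟨δ, hδ, fun r hr t ht htδ => ?_⟩
  rcases ht.eq_or_lt with rfl | ht
  · have l1 : Tendsto (F r) (𝓝[>] 0) (𝓝 (F r 0)) :=
      ((hFcont r hr) 0 self_mem_Ici).tendsto.mono_left (nhdsWithin_mono _ Ioi_subset_Ici_self)
    have l2 : Tendsto (fun t : ℝ => ε * t ^ p) (𝓝[>] 0) (𝓝 (ε * 0 ^ p)) :=
      (((Real.continuousAt_rpow_const 0 p (Or.inr hp.le)).tendsto).const_mul ε).mono_left
        nhdsWithin_le_nhds
    refine le_of_tendsto_of_tendsto l1 l2 ?_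
    filter_upwards [Ioo_mem_nhdsGT (mem_Ioi.1 hδ)] with t ht
    exact key r hr t ht.1 ht.2
  · exact key r hr t ht htδ

lemma exists_le_mul_exp_of_large {F : ℝ → ℝ → ℝ} {P β : ℝ}
    (hFinfty : TendstoUniformlyOn (fun t r => F r t * t ^ P * Real.exp (-(β * t ^ P)))
      (fun _ => 0) atTop (Ici 0)) {ε : ℝ} (hε : 0 < ε) (hβ : 0 < β) :
    ∃ T : ℝ, 0 < T ∧ ∀ r, 0 ≤ r → ∀ t, T ≤ t →
      F r t ≤ ε * β * (Real.exp (β * t ^ P) / (β * t ^ P)) := by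
  obtain ⟨T, hT⟩ := eventually_atTop.1 (Metric.tendstoUniformlyOn_iff.1 hFinfty ε hε)
  refine ⟨max T 1, lt_max_of_lt_right one_pos, fun r hr t ht => ?_⟩
  have ht0 : 0 < t := lt_of_lt_of_le one_pos ((le_max_right _ _).trans ht)
  have h1 := hT t ((le_max_left _ _).trans ht) r hr
  rw [dist_zero_left, Real.norm_eq_abs] at h1
  have h2 := (le_abs_self _).trans h1.le
  have hP : 0 < t ^ P := by positivity
  rw [Real.exp_neg, ← div_eq_mul_inv, div_le_iff₀ (Real.exp_pos _), ← le_div_iff₀ hP] at h2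
  refine h2.trans (le_of_eq ?_)
  field_simp

/-- Continuity of a functional with critical growth along sequences of bounded energy. -/
theorem tendsto_lintegral_critical {p C a N M : ℝ} (hp : 1 < p) (hC : 0 < C) (ha : -1 < a)
    (hN : 0 < N) (hM : 0 ≤ M) {M' : ℝ≥0∞} (hM' : M' ≠ ⊤) {F : ℝ → ℝ → ℝ}
    (hFmeas : ∀ t, 0 ≤ t → AEMeasurable (fun r => F r t) (volume.restrict (Ioi 0)))
    (hFcont : ∀ r, 0 ≤ r → ContinuousOn (F r) (Ici 0))
    (hFbdd : ∀ B : Set (ℝ × ℝ), B ⊆ Ici 0 ×ˢ Ici 0 → Bornology.IsBounded B →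
      Bornology.IsBounded ((fun x : ℝ × ℝ => F x.1 x.2) '' B))
    (hFzero : TendstoUniformlyOn (fun t r => F r t * t ^ (-p)) (fun _ => 0) (𝓝[>] 0) (Ici 0))
    (hFinfty : TendstoUniformlyOn
      (fun t r => F r t * t ^ (p / (p - 1)) *
        Real.exp (-(N * C ^ (p / (p - 1)) * t ^ (p / (p - 1)))))
      (fun _ => 0) atTop (Ici 0))
    {W : ℕ → ℝ → ℝ} {g : ℕ → ℝ → ℝ} {W₀ : ℝ → ℝ} (hW : ∀ n, BoundedEnergy p C (W n) (g n))
    (hWa : ∀ n, powInt p a (Ioi 1) (W n) ≤ ENNReal.ofReal M)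
    (hWN : ∀ n, powInt p (N - 1) (Ioi 1) (W n) ≤ M')
    (hlim : ∀ r, 0 < r → Tendsto (fun n => W n r) atTop (𝓝 (W₀ r))) :
    (∀ n, ∫⁻ r in Ioi (0 : ℝ), ENNReal.ofReal (F r |W n r| * r ^ (N - 1)) ≠ ⊤) ∧
    ∫⁻ r in Ioi (0 : ℝ), ENNReal.ofReal (F r |W₀ r| * r ^ (N - 1)) ≠ ⊤ ∧
    Tendsto (fun n => ∫⁻ r in Ioi (0 : ℝ), ENNReal.ofReal (F r |W n r| * r ^ (N - 1))) atTop
      (𝓝 (∫⁻ r in Ioi (0 : ℝ), ENNReal.ofReal (F r |W₀ r| * r ^ (N - 1)))) := by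
  have hp0 : 0 < p := by linarith
  have hp1 : 0 < p - 1 := by linarith
  obtain ⟨A, hA⟩ := exists_mass_bound hp hC ha hN hM hM'
  obtain ⟨K, hK, hexp⟩ := exists_exp_bound hp hC hN A
  have hmass : ∀ n, powInt p (N - 1) (Ioi 0) (W n) ≤ ENNReal.ofReal A := fun n =>
    hA (W n) (g n) (hW n) (hWa n) (hWN n)
  set β := N * C ^ (p / (p - 1)) with hβ
  have hβ0 : 0 < β := by positivity
  set κ := N ^ ((p - 1) / p) * C with hκ
  have hκ0 : 0 < κ := by positivity
  have hWm : ∀ n, AEMeasurable (W n) (volume.restrict (Ioi 0)) := fun n =>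
    (hW n).cont.aemeasurable measurableSet_Ioi
  refine tendsto_lintegral_of_approx_dominated (Q := ENNReal.ofReal β * K + ENNReal.ofReal A)
    (fun n => ?_) ?_ (ENNReal.add_ne_top.2 ⟨ENNReal.mul_ne_top ENNReal.ofReal_ne_top hK,
      ENNReal.ofReal_ne_top⟩) fun ε hε => ?_
  · refine ENNReal.measurable_ofReal.comp_aemeasurable ((aemeasurable_caratheodory hFmeas ?_
      (hWm n)).mul (measurable_id.pow_const _).aemeasurable)
    filter_upwards [ae_restrict_mem measurableSet_Ioi] with r hr
    exact hFcont r (le_of_lt hr)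
  · filter_upwards [ae_restrict_mem measurableSet_Ioi] with r hr
    refine (ENNReal.continuous_ofReal.tendsto _).comp (Tendsto.mul_const _ ?_)
    exact ((hFcont r (le_of_lt hr)) |W₀ r| (mem_Ici.2 (abs_nonneg _))).tendsto.comp
      (tendsto_nhdsWithin_iff.2 ⟨(hlim r hr).abs, Eventually.of_forall fun n =>
        mem_Ici.2 (abs_nonneg (W n r))⟩)
  · obtain ⟨δ, hδ, hsmall⟩ := exists_le_mul_rpow_of_small hp0 hFcont hFzero hε
    obtain ⟨T₀, hT₀, hlarge⟩ := exists_le_mul_exp_of_large hFinfty hε hβ0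
    obtain ⟨R, hR, hdec⟩ := exists_uniform_decay hp hC ha hM hδ
    set T := max T₀ κ⁻¹ with hT
    have hbd : Bornology.IsBounded (Icc (0 : ℝ) R ×ˢ Icc (0 : ℝ) T) :=
      Metric.isBounded_Icc _ _ |>.prod (Metric.isBounded_Icc _ _)
    obtain ⟨b, hb⟩ := (hFbdd _ (prod_mono Icc_subset_Ici_self Icc_subset_Ici_self)
      hbd).exists_norm_le
    have hb' : ∀ r t, 0 ≤ r → r ≤ R → 0 ≤ t → t ≤ T → F r t ≤ b := fun r t h1 h2 h3 h4 =>
      (le_abs_self _).trans (hb _ ⟨(r, t), ⟨⟨h1, h2⟩, ⟨h3, h4⟩⟩, rfl⟩)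
    set H : ℝ → ℝ≥0∞ := (Ioo 0 R).indicator fun r => ENNReal.ofReal b * ENNReal.ofReal (r ^ (N - 1))
      with hH
    refine ⟨H, ?_, ?_, fun n => ?_⟩
    · exact ((measurable_ofReal_rpow _).const_mul _).indicator measurableSet_Ioo |>.aemeasurable
    · rw [hH, setLIntegral_indicator measurableSet_Ioo, inter_eq_left.2 Ioo_subset_Ioi_self,
        lintegral_const_mul' _ _ ENNReal.ofReal_ne_top, lintegral_Ioo_rpow hN (by linarith)]
      exact ENNReal.mul_ne_top ENNReal.ofReal_ne_top ENNReal.ofReal_ne_top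
    · set X : ℝ → ℝ≥0∞ := fun r => {r | 1 ≤ κ * |W n r|}.indicator (fun r =>
        ENNReal.ofReal (Real.exp (β * |W n r| ^ (p / (p - 1))) /
          (β * |W n r| ^ (p / (p - 1))))) r * ENNReal.ofReal (r ^ (N - 1)) with hX
      have hptw : ∀ r ∈ Ioi (0 : ℝ), ENNReal.ofReal (F r |W n r| * r ^ (N - 1)) - H r ≤
          ENNReal.ofReal ε * (ENNReal.ofReal β * X r) +
            ENNReal.ofReal ε * (‖W n r‖ₑ ^ p * ENNReal.ofReal (r ^ (N - 1))) := by
        intro r hr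
        have hr0 : 0 < r := hr
        have ht0 := abs_nonneg (W n r)
        rcases le_or_gt T |W n r| with h1 | h1
        · have hmem : r ∈ {r | 1 ≤ κ * |W n r|} := by
            have : κ⁻¹ ≤ |W n r| := (le_max_right _ _).trans h1
            rwa [inv_le_iff_one_le_mul₀' hκ0] at this
          have ht1 : 0 < |W n r| := (hT₀.trans_le (le_max_left _ _)).trans_le h1
          refine tsub_le_self.trans (le_trans ?_ le_self_add)
          rw [hX]
          simp only
          rw [indicator_of_mem hmem, ← ENNReal.ofReal_mul (by positivity),
            ← ENNReal.ofReal_mul hβ0.le, ← ENNReal.ofReal_mul hε.le]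
          refine ENNReal.ofReal_le_ofReal ?_
          have := hlarge r hr0.le _ ((le_max_left _ _).trans h1)
          calc _ ≤ ε * β * (Real.exp (β * |W n r| ^ (p / (p - 1))) /
                (β * |W n r| ^ (p / (p - 1)))) * r ^ (N - 1) := by gcongr
            _ = _ := by ring
        · rcases lt_or_ge |W n r| δ with h2 | h2
          · refine tsub_le_self.trans (le_trans ?_ le_add_self)
            rw [Real.enorm_eq_ofReal_abs, ENNReal.ofReal_rpow_of_nonneg ht0 hp0.le,
              ← ENNReal.ofReal_mul (by positivity), ← ENNReal.ofReal_mul hε.le]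
            refine ENNReal.ofReal_le_ofReal ?_
            rw [← mul_assoc]
            gcongr
            exact hsmall r hr0.le _ ht0 h2
          · have hrR : r < R := by
              by_contra! hle
              exact absurd (hdec (W n) (g n) (hW n) (hWa n) r hle) (not_lt.2 h2)
            have hle : ENNReal.ofReal (F r |W n r| * r ^ (N - 1)) ≤ H r := by
              rw [hH, indicator_of_mem (show r ∈ Ioo 0 R from ⟨hr0, hrR⟩), ← ENNReal.ofReal_mul' (by positivity)]
              refine ENNReal.ofReal_le_ofReal ?_
              gcongr
              exact hb' r _ hr0.le hrR.le ht0 h1.le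
            rw [tsub_eq_zero_of_le hle]
            exact bot_le
      have hm2 : AEMeasurable (fun r => ENNReal.ofReal ε *
          (‖W n r‖ₑ ^ p * ENNReal.ofReal (r ^ (N - 1)))) (volume.restrict (Ioi 0)) :=
        (((hWm n).enorm.pow_const p).mul (measurable_ofReal_rpow _).aemeasurable).const_mul _
      calc _ ≤ ∫⁻ r in Ioi (0 : ℝ), (ENNReal.ofReal ε * (ENNReal.ofReal β * X r) +
            ENNReal.ofReal ε * (‖W n r‖ₑ ^ p * ENNReal.ofReal (r ^ (N - 1)))) :=
            setLIntegral_mono_ae' measurableSet_Ioi (Eventually.of_forall hptw)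
        _ = ENNReal.ofReal ε * (ENNReal.ofReal β * ∫⁻ r in Ioi (0 : ℝ), X r) +
            ENNReal.ofReal ε * powInt p (N - 1) (Ioi 0) (W n) := by
            rw [lintegral_add_right' _ hm2, lintegral_const_mul' _ _ ENNReal.ofReal_ne_top,
              lintegral_const_mul' _ _ ENNReal.ofReal_ne_top,
              lintegral_const_mul' _ _ ENNReal.ofReal_ne_top, powInt]
        _ ≤ ENNReal.ofReal ε * (ENNReal.ofReal β * K) + ENNReal.ofReal ε * ENNReal.ofReal A := by
            gcongr
            · exact hexp (W n) (g n) (hW n) (hmass n)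
            · exact hmass n
        _ = _ := by rw [← mul_add]

lemma integrableOn_of_lintegral_ne_top {h : ℝ → ℝ}
    (hm : AEStronglyMeasurable h (volume.restrict (Ioi 0)))
    (h0 : ∀ᵐ r ∂volume.restrict (Ioi (0 : ℝ)), 0 ≤ h r)
    (hfin : ∫⁻ r in Ioi (0 : ℝ), ENNReal.ofReal (h r) ≠ ⊤) : IntegrableOn h (Ioi 0) :=
  (lintegral_ofReal_ne_top_iff_integrable hm h0).1 hfin

section Energy

variable {k : ℕ} {p : ℝ} [Fact (1 ≤ p)] {α : Fin (k + 1) → ℝ}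

/-- The weight exponents, indexed by natural numbers. -/
noncomputable def weightExp (α : Fin (k + 1) → ℝ) (j : ℕ) : ℝ :=
  if h : j < k + 1 then α ⟨j, h⟩ else 0

lemma powInt_jetFn_le' (u : sobolevX k p α) (hp : 0 < p) {j : ℕ} (h : j ≤ k) :
    powInt p (weightExp α j) (Ioi 0) (jetFn u j) ≤ ‖u‖ₑ ^ p := by
  rw [weightExp, dif_pos (Nat.lt_succ_of_le h)]
  exact powInt_jetFn_le u hp _

lemma powInt_jetFn_lt_top (u : sobolevX k p α) (hp : 0 < p) {j : ℕ} (h : j ≤ k) :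
    powInt p (weightExp α j) (Ioi 0) (jetFn u j) < ⊤ :=
  (powInt_jetFn_le' u hp h).trans_lt (ENNReal.rpow_lt_top_of_nonneg hp.le (by simp))

lemma powInt_jetFn_one_le (hk : 1 ≤ k) (hp : 1 < p) {θ γ : ℝ}
    (hαk : weightExp α k = k * p - 1)
    (hα : ∀ i : ℕ, 1 ≤ i → i ≤ k → i * p - 1 ≤ weightExp α i)
    (hc : ∀ j, 1 ≤ j → j < k → 0 < hardyConst θ γ j) (u : sobolevX k p α)
    (hgrad : eLpNorm (gradL θ γ k (sobolevFn u)) (ENNReal.ofReal p)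
      (weightMeasure (weightExp α k + ((k / 2 : ℕ) : ℝ) * (θ - γ) * p)) ≤ 1) :
    powInt p (p - 1) (Ioi 0) (jetFn u 1) ≤
      ENNReal.ofReal ((∏ j ∈ Finset.Ico 1 k, hardyConst θ γ j) ^ (-p)) := by
  have hp0 : 0 < p := by linarith
  have hd : ∀ i, i < k → HasWeakDeriv 1 (jetFn u i) (jetFn u (i + 1)) := fun i hi =>
    hasWeakDeriv_jetFn u hi
  have hchain := gradL_chain (θ := θ) (γ := γ) hp hk (hd 0 (by omega)) (fun i _ hi => hd i hi)
    (powInt_deriv_lt_top hp hd hα hαk fun i hi => powInt_jetFn_lt_top u hp0 hi)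
    fun j h1 h2 => (hc j h1 h2).ne'
  have hprod : 0 < ∏ j ∈ Finset.Ico 1 k, hardyConst θ γ j :=
    Finset.prod_pos fun j hj => hc j (Finset.mem_Ico.1 hj).1 (Finset.mem_Ico.1 hj).2
  have hν : weightExp α k + ((k / 2 : ℕ) : ℝ) * (θ - γ) * p = gradExp θ γ k * p - 1 := by
    have h2 : (k : ℝ) = 2 * ((k / 2 : ℕ) : ℝ) + ((k % 2 : ℕ) : ℝ) := by
      exact_mod_cast (Nat.div_add_mod k 2).symm
    rw [hαk, gradExp]
    nth_rewrite 1 [h2]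
    ring
  rw [abs_of_pos hprod] at hchain
  refine hchain.trans (mul_le_of_le_one_right bot_le ?_)
  rw [← hν, ← eLpNorm_weightMeasure_rpow hp0, jetFn_zero]
  exact ENNReal.rpow_le_one hgrad hp0.le

end Energy

theorem mainTheorem9
    (k : ℕ) (hk : 1 ≤ k) (p : ℝ) [Fact (1 ≤ p)] (hp : 1 < p)
    (α : Fin (k + 1) → ℝ) (η θ γ : ℝ)
    (hαk : α (Fin.last k) - k * p + 1 = 0)
    (hα : ∀ i : Fin (k + 1), 1 ≤ (i : ℕ) →
      α (Fin.last k) - ((k : ℝ) - ((i : ℕ) : ℝ)) * p ≤ α i)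
    (hη : -1 < η) (hθγ : γ < θ + 2)
    (hθ : ((k / 2 : ℕ) : ℝ) * (θ + 2 - γ) - 1 < θ)
    (hγ : γ = (2 * p - 1 + (p - 1) * η) / p)
    (hα0 : -1 < α 0)
    -- the parameter condition for `X^{k,p}_∞ ⊆ L^p_η`, for instance `η ≤ α_0`
    (hηα : ∃ j : Fin (k + 1), η ≤ α j - ((j : ℕ) : ℝ) * p)
    -- `F : [0, ∞) × [0, ∞) → [0, ∞)` is a Caratheodory function
    (F : ℝ → ℝ → ℝ)
    (hF0 : ∀ r, 0 ≤ r → ∀ t, 0 ≤ t → 0 ≤ F r t)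
    (hFmeas : ∀ t, 0 ≤ t → AEMeasurable (fun r => F r t) (volume.restrict (Ioi 0)))
    (hFcont : ∀ r, 0 ≤ r → ContinuousOn (F r) (Ici 0))
    (hFbdd : ∀ B : Set (ℝ × ℝ), B ⊆ Ici 0 ×ˢ Ici 0 → Bornology.IsBounded B →
      Bornology.IsBounded ((fun x : ℝ × ℝ => F x.1 x.2) '' B))
    (hFzero : TendstoUniformlyOn (fun t r => F r t * t ^ (-p)) (fun _ => 0) (𝓝[>] 0) (Ici 0))
    (hFinfty : TendstoUniformlyOn
      (fun t r => F r t * t ^ (p / (p - 1)) *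
        Real.exp (-(betaCrit k p η θ γ * t ^ (p / (p - 1)))))
      (fun _ => 0) atTop (Ici 0))
    (u : ℕ → sobolevX k p α) (u₀ : sobolevX k p α)
    (hweak : Tendsto (fun n => toWeakSpace ℝ (sobolevX k p α) (u n)) atTop
      (𝓝 (toWeakSpace ℝ (sobolevX k p α) u₀)))
    (hgrad : ∀ n, eLpNorm (gradL θ γ k (sobolevFn (u n))) (ENNReal.ofReal p)
      (weightMeasure (α (Fin.last k) + ((k / 2 : ℕ) : ℝ) * (θ - γ) * p)) ≤ 1) :
    (∀ n, IntegrableOn (fun r => F r |sobolevFn (u n) r| * r ^ η) (Ioi 0)) ∧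
    IntegrableOn (fun r => F r |sobolevFn u₀ r| * r ^ η) (Ioi 0) ∧
    Tendsto (fun n => ∫ r in Ioi (0 : ℝ), F r |sobolevFn (u n) r| * r ^ η) atTop
      (𝓝 (∫ r in Ioi (0 : ℝ), F r |sobolevFn u₀ r| * r ^ η)) := by
  have hp0 : 0 < p := by linarith
  have hN : 0 < η + 1 := by linarith
  have hγ1 : 1 < γ := by
    rw [hγ, lt_div_iff₀ hp0]
    nlinarith
  have eα : ∀ j : Fin (k + 1), weightExp α j = α j := fun j => dif_pos j.2
  have eαk : weightExp α k = α (Fin.last k) := eα (Fin.last k)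
  have eα0 : weightExp α 0 = α 0 := eα 0
  have hαk' : weightExp α k = k * p - 1 := by rw [eαk]; linarith
  have hα' : ∀ i : ℕ, 1 ≤ i → i ≤ k → i * p - 1 ≤ weightExp α i := fun i h1 h2 => by
    have h3 := hα ⟨i, Nat.lt_succ_of_le h2⟩ h1
    rw [← eα ⟨i, Nat.lt_succ_of_le h2⟩] at h3
    simp only at h3
    linarith
  have hc : ∀ j, 1 ≤ j → j < k → 0 < hardyConst θ γ j := fun j h1 h2 =>
    hardyConst_pos hθγ hθ h1 h2
  rw [betaCrit_eq hk hθγ hγ1 hθ] at hFinfty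
  set C := ∏ j ∈ Finset.Ico 1 k, hardyConst θ γ j with hCdef
  have hC : 0 < C := Finset.prod_pos fun j hj =>
    hc j (Finset.mem_Ico.1 hj).1 (Finset.mem_Ico.1 hj).2
  obtain ⟨M, hM⟩ := exists_norm_le_of_tendsto_weak hweak
  have hMenorm : ∀ n, ‖u n‖ₑ ^ p ≤ ENNReal.ofReal (max M 0 ^ p) := fun n => by
    rw [← ENNReal.ofReal_rpow_of_nonneg (le_max_right _ _) hp0.le, ← ofReal_norm]
    gcongr
    exact (hM n).trans (le_max_left _ _)
  choose W hWae hWc hWd using fun n => (hasWeakDeriv_jetFn (u n) (j := 0) (by omega)).exists_repr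
  obtain ⟨W₀, hW₀ae, hW₀c, hW₀d⟩ := (hasWeakDeriv_jetFn u₀ (j := 0) (by omega)).exists_repr
  have hBE : ∀ n, BoundedEnergy p C (W n) (jetFn (u n) 1) := fun n =>
    ⟨hWc n, hWd n, (hasWeakDeriv_jetFn_zero (u n) hk).2.1,
      powInt_jetFn_one_le hk hp hαk' hα' hc (u n) (by rw [eαk]; exact hgrad n)⟩
  have hlim : ∀ r, 0 < r → Tendsto (fun n => W n r) atTop (𝓝 (W₀ r)) := fun r hr =>
    tendsto_repr hp hk hweak hWae hW₀ae hWc hW₀c hWd hW₀d hr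
  have hIoi1 : Ioi (1 : ℝ) ⊆ Ioi 0 := Ioi_subset_Ioi zero_le_one
  have hWa : ∀ n, powInt p (α 0) (Ioi 1) (W n) ≤ ENNReal.ofReal (max M 0 ^ p) := fun n => by
    rw [← powInt_congr hIoi1 (hWae n), ← eα0]
    exact ((powInt_mono_set hIoi1 _).trans
      (powInt_jetFn_le' (u n) hp0 (Nat.zero_le k))).trans (hMenorm n)
  obtain ⟨j, hj⟩ := hηα
  obtain ⟨K, hK, hKb⟩ := exists_hardy_tail hp hη (j : ℕ)
  have hjk : (j : ℕ) ≤ k := Nat.lt_succ_iff.1 j.2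
  have hWN : ∀ n, powInt p (η + 1 - 1) (Ioi 1) (W n) ≤ K * ENNReal.ofReal (max M 0 ^ p) :=
    fun n => by
      rw [← powInt_congr hIoi1 (hWae n), add_sub_cancel_right]
      refine (hKb (jetFn (u n)) (fun i hi => hasWeakDeriv_jetFn (u n) (by omega))
        fun i hi => ?_).trans (mul_le_mul' le_rfl ?_)
      · refine lt_of_le_of_lt ((powInt_Ioi_one_mono (c := weightExp α i) ?_ _).trans
          (powInt_mono_set hIoi1 _)) (powInt_jetFn_lt_top (u n) hp0 (by omega))
        rcases Nat.eq_zero_or_pos i with rfl | hi0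
        · rw [eα0]; exact hα0.le
        · have := hα' i hi0 (by omega)
          have : 0 ≤ (i : ℝ) * p := by positivity
          linarith
      · refine ((powInt_Ioi_one_mono (c := weightExp α j) ?_ _).trans
          (powInt_mono_set hIoi1 _)).trans
          ((powInt_jetFn_le' (u n) hp0 hjk).trans (hMenorm n))
        rw [eα j]
        linarith
  obtain ⟨f1, f2, f3⟩ := tendsto_lintegral_critical hp hC hα0 hN (by positivity)
    (ENNReal.mul_ne_top hK ENNReal.ofReal_ne_top) hFmeas hFcont hFbdd hFzero hFinfty hBE hWa hWN
    hlim
  simp only [add_sub_cancel_right] at f1 f2 f3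
  have hm : ∀ V : ℝ → ℝ, ContinuousOn V (Ioi 0) →
      AEStronglyMeasurable (fun r => F r |V r| * r ^ η) (volume.restrict (Ioi 0)) := fun V hV => by
    refine AEMeasurable.aestronglyMeasurable ((aemeasurable_caratheodory hFmeas ?_
      (hV.aemeasurable measurableSet_Ioi)).mul (measurable_id.pow_const _).aemeasurable)
    filter_upwards [ae_restrict_mem measurableSet_Ioi] with r hr
    exact hFcont r (le_of_lt hr)
  have hnn : ∀ V : ℝ → ℝ, ∀ᵐ r ∂volume.restrict (Ioi (0 : ℝ)), 0 ≤ F r |V r| * r ^ η :=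
    fun V => by
      filter_upwards [ae_restrict_mem measurableSet_Ioi] with r hr
      have hr0 : (0 : ℝ) < r := hr
      exact mul_nonneg (hF0 r hr0.le _ (abs_nonneg _)) (by positivity)
  have hae : ∀ (v : sobolevX k p α) (V : ℝ → ℝ), jetFn v 0 =ᵐ[volume.restrict (Ioi 0)] V →
      (fun r => F r |V r| * r ^ η) =ᵐ[volume.restrict (Ioi 0)]
        fun r => F r |sobolevFn v r| * r ^ η := fun v V hv => by
    rw [jetFn_zero] at hv
    filter_upwards [hv] with r hr
    rw [hr]
  refine ⟨fun n => ?_, ?_, ?_⟩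
  · exact (integrableOn_of_lintegral_ne_top (hm _ (hWc n)) (hnn _) (f1 n)).congr
      (hae _ _ (hWae n))
  · exact (integrableOn_of_lintegral_ne_top (hm _ hW₀c) (hnn _) f2).congr (hae _ _ hW₀ae)
  · rw [← integral_congr_ae (hae _ _ hW₀ae),
      integral_eq_lintegral_of_nonneg_ae (hnn _) (hm _ hW₀c)]
    refine ((ENNReal.tendsto_toReal f2).comp f3).congr fun n => ?_
    rw [← integral_congr_ae (hae _ _ (hWae n)),
      integral_eq_lintegral_of_nonneg_ae (hnn _) (hm _ (hWc n))]
    rfl
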